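/- \textbf{Setting.} Let $\sigma\in\mathbb{R}$ and let $\Pi$ be a Lévy measure on $\mathbb{R}$, i.e. $\Pi(\{0\})=0$ and $\int(1\wedge x^2)\,\Pi(dx)<\infty$. A Lévy–Khintchine random matrix ensemble with characteristics $(\sigma^2,0,\Pi)$ is a sequence $(C_n)_{n\ge1}$ of random $n\times n$ complex Hermitian matrices with zero diagonal such that for each $n$ the entries $C_n(j,k)$, $j<k$, are independent with identically distributed moduli, their drift is of order $1/n$, i.e. $\sup_n\max_{j\ne k} n\,\bigl|\mathbf{E}\bigl[C_n(j,k)1_{\{|C_n(j,k)|\le 1\}}\bigr]\bigr|<\infty$, and, as $n\to\infty$, $\sum_{k=1}^n\pm|C_n(1,k)|$ (the signs being independent Rademacher variables, independent of $C_n$) converges weakly to the infinitely divisible law with characteristic function $$\theta\mapsto\exp\Bigl(-\tfrac12\theta^2\sigma^2+\int_{\mathbb{R}}\Bigl(e^{i\theta x}-1-\frac{i\theta x}{1+x^2}\Bigr)\Pi(dx)\Bigr).$$ Let $\mu_{C_n}=\frac1n\sum_{j=1}^n\delta_{\lambda_j}$, with $\lambda_1,\dots,\lambda_n$ the eigenvalues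 of $C_n$, be the empirical spectral distribution, and $\mathbf{E}\mu_{C_n}$ its expectation, a probability measure on $\mathbb{R}$. The expected LSD $\mathbf{E}\mu_{C_\infty}$ is the probability measure that is the weak limit of $\mathbf{E}\mu_{C_n}$ as $n\to\infty$, if it exists. Write $M_k(\mu)=\int x^k\,\mu(dx)$. \textbf{Trees.} For integers $q_1\ge\cdots\ge q_\ell\ge1$ with $q_1+\cdots+q_\ell=p$, let $T(q_1,\dots,q_\ell)$ be the number of plane (ordered) rooted trees with $p+1$ vertices together with a coloring of the vertices, two colorings being identified if they differ only by renaming the colors, such that the root is the only vertex of its color; the other color classes have sizes $q_1,\dots,q_\ell$; any two vertices of the same color have the same distance to the root; and the parents of any two non-root vertices of the same color have the same color. Let $I_{p,\ell}$ be the sum of $T(q_1,\dots,q_\ell)$ over all partitions $(q_1,\dots,q_\ell)$ of $p$ into exactly $\ell$ parts. \textbf{Proposition.} Let $(C_n)$ be a Lévy–Khintchine ensemble with characteristics $(\sigma^2,0,\Pi)$ whose entries are bounded, $|C_n(j,k)|\le\tau$ almost surely for all $n,j,k$, for some $0<\tau<\infty$. Then $M_2(\Pi)<\infty$, the expected LSD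 $\mathbf{E}\mu_{C_\infty}$ exists, all its moments are finite, for every $p\ge0$ $$M_{2p}(\mathbf{E}\mu_{C_\infty})\le\max(\tau,1)^{2p}\sum_{\ell=0}^{p}I_{p,\ell}\,\bigl(M_2(\Pi)+\Pi([-1,1]^c)+\sigma^2\bigr)^\ell,$$ and $\mathbf{E}\mu_{C_\infty}$ is determined by its moments: it is the only probability measure on $\mathbb{R}$ with finite moments of all orders equal to its own. -/

import Mathlib

open MeasureTheory ProbabilityTheory Filter Topology
open scoped ENNReal BoundedContinuousFunction

/-! ### Measures on the line -/

/-- Weak convergence of a sequence of measures on `ℝ`: convergence of the integrals of all bounded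
continuous functions. -/
def WeaklyConverges (μ : ℕ → Measure ℝ) (ρ : Measure ℝ) : Prop :=
  ∀ f : ℝ →ᵇ ℝ, Tendsto (fun n => ∫ x, f x ∂(μ n)) atTop (𝓝 (∫ x, f x ∂ρ))

/-- The `k`-th moment `M_k(μ) = ∫ x ^ k μ(dx)`. -/
noncomputable def realMoment (k : ℕ) (μ : Measure ℝ) : ℝ := ∫ x, x ^ k ∂μ

/-- All moments of `μ` are finite, and `μ` is the only probability measure with these moments. -/
def IsDeterminedByMoments (μ : Measure ℝ) : Prop :=
  (∀ k : ℕ, Integrable (fun x : ℝ => x ^ k) μ) ∧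
    ∀ ρ : Measure ℝ, IsProbabilityMeasure ρ → (∀ k : ℕ, Integrable (fun x : ℝ => x ^ k) ρ) →
      (∀ k : ℕ, realMoment k ρ = realMoment k μ) → ρ = μ

/-- `ν` is a Lévy measure: it does not charge `0`, and `∫ (1 ∧ x²) ν(dx) < ∞`. -/
structure IsLevyMeasure (ν : Measure ℝ) : Prop where
  zero : ν {0} = 0
  finite : ∫⁻ x, ENNReal.ofReal (min 1 (x ^ 2)) ∂ν < ∞

/-- The Lévy exponent of the characteristics `(σ², b, ν)`. -/
noncomputable def levyExponent (σ b : ℝ) (ν : Measure ℝ) (θ : ℝ) : ℂ :=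
  -(1 / 2) * (θ : ℂ) ^ 2 * (σ : ℂ) ^ 2 + Complex.I * θ * b +
    ∫ x : ℝ, (Complex.exp (Complex.I * θ * x) - 1 - Complex.I * θ * x / (1 + (x : ℂ) ^ 2)) ∂ν

/-- `ρ` is the infinitely divisible law with characteristics `(σ², b, ν)`. -/
structure IsInfDivLaw (ρ : Measure ℝ) (σ b : ℝ) (ν : Measure ℝ) : Prop where
  levy : IsLevyMeasure ν
  prob : IsProbabilityMeasure ρ
  charFun_eq : ∀ θ : ℝ, (∫ x : ℝ, Complex.exp (Complex.I * θ * x) ∂ρ)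
    = Complex.exp (levyExponent σ b ν θ)

/-! ### The random matrices -/

/-- The law of a random sign. -/
noncomputable def rademacher : Measure ℝ :=
  (2 : ℝ≥0∞)⁻¹ • (Measure.dirac 1 + Measure.dirac (-1))

/-- The law of `∑ k, ± |A j k|` for a random matrix `A`, where the signs are independent
Rademacher variables that are independent of `A`. -/
noncomputable def signedRowSumLaw {Ω : Type*} [MeasurableSpace Ω] (P : Measure Ω) {n : ℕ}
    (A : Ω → Matrix (Fin n) (Fin n) ℂ) (j : Fin n) : Measure ℝ :=
  (P.prod (Measure.pi fun _ : Fin n => rademacher)).map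
    fun x : Ω × (Fin n → ℝ) => ∑ k, x.2 k * ‖A x.1 j k‖

/-- `C n` is, for each `n`, a random `n × n` Hermitian matrix with zero diagonal, with independent
entries above the diagonal whose moduli are identically distributed, such that the randomly signed
row sums of moduli converge weakly to the infinitely divisible law with characteristics
`(σ², 0, ν)`. The drift (truncated mean) of the entries is of order `1 / n`. The matrices of
different sizes may live on different probability spaces. -/
structure IsLevyKhintchineEnsemble {Ω : ℕ → Type*} [∀ n, MeasurableSpace (Ω n)]
    (P : ∀ n, Measure (Ω n)) (C : ∀ n, Ω n → Matrix (Fin n) (Fin n) ℂ)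
    (σ : ℝ) (ν : Measure ℝ) : Prop where
  measurable : ∀ n j k, Measurable fun ω => C n ω j k
  hermitian : ∀ n ω, (C n ω).IsHermitian
  diag : ∀ n ω j, C n ω j j = 0
  indep : ∀ n, iIndepFun
    (fun (e : {e : Fin n × Fin n // e.1 < e.2}) ω => C n ω e.1.1 e.1.2) (P n)
  identDistrib : ∀ n (j k j' k' : Fin n), j ≠ k → j' ≠ k' →
    IdentDistrib (fun ω => ‖C n ω j k‖) (fun ω => ‖C n ω j' k'‖) (P n) (P n)
  drift : ∃ K : ℝ, ∀ n (j k : Fin n), j ≠ k →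
    ‖∫ ω in {ω | ‖C n ω j k‖ ≤ 1}, C n ω j k ∂(P n)‖ ≤ K / n
  rowSum : ∃ ρ : Measure ℝ, IsInfDivLaw ρ σ 0 ν ∧
    WeaklyConverges (fun n => signedRowSumLaw (P (n + 1)) (C (n + 1)) 0) ρ

open Classical in
/-- The empirical spectral distribution `n⁻¹ ∑ j, δ_{λ_j}` of a Hermitian matrix. -/
noncomputable def esd {n : ℕ} (A : Matrix (Fin n) (Fin n) ℂ) : Measure ℝ :=
  if h : A.IsHermitian then (n : ℝ≥0∞)⁻¹ • ∑ j, Measure.dirac (h.eigenvalues j) else 0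

/-- The expected empirical spectral distribution `B ↦ E[esd(A)(B)]` of a random matrix `A`. -/
noncomputable def expectedESD {Ω : Type*} [MeasurableSpace Ω] (P : Measure Ω) {n : ℕ}
    (A : Ω → Matrix (Fin n) (Fin n) ℂ) : Measure ℝ :=
  P.bind fun ω => esd (A ω)

/-- `μ` is the expected limiting spectral distribution: the probability measure that is the weak
limit of the expected empirical spectral distributions. -/
structure IsExpectedLSD {Ω : ℕ → Type*} [∀ n, MeasurableSpace (Ω n)]
    (P : ∀ n, Measure (Ω n)) (C : ∀ n, Ω n → Matrix (Fin n) (Fin n) ℂ) (μ : Measure ℝ) :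
    Prop where
  prob : IsProbabilityMeasure μ
  tendsto : WeaklyConverges (fun n => expectedESD (P n) (C n)) μ

/-! ### Colored rooted trees -/

/-- A finite plane (rooted ordered) tree, as its set of Ulam–Harris addresses: the root is `[]`,
and the children of `u`, from left to right, are `u ++ [0]`, `u ++ [1]`, …. The parent of a
vertex is obtained by dropping the last letter, and the distance to the root is the length. -/
structure IsPlaneTree (t : Finset (List ℕ)) : Prop where
  root_mem : [] ∈ t
  parent_mem : ∀ u k, u ++ [k] ∈ t → u ∈ t
  sibling_mem : ∀ u k, u ++ [k + 1] ∈ t → u ++ [k] ∈ t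

/-- Admissible colorings of the vertices of `t`, given by the partition of the vertices into color
classes (so that renaming the colors does not change the coloring). The root is alone in its
class, and vertices of the same color have the same depth, and parents of the same color. -/
structure IsAdmissibleColoring {t : Finset (List ℕ)} (c : Finpartition t) : Prop where
  root : {[]} ∈ c.parts
  depth : ∀ B ∈ c.parts, ∀ u ∈ B, ∀ v ∈ B, u.length = v.length
  parent : ∀ B ∈ c.parts, ∀ u ∈ B, ∀ v ∈ B, ∃ B' ∈ c.parts, u.dropLast ∈ B' ∧ v.dropLast ∈ B'

/-- `T(q₁, …, q_ℓ)`: the number of colored rooted trees with `p + 1` vertices and with an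
admissible coloring whose classes, apart from that of the root, have the sizes `q₁, …, q_ℓ`. -/
noncomputable def numColoredTrees {p : ℕ} (q : Nat.Partition p) : ℕ :=
  Nat.card {x : Σ t : Finset (List ℕ), Finpartition t //
    IsPlaneTree x.1 ∧ x.1.card = p + 1 ∧ IsAdmissibleColoring x.2 ∧
      (x.2.parts.erase {[]}).val.map Finset.card = q.parts}

/-- `I_{p,ℓ}`: the sum of `T(q₁, …, q_ℓ)` over the partitions of `p` into `ℓ` parts. -/
noncomputable def treeCount (p ℓ : ℕ) : ℕ :=
  ∑ q ∈ (Finset.univ : Finset (Nat.Partition p)).filter (fun q => Multiset.card q.parts = ℓ),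
    numColoredTrees q

/-! The proof is the method of moments, and the entries enter it only through moments. Averaging
over the signs, the characteristic function of the signed row sum becomes the `(n - 1)`-st power of
`E cos(θ|C_n(1,2)|)`. Its limit is known, and since the entries are bounded its logarithm can be
analysed near `θ = 0`. Peeling off one Taylor coefficient of the cosine at a time gives limits `κ m`
of `n E|C_n(1,2)|^(2m)`, and Fatou's lemma gives `M₂(Π) < ∞` with `κ 1 ≤ σ² + M₂(Π)`. This is
`IsLevyKhintchineEnsemble.exists_tendsto_moments`.

The trace of a `k`-th power is a sum over closed walks of `k` steps. Grouping the walks by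
coincidences turns it into a finite sum over setoids on the times `0, …, k`, and then over
embeddings of the set `V` of classes into the index set, of which there are about `n^|V|`. The
expectation factorizes over the distinct edges, and each edge contributes `O(1/n)`: a mean if it is
used once (drift condition and second moment), an absolute moment otherwise. With the prefactor
`1/n`, only patterns with `|V| - 1` edges survive, that is, trees. A closed walk crosses each edge
of a tree equally often in both directions, so that Hermitian symmetry leaves only even moments of
the moduli. The limit of the `k`-th moment is therefore the sum over treelike patterns of a product
of numbers `κ m`, one for each edge (`IsLevyKhintchineEnsemble.tendsto_realMoment`).

Boundedness gives `κ m ≤ max(τ,1)^(2m) x`, where `x` is the sum in the statement, so a pattern with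
`2p` steps and `ℓ + 1` vertices weighs at most `max(τ,1)^(2p) x^ℓ`. To count patterns, a treelike
walk is lifted to the contour walk of a plane tree with `p` edges, every step away from the root
opening a new child. Coloring each plane vertex by the vertex below it is admissible, and the
colored plane tree determines the pattern. This injection is `card_treelike_le_treeCount`.

Since there are at most `(2p+1)^(2p+1)` patterns, the limits of the moments grow at most like `A
R^(2p) (2p)!`. A law with such moments has exponential moments, hence a complex moment generating
function analytic in a strip, and is determined by its moments. Second moments give tightness, so
the sequence has exactly one cluster point (`exists_weaklyConverges_of_tendsto_realMoment`). -/

/-! ### Closed walks on rooted trees -/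

/-- `W` is a walk of `k` steps from `r` to `r` that visits all vertices of the tree with root `r`,
parent map `par` and depth function `depth`. -/
structure IsTreeWalk {V : Type*} (W : ℕ → V) (k : ℕ) (r : V) (par : V → V) (depth : V → ℕ) :
    Prop where
  start : W 0 = r
  finish : W k = r
  surj : ∀ v, ∃ i ≤ k, W i = v
  par_root : par r = r
  depth_root : depth r = 0
  depth_par : ∀ v, v ≠ r → depth v = depth (par v) + 1
  step : ∀ i < k, (W (i + 1) ≠ r ∧ par (W (i + 1)) = W i) ∨ (W i ≠ r ∧ par (W i) = W (i + 1))

/-- The first time at which `W` visits `v`. -/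
noncomputable def firstVisit {V : Type*} (W : ℕ → V) (v : V) : ℕ := sInf {i | W i = v}

/-- The vertex visited by `W` just before its first visit to `v`. -/
noncomputable def walkParent {V : Type*} (W : ℕ → V) (v : V) : V := W (firstVisit W v - 1)

/-- The number of ancestors of `v` for the parent map of the walk `W`. -/
noncomputable def walkDepth {V : Type*} (W : ℕ → V) (v : V) : ℕ :=
  sInf {j | (walkParent W)^[j] v = W 0}

/-- Every step of `W` before time `k` connects a vertex and its parent. -/
def IsTreelike {V : Type*} (W : ℕ → V) (k : ℕ) : Prop :=
  ∀ i < k, (W (i + 1) ≠ W 0 ∧ walkParent W (W (i + 1)) = W i) ∨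
    (W i ≠ W 0 ∧ walkParent W (W i) = W (i + 1))

section Walk

variable {V : Type*} {W : ℕ → V} {k : ℕ}

lemma firstVisit_spec {v : V} (h : ∃ i, W i = v) : W (firstVisit W v) = v :=
  Nat.sInf_mem (s := {i | W i = v}) h

lemma firstVisit_le {v : V} {i : ℕ} (h : W i = v) : firstVisit W v ≤ i := Nat.sInf_le h

lemma firstVisit_pos {v : V} (h : ∃ i, W i = v) (hv : v ≠ W 0) : 0 < firstVisit W v := by
  rcases Nat.eq_zero_or_pos (firstVisit W v) with h0 | h0
  · have := firstVisit_spec h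
    rw [h0] at this
    exact absurd this.symm hv
  · exact h0

/-- First-visit times decrease along `walkParent`. This makes the parent map acyclic, so that it
defines a tree rooted at the starting point of the walk. -/
lemma firstVisit_walkParent_lt {v : V} (h : ∃ i, W i = v) (hv : v ≠ W 0) :
    firstVisit W (walkParent W v) < firstVisit W v := by
  have h1 : firstVisit W (walkParent W v) ≤ firstVisit W v - 1 := firstVisit_le rfl
  have := firstVisit_pos h hv
  omega

lemma walkParent_root : walkParent W (W 0) = W 0 := by
  have h : firstVisit W (W 0) = 0 := Nat.le_zero.1 (firstVisit_le rfl)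
  simp [walkParent, h]

lemma exists_iterate_walkParent (hs : ∀ v, ∃ i, W i = v) (v : V) :
    ∃ j, (walkParent W)^[j] v = W 0 := by
  induction hn : firstVisit W v using Nat.strong_induction_on generalizing v with
  | _ n ih =>
    by_cases hv : v = W 0
    · exact ⟨0, hv⟩
    · obtain ⟨j, hj⟩ := ih _ (hn ▸ firstVisit_walkParent_lt (hs v) hv) (walkParent W v) rfl
      exact ⟨j + 1, by rwa [Function.iterate_succ_apply]⟩

lemma walkDepth_root : walkDepth W (W 0) = 0 :=
  Nat.le_zero.1 (Nat.sInf_le (show (walkParent W)^[0] (W 0) = W 0 from rfl))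

lemma walkDepth_eq_succ (hs : ∀ v, ∃ i, W i = v) {v : V} (hv : v ≠ W 0) :
    walkDepth W v = walkDepth W (walkParent W v) + 1 := by
  have h1 : (walkParent W)^[walkDepth W v] v = W 0 :=
    Nat.sInf_mem (s := {j | (walkParent W)^[j] v = W 0}) (exists_iterate_walkParent hs v)
  have h2 : (walkParent W)^[walkDepth W (walkParent W v)] (walkParent W v) = W 0 :=
    Nat.sInf_mem (s := {j | (walkParent W)^[j] (walkParent W v) = W 0})
      (exists_iterate_walkParent hs _)
  have h3 : walkDepth W v ≠ 0 := by
    intro h0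
    rw [h0] at h1
    exact hv h1
  obtain ⟨d, hd⟩ := Nat.exists_eq_succ_of_ne_zero h3
  apply le_antisymm
  · apply Nat.sInf_le
    change (walkParent W)^[_ + 1] v = W 0
    rw [Function.iterate_succ_apply]
    exact h2
  · rw [hd, Function.iterate_succ_apply] at h1
    have : walkDepth W (walkParent W v) ≤ d := Nat.sInf_le h1
    omega

lemma IsTreelike.isTreeWalk (h : IsTreelike W k) (hk : W k = W 0) (hs : ∀ v, ∃ i ≤ k, W i = v) :
    IsTreeWalk W k (W 0) (walkParent W) (walkDepth W) where
  start := rfl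
  finish := hk
  surj := hs
  par_root := walkParent_root
  depth_root := walkDepth_root
  depth_par _ hv := walkDepth_eq_succ (fun v => (hs v).imp fun _ h => h.2) hv
  step := h

open Classical in
/-- A closed walk that visits the vertices of `V` uses at least `|V|` edges unless it is
treelike. -/
lemma card_le_card_edges_of_not_isTreelike [Fintype V] (hs : ∀ v, ∃ i ≤ k, W i = v)
    (h : ¬ IsTreelike W k) :
    Fintype.card V ≤ ((Finset.range k).image fun i => s(W i, W (i + 1))).card := by
  have hs' : ∀ v, ∃ i, W i = v := fun v => (hs v).imp fun _ h => h.2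
  -- The edges of first visits form a spanning tree with `|V| - 1` edges; a step that is not along
  -- this tree supplies one more.
  set T : Finset (Sym2 V) := (Finset.univ.erase (W 0)).image fun v => s(v, walkParent W v)
  have hTcard : T.card = Fintype.card V - 1 := by
    rw [Finset.card_image_of_injOn, Finset.card_erase_of_mem (Finset.mem_univ _),
      Finset.card_univ]
    intro v hv v' hv' hvv
    simp only [Finset.coe_erase, Finset.coe_univ, Set.mem_sdiff, Set.mem_univ, true_and,
      Set.mem_singleton_iff] at hv hv'
    rcases Sym2.eq_iff.1 hvv with h1 | h1
    · exact h1.1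
    -- Two vertices that are parents of each other would each be visited before the other.
    · have a1 := firstVisit_walkParent_lt (hs' v) hv
      have a2 := firstVisit_walkParent_lt (hs' v') hv'
      rw [h1.2] at a1
      rw [← h1.1] at a2
      omega
  have hTsub : T ⊆ (Finset.range k).image fun i => s(W i, W (i + 1)) := by
    intro e he
    obtain ⟨v, hv, rfl⟩ := Finset.mem_image.1 he
    have hv0 : v ≠ W 0 := (Finset.mem_erase.1 hv).1
    have hp := firstVisit_pos (hs' v) hv0
    obtain ⟨i, hik, hi⟩ := hs v
    have hle := firstVisit_le hi
    refine Finset.mem_image.2 ⟨firstVisit W v - 1, Finset.mem_range.2 (by omega), ?_⟩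
    rw [Nat.sub_add_cancel hp, firstVisit_spec (hs' v), Sym2.eq_swap]
    rfl
  simp only [IsTreelike, not_forall, not_or] at h
  obtain ⟨i, hi, h1, h2⟩ := h
  have hnot : s(W i, W (i + 1)) ∉ T := by
    intro hm
    obtain ⟨v, hv, hv'⟩ := Finset.mem_image.1 hm
    have hv0 : v ≠ W 0 := (Finset.mem_erase.1 hv).1
    rcases Sym2.eq_iff.1 hv' with ⟨a, b⟩ | ⟨a, b⟩
    · exact h2 ⟨a ▸ hv0, by rw [← a]; exact b⟩
    · exact h1 ⟨a ▸ hv0, by rw [← a]; exact b⟩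
  have : (insert s(W i, W (i + 1)) T).card ≤
      ((Finset.range k).image fun i => s(W i, W (i + 1))).card := by
    apply Finset.card_le_card
    refine Finset.insert_subset (Finset.mem_image.2 ⟨i, Finset.mem_range.2 hi, rfl⟩) hTsub
  rw [Finset.card_insert_of_notMem hnot, hTcard] at this
  omega

end Walk

/-! ### How often a tree walk uses each edge -/

namespace IsTreeWalk

variable {V : Type*} {W : ℕ → V} {k : ℕ} {r : V} {par : V → V} {depth : V → ℕ}

lemma depth_eq_zero (h : IsTreeWalk W k r par depth) {v : V} : depth v = 0 ↔ v = r := by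
  refine ⟨fun h0 => ?_, fun h0 => h0 ▸ h.depth_root⟩
  by_contra hv
  have := h.depth_par v hv
  omega

lemma depth_par_le (h : IsTreeWalk W k r par depth) (v : V) : depth (par v) ≤ depth v := by
  by_cases hv : v = r
  · rw [hv, h.par_root]
  · rw [h.depth_par v hv]; omega

lemma depth_iterate_le (h : IsTreeWalk W k r par depth) (j : ℕ) (v : V) :
    depth (par^[j] v) ≤ depth v := by
  induction j with
  | zero => exact le_rfl
  | succ j ih => rw [Function.iterate_succ_apply']; exact (h.depth_par_le _).trans ih

/-- A step cannot go both up and down. -/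
lemma not_up_and_down (h : IsTreeWalk W k r par depth) {u v : V} (hv : v ≠ r) (hvu : par v = u)
    (hu : u ≠ r) (huv : par u = v) : False := by
  have h1 := h.depth_par v hv
  have h2 := h.depth_par u hu
  rw [hvu] at h1
  rw [huv] at h2
  omega

open Classical in
/-- The number of steps from the parent of `v` to `v`. -/
noncomputable def upCount (W : ℕ → V) (k : ℕ) (par : V → V) (v : V) : ℕ :=
  ((Finset.range k).filter fun i => W (i + 1) = v ∧ W i = par v).card

open Classical in
/-- The number of steps from `v` to its parent. -/
noncomputable def downCount (W : ℕ → V) (k : ℕ) (par : V → V) (v : V) : ℕ :=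
  ((Finset.range k).filter fun i => W i = v ∧ W (i + 1) = par v).card

-- The indicator of the subtree `D` below `v` changes along the walk only when the edge above `v` is
-- crossed: by `+1` upwards in depth and by `-1` back. The walk is closed, so the changes telescope
-- to zero.
open Classical in
lemma upCount_eq_downCount (h : IsTreeWalk W k r par depth) {v : V} (hv : v ≠ r) :
    upCount W k par v = downCount W k par v := by
  set D : Set V := {u | ∃ j, par^[j] u = v} with hD
  have hvD : v ∈ D := ⟨0, rfl⟩
  have hpD : par v ∉ D := by
    rintro ⟨j, hj⟩
    have h1 := h.depth_iterate_le j (par v)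
    rw [hj, h.depth_par v hv] at h1
    omega
  have hrD : r ∉ D := by
    rintro ⟨j, hj⟩
    rw [Function.iterate_fixed h.par_root] at hj
    exact hv hj.symm
  have hparD : ∀ u, u ≠ v → (par u ∈ D ↔ u ∈ D) := by
    intro u hu
    constructor
    · rintro ⟨j, hj⟩
      exact ⟨j + 1, by rwa [Function.iterate_succ_apply]⟩
    · rintro ⟨j, hj⟩
      cases j with
      | zero => exact absurd hj hu
      | succ j => exact ⟨j, by rwa [Function.iterate_succ_apply] at hj⟩
  set s : V → ℤ := fun u => if u ∈ D then 1 else 0 with hsdef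
  have hstep : ∀ i ∈ Finset.range k, s (W (i + 1)) - s (W i) =
      (if W (i + 1) = v ∧ W i = par v then 1 else 0) -
        (if W i = v ∧ W (i + 1) = par v then 1 else 0) := by
    intro i hi
    rcases h.step i (Finset.mem_range.1 hi) with ⟨h1, h2⟩ | ⟨h1, h2⟩
    · have hnd : ¬ (W i = v ∧ W (i + 1) = par v) := by
        rintro ⟨a, b⟩
        exact h.not_up_and_down h1 h2 (a ▸ hv) (by rw [a, ← b])
      rw [if_neg hnd]
      by_cases hx : W (i + 1) = v
      · have hy : W i = par v := by rw [← h2, hx]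
        simp [hsdef, hx, hy, hvD, hpD]
      · have := hparD _ hx
        rw [h2] at this
        simp [hsdef, hx, this]
    · have hnd : ¬ (W (i + 1) = v ∧ W i = par v) := by
        rintro ⟨a, b⟩
        exact h.not_up_and_down h1 h2 (a ▸ hv) (by rw [a, ← b])
      rw [if_neg hnd]
      by_cases hx : W i = v
      · have hy : W (i + 1) = par v := by rw [← h2, hx]
        simp [hsdef, hx, hy, hvD, hpD]
      · have := hparD _ hx
        rw [h2] at this
        simp [hsdef, hx, this]
  have hsum := Finset.sum_congr rfl hstep
  rw [Finset.sum_range_sub (fun i => s (W i)), Finset.sum_sub_distrib, h.start, h.finish,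
    sub_self, Finset.sum_boole, Finset.sum_boole] at hsum
  have : ((upCount W k par v : ℕ) : ℤ) = (downCount W k par v : ℕ) := by
    unfold upCount downCount; linarith
  exact_mod_cast this

open Classical in
/-- The endpoint further from the root of the edge used by the `i`-th step. -/
noncomputable def lowerEnd (W : ℕ → V) (r : V) (par : V → V) (i : ℕ) : V :=
  if W (i + 1) ≠ r ∧ par (W (i + 1)) = W i then W (i + 1) else W i

lemma lowerEnd_ne (h : IsTreeWalk W k r par depth) {i : ℕ} (hi : i < k) :
    lowerEnd W r par i ≠ r := by
  unfold lowerEnd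
  split_ifs with hc
  · exact hc.1
  · exact ((h.step i hi).resolve_left hc).1

open Classical in
lemma lowerEnd_eq_iff (h : IsTreeWalk W k r par depth) {i : ℕ} (hi : i < k) {v : V} (hv : v ≠ r) :
    lowerEnd W r par i = v ↔
      (W (i + 1) = v ∧ W i = par v) ∨ (W i = v ∧ W (i + 1) = par v) := by
  unfold lowerEnd
  constructor
  · split_ifs with hc
    · rintro rfl
      exact Or.inl ⟨rfl, hc.2.symm⟩
    · rintro rfl
      exact Or.inr ⟨rfl, ((h.step i hi).resolve_left hc).2.symm⟩
  · rintro (⟨a, b⟩ | ⟨a, b⟩)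
    · rw [if_pos ⟨a ▸ hv, by rw [a, b]⟩, a]
    · rw [if_neg, a]
      rintro ⟨c1, c2⟩
      exact h.not_up_and_down c1 c2 (a ▸ hv) (by rw [a, ← b])

/-- A product along the steps of a tree walk, rearranged according to the edges. -/
lemma prod_steps [Fintype V] [DecidableEq V] (h : IsTreeWalk W k r par depth)
    {R : Type*} [CommMonoid R] (f : V → V → R) :
    ∏ i ∈ Finset.range k, f (W i) (W (i + 1)) =
      ∏ v ∈ Finset.univ.erase r, (f (par v) v * f v (par v)) ^ upCount W k par v := by
  classical
  rw [← Finset.prod_fiberwise_of_maps_to (t := Finset.univ.erase r) (g := lowerEnd W r par)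
    (fun i hi => Finset.mem_erase.2 ⟨h.lowerEnd_ne (Finset.mem_range.1 hi), Finset.mem_univ _⟩)]
  refine Finset.prod_congr rfl fun v hv => ?_
  have hv0 : v ≠ r := (Finset.mem_erase.1 hv).1
  have hsplit : (Finset.range k).filter (fun i => lowerEnd W r par i = v) =
      (Finset.range k).filter (fun i => W (i + 1) = v ∧ W i = par v) ∪
        (Finset.range k).filter (fun i => W i = v ∧ W (i + 1) = par v) := by
    rw [← Finset.filter_or]
    exact Finset.filter_congr fun i hi => h.lowerEnd_eq_iff (Finset.mem_range.1 hi) hv0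
  have hdisj : Disjoint ((Finset.range k).filter (fun i => W (i + 1) = v ∧ W i = par v))
      ((Finset.range k).filter (fun i => W i = v ∧ W (i + 1) = par v)) := by
    refine Finset.disjoint_filter.2 ?_
    rintro i - ⟨a, b⟩ ⟨c, d⟩
    have := h.depth_par v hv0
    rw [← b, c] at this
    omega
  rw [hsplit, Finset.prod_union hdisj]
  rw [Finset.prod_congr rfl (g := fun _ => f (par v) v), Finset.prod_const,
    Finset.prod_congr rfl (g := fun _ => f v (par v)), Finset.prod_const, mul_pow]
  · have e1 : ((Finset.range k).filter fun i => W (i + 1) = v ∧ W i = par v).card =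
        upCount W k par v := by unfold upCount; congr
    have e2 : ((Finset.range k).filter fun i => W i = v ∧ W (i + 1) = par v).card =
        upCount W k par v := by rw [h.upCount_eq_downCount hv0]; unfold downCount; congr
    rw [e1, e2]
  · intro i hi
    simp only [Finset.mem_filter] at hi
    rw [hi.2.1, hi.2.2]
  · intro i hi
    simp only [Finset.mem_filter] at hi
    rw [hi.2.1, hi.2.2]

/-- Every edge is used equally often in both directions. -/
lemma two_mul_sum_upCount [Fintype V] [DecidableEq V] (h : IsTreeWalk W k r par depth) :
    2 * ∑ v ∈ Finset.univ.erase r, upCount W k par v = k := by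
  -- Giving every step the same generator of a multiplicative copy of `ℕ` turns the product formula
  -- into a count of steps.
  have := h.prod_steps (R := Multiplicative ℕ) (fun _ _ => Multiplicative.ofAdd 1)
  apply_fun Multiplicative.toAdd at this
  simp [toAdd_prod] at this
  rw [Finset.mul_sum]
  conv_rhs => rw [this]
  exact Finset.sum_congr rfl fun _ _ => Nat.mul_comm _ _

/-- Every edge is used. -/
lemma upCount_pos (h : IsTreeWalk W k r par depth) {v : V} (hv : v ≠ r) :
    0 < upCount W k par v := by
  classical
  by_contra h0
  have hu : upCount W k par v = 0 := by omega
  -- The subtree of `v` can be entered only through `v`, so without a step from the parent to `v`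
  -- the walk stays outside it.
  have hne : ∀ i, i ≤ k → ∀ j, par^[j] (W i) ≠ v := by
    intro i
    induction i with
    | zero =>
      intro _ j hj
      rw [h.start, Function.iterate_fixed h.par_root] at hj
      exact hv hj.symm
    | succ i ih =>
      intro hi j hj
      rcases h.step i (by omega) with ⟨h1, h2⟩ | ⟨h1, h2⟩
      · cases j with
        | zero =>
          have hmem : i ∈ (Finset.range k).filter fun i => W (i + 1) = v ∧ W i = par v := by
            simp only [Finset.mem_filter, Finset.mem_range]
            change W (i + 1) = v at hj
            exact ⟨by omega, hj, by rw [← hj, h2]⟩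
          unfold upCount at hu
          rw [Finset.card_eq_zero] at hu
          rw [hu] at hmem
          simp at hmem
        | succ j =>
          rw [Function.iterate_succ_apply, h2] at hj
          exact ih (by omega) j hj
      · rw [← h2, ← Function.iterate_succ_apply] at hj
        exact ih (by omega) _ hj
  obtain ⟨i, hi, hiv⟩ := h.surj v
  exact hne i hi 0 hiv

end IsTreeWalk

/-! ### Contour walks of plane trees -/

/-- The index of the next child of the vertex `u` to be added to the plane tree `s`. -/
noncomputable def freshChild (s : Finset (List ℕ)) (u : List ℕ) : ℕ := sInf {c | u ++ [c] ∉ s}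

open Classical in
/-- The contour walk with up steps at the times `i` such that `b i`: the current vertex, and the
set of the vertices visited so far. An up step leads to a new child of the current vertex. -/
noncomputable def contour (b : ℕ → Prop) : ℕ → List ℕ × Finset (List ℕ)
  | 0 => ([], {[]})
  | i + 1 =>
    if b i then
      ((contour b i).1 ++ [freshChild (contour b i).2 (contour b i).1],
        insert ((contour b i).1 ++ [freshChild (contour b i).2 (contour b i).1]) (contour b i).2)
    else ((contour b i).1.dropLast, (contour b i).2)

section Contour

/-- A finite set misses some child of `u`, so the infimum is attained and is not the default value
of an empty infimum. -/
lemma append_freshChild_notMem (s : Finset (List ℕ)) (u : List ℕ) :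
    u ++ [freshChild s u] ∉ s := by
  have hne : {c | u ++ [c] ∉ s}.Nonempty := by
    by_contra h
    rw [Set.not_nonempty_iff_eq_empty] at h
    have hall : ∀ c, u ++ [c] ∈ s := by
      intro c
      by_contra hc
      have : c ∈ {c | u ++ [c] ∉ s} := hc
      rw [h] at this
      exact this
    have hinj : Function.Injective fun c : ℕ => u ++ [c] := by
      intro a b hab
      simpa using hab
    exact Set.infinite_of_injective_forall_mem hinj hall s.finite_toSet
  exact Nat.sInf_mem hne

lemma append_mem_of_lt_freshChild {s : Finset (List ℕ)} {u : List ℕ} {c : ℕ}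
    (h : c < freshChild s u) : u ++ [c] ∈ s := by
  by_contra hc
  exact absurd (Nat.sInf_le (s := {c | u ++ [c] ∉ s}) hc) (not_le.2 h)

lemma IsPlaneTree.dropLast_mem {t : Finset (List ℕ)} (ht : IsPlaneTree t) {u : List ℕ}
    (hu : u ∈ t) : u.dropLast ∈ t := by
  rcases List.eq_nil_or_concat u with rfl | ⟨v, c, rfl⟩
  · exact hu
  · rw [List.concat_eq_append] at hu ⊢
    rw [List.dropLast_concat]
    exact ht.parent_mem _ _ hu

variable {b : ℕ → Prop}

lemma contour_up {i : ℕ} (h : b i) : contour b (i + 1) =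
    ((contour b i).1 ++ [freshChild (contour b i).2 (contour b i).1],
      insert ((contour b i).1 ++ [freshChild (contour b i).2 (contour b i).1])
        (contour b i).2) := by
  rw [contour, if_pos h]

lemma contour_down {i : ℕ} (h : ¬ b i) :
    contour b (i + 1) = ((contour b i).1.dropLast, (contour b i).2) := by
  rw [contour, if_neg h]

/-- The left-sibling condition persists because the new child has the smallest free index. -/
lemma contour_spec (b : ℕ → Prop) (i : ℕ) :
    IsPlaneTree (contour b i).2 ∧ (contour b i).1 ∈ (contour b i).2 := by
  induction i with
  | zero =>
    refine ⟨⟨by simp [contour], ?_, ?_⟩, by simp [contour]⟩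
    · intro u k h
      simp [contour] at h
    · intro u k h
      simp [contour] at h
  | succ i ih =>
    obtain ⟨ht, hm⟩ := ih
    by_cases hb : b i
    · rw [contour_up hb]
      refine ⟨⟨Finset.mem_insert_of_mem ht.root_mem, ?_, ?_⟩, Finset.mem_insert_self _ _⟩
      · intro u k h
        apply Finset.mem_insert_of_mem
        rcases Finset.mem_insert.1 h with h | h
        · rw [(List.append_inj' h rfl).1]
          exact hm
        · exact ht.parent_mem _ _ h
      · intro u k h
        apply Finset.mem_insert_of_mem
        rcases Finset.mem_insert.1 h with h | h
        · obtain ⟨h1, h2⟩ := List.append_inj' h rfl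
          rw [h1]
          apply append_mem_of_lt_freshChild
          simp at h2
          omega
        · exact ht.sibling_mem _ _ h
    · rw [contour_down hb]
      exact ⟨ht, ht.dropLast_mem hm⟩

lemma contour_snd_mono : Monotone fun i => (contour b i).2 := by
  refine monotone_nat_of_le_succ fun i => ?_
  by_cases hb : b i
  · simp only [contour_up hb]
    exact Finset.subset_insert _ _
  · simp only [contour_down hb]
    exact le_rfl

lemma mem_contour_snd {i : ℕ} {x : List ℕ} :
    x ∈ (contour b i).2 ↔ ∃ j ≤ i, (contour b j).1 = x := by
  constructor
  · induction i with
    | zero =>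
      intro h
      exact ⟨0, le_rfl, by simpa [contour, eq_comm] using h⟩
    | succ i ih =>
      intro h
      by_cases hb : b i
      · rw [contour_up hb] at h
        rcases Finset.mem_insert.1 h with h | h
        · exact ⟨i + 1, le_rfl, by rw [contour_up hb, h]⟩
        · obtain ⟨j, hj, hx⟩ := ih h
          exact ⟨j, by omega, hx⟩
      · rw [contour_down hb] at h
        obtain ⟨j, hj, hx⟩ := ih h
        exact ⟨j, by omega, hx⟩
  · rintro ⟨j, hj, rfl⟩
    exact contour_snd_mono hj (contour_spec b j).2

/-- After the contour walk has left the subtree of the current vertex, it does not return. -/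
lemma contour_no_return {i : ℕ} (hb : ¬ b i) (hne : (contour b i).1 ≠ []) {j : ℕ} (hj : i + 1 ≤ j) :
    ¬ (contour b i).1 <+: (contour b j).1 ∧
      ∀ x ∈ (contour b j).2, (contour b i).1 <+: x → x ∈ (contour b i).2 := by
  induction j, hj using Nat.le_induction with
  | base =>
    rw [contour_down hb]
    refine ⟨fun h => ?_, fun x hx _ => hx⟩
    have h1 := h.length_le
    rw [List.length_dropLast] at h1
    have := List.length_pos_iff.2 hne
    omega
  | succ j hj ih =>
    obtain ⟨h1, h2⟩ := ih
    by_cases hbj : b j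
    · rw [contour_up hbj]
      have key : ¬ (contour b i).1 <+:
          (contour b j).1 ++ [freshChild (contour b j).2 (contour b j).1] := by
        intro h
        -- Either the old vertex would be the newly created one, although it was visited already, or
        -- the walk would have been in the subtree before this step.
        rcases List.prefix_concat_iff.1 h with h | h
        · have := contour_snd_mono (b := b) (by omega : i ≤ j) (contour_spec b i).2
          rw [h] at this
          exact append_freshChild_notMem _ _ this
        · exact h1 h
      refine ⟨key, fun x hx hp => ?_⟩
      rcases Finset.mem_insert.1 hx with rfl | hx
      · exact absurd hp key
      · exact h2 x hx hp
    · rw [contour_down hbj]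
      exact ⟨fun h => h1 (h.trans (List.dropLast_prefix _)), h2⟩

lemma contour_congr {b' : ℕ → Prop} {i : ℕ} (h : ∀ j < i, (b j ↔ b' j)) :
    contour b i = contour b' i := by
  induction i with
  | zero => rfl
  | succ i ih =>
    have ih' := ih fun j hj => h j (by omega)
    by_cases hb : b i
    · rw [contour_up hb, contour_up ((h i (by omega)).1 hb), ih']
    · rw [contour_down hb, contour_down (fun h' => hb ((h i (by omega)).2 h')), ih']

/-- A contour walk is determined by its tree. -/
lemma steps_eq_of_contour_snd_eq {b' : ℕ → Prop} {k : ℕ}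
    (hb : ∀ i < k, ¬ b i → (contour b i).1 ≠ [])
    (hb' : ∀ i < k, ¬ b' i → (contour b' i).1 ≠ [])
    (ht : (contour b k).2 = (contour b' k).2) : ∀ i < k, (b i ↔ b' i) := by
  intro i
  induction i using Nat.strong_induction_on with
  | _ i ih =>
    intro hi
    have heq : contour b i = contour b' i := contour_congr fun j hj => ih j hj (by omega)
    -- At a first disagreement one walk adds a child below the current vertex and the other leaves
    -- the subtree for good. The second can never add that child, so the final trees differ.
    have aux : ∀ {b b' : ℕ → Prop}, (∀ i < k, ¬ b' i → (contour b' i).1 ≠ []) →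
        (contour b k).2 = (contour b' k).2 → contour b i = contour b' i → b i → b' i := by
      intro b b' hb' ht heq h1
      by_contra h2
      have hmem : (contour b i).1 ++ [freshChild (contour b i).2 (contour b i).1] ∈
          (contour b k).2 := by
        apply contour_snd_mono (b := b) (by omega : i + 1 ≤ k)
        simp only [contour_up h1]
        exact Finset.mem_insert_self _ _
      have := (contour_no_return h2 (hb' i hi h2) (by omega : i + 1 ≤ k)).2 _ (ht ▸ hmem)
        (by rw [heq]; exact List.prefix_append _ _)
      rw [heq] at this
      exact append_freshChild_notMem _ _ this
    exact ⟨aux hb' ht heq, aux hb ht.symm heq.symm⟩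

end Contour

/-! ### The colored plane tree of a tree walk -/

namespace IsTreeWalk

variable {V : Type*} {W : ℕ → V} {k : ℕ} {r : V} {par : V → V} {depth : V → ℕ}

/-- The `i`-th step of `W` leads away from the root. -/
def IsUp (W : ℕ → V) (r : V) (par : V → V) (i : ℕ) : Prop := W (i + 1) ≠ r ∧ par (W (i + 1)) = W i

/-- The lift moves up and down together with `W`, which gives the depth. For the count: steps away
from the root minus steps back give the length, their sum is `i`, and each step away from the root
creates one vertex besides the root. -/
lemma length_contour (h : IsTreeWalk W k r par depth) {i : ℕ} (hi : i ≤ k) :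
    (contour (IsUp W r par) i).1.length = depth (W i) ∧
      (contour (IsUp W r par) i).1.length + i + 2 = 2 * (contour (IsUp W r par) i).2.card := by
  induction i with
  | zero => simp [contour, h.start, h.depth_root]
  | succ i ih =>
    obtain ⟨h1, h2⟩ := ih (by omega)
    by_cases hb : IsUp W r par i
    · rw [contour_up hb]
      have := h.depth_par _ hb.1
      rw [hb.2, ← h1] at this
      rw [Finset.card_insert_of_notMem (append_freshChild_notMem _ _)]
      simp only [List.length_append, List.length_singleton]
      omega
    · rw [contour_down hb]
      obtain ⟨a, c⟩ := (h.step i (by omega)).resolve_left hb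
      have := h.depth_par _ a
      rw [c] at this
      simp only [List.length_dropLast]
      omega

lemma contour_ne_nil (h : IsTreeWalk W k r par depth) {i : ℕ} (hi : i < k)
    (hb : ¬ IsUp W r par i) : (contour (IsUp W r par) i).1 ≠ [] := by
  obtain ⟨a, -⟩ := (h.step i hi).resolve_left hb
  intro h0
  have := (h.length_contour hi.le).1
  rw [h0, List.length_nil, eq_comm, h.depth_eq_zero] at this
  exact a this

/-- The projection from the plane tree to `V` is well defined and commutes with taking ancestors. In
the induction on the later time, a step to a new child lowers `m` by one and a step back raises it
by one; `m = 0` cannot occur right after a step to a new child, since that address was not visited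
before. -/
lemma eq_iterate_par (h : IsTreeWalk W k r par depth) {i : ℕ} (hi : i ≤ k) {j : ℕ} (hj : j ≤ i)
    {m : ℕ} (hm : (contour (IsUp W r par) j).1 =
      List.dropLast^[m] (contour (IsUp W r par) i).1) : W j = par^[m] (W i) := by
  induction i generalizing j m with
  | zero =>
    obtain rfl : j = 0 := by omega
    rw [h.start, Function.iterate_fixed h.par_root]
  | succ i ih =>
    have hnil : List.dropLast^[m] ([] : List ℕ) = [] := Function.iterate_fixed rfl m
    rcases Nat.lt_or_ge i j with hij | hij
    · obtain rfl : j = i + 1 := by omega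
      cases m with
      | zero => rfl
      | succ m =>
        have hlen : ∀ (m : ℕ) (l : List ℕ), (List.dropLast^[m] l).length ≤ l.length := by
          intro m
          induction m with
          | zero => exact fun l => le_rfl
          | succ m ihm =>
            intro l
            rw [Function.iterate_succ_apply]
            refine (ihm _).trans ?_
            rw [List.length_dropLast]; omega
        -- An address that is a proper iterated `dropLast` of itself is empty, so the walk is at the
        -- root, which `par` fixes.
        have h1 := congrArg List.length hm
        rw [Function.iterate_succ_apply] at h1
        have h2 := hlen m (contour (IsUp W r par) (i + 1)).1.dropLast
        rw [← h1, List.length_dropLast] at h2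
        have h3 := (h.length_contour hi).1
        have h4 : W (i + 1) = r := h.depth_eq_zero.1 (by omega)
        rw [h4, Function.iterate_fixed h.par_root]
    · by_cases hb : IsUp W r par i
      · rw [contour_up hb] at hm
        cases m with
        | zero =>
          have : (contour (IsUp W r par) j).1 ∈ (contour (IsUp W r par) i).2 :=
            mem_contour_snd.2 ⟨j, hij, rfl⟩
          rw [hm] at this
          exact absurd this (append_freshChild_notMem _ _)
        | succ m =>
          rw [Function.iterate_succ_apply, List.dropLast_concat] at hm
          rw [Function.iterate_succ_apply, hb.2]
          exact ih (by omega) hij hm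
      · obtain ⟨-, c⟩ := (h.step i (by omega)).resolve_left hb
        rw [contour_down hb, ← Function.iterate_succ_apply] at hm
        rw [← c, ← Function.iterate_succ_apply]
        exact ih (by omega) hij hm

lemma eq_of_contour_eq (h : IsTreeWalk W k r par depth) {i j : ℕ} (hi : i ≤ k) (hj : j ≤ k)
    (hij : (contour (IsUp W r par) i).1 = (contour (IsUp W r par) j).1) : W i = W j := by
  rcases le_total i j with h1 | h1
  · exact h.eq_iterate_par hj h1 (m := 0) hij
  · exact (h.eq_iterate_par hi h1 (m := 0) hij.symm).symm

open Classical in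
/-- The vertices of the plane tree of `W` at which `W` visits `v`. -/
noncomputable def colorClass (W : ℕ → V) (k : ℕ) (r : V) (par : V → V) (v : V) :
    Finset (List ℕ) :=
  ((Finset.range (k + 1)).filter fun i => W i = v).image fun i => (contour (IsUp W r par) i).1

lemma mem_colorClass {v : V} {x : List ℕ} :
    x ∈ colorClass W k r par v ↔ ∃ i ≤ k, W i = v ∧ (contour (IsUp W r par) i).1 = x := by
  simp [colorClass, and_assoc]

lemma contour_mem_colorClass_iff (h : IsTreeWalk W k r par depth) {i : ℕ} (hi : i ≤ k) {v : V} :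
    (contour (IsUp W r par) i).1 ∈ colorClass W k r par v ↔ W i = v := by
  rw [mem_colorClass]
  constructor
  · rintro ⟨j, hj, rfl, hji⟩
    exact h.eq_of_contour_eq hi hj hji.symm
  · exact fun hv => ⟨i, hi, hv, rfl⟩

lemma colorClass_nonempty (h : IsTreeWalk W k r par depth) (v : V) :
    (colorClass W k r par v).Nonempty := by
  obtain ⟨i, hi, hv⟩ := h.surj v
  exact ⟨_, (h.contour_mem_colorClass_iff hi).2 hv⟩

lemma colorClass_injective (h : IsTreeWalk W k r par depth) :
    Function.Injective (colorClass W k r par) := by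
  intro v v' hv
  obtain ⟨i, hi, hiv⟩ := h.surj v
  have := (h.contour_mem_colorClass_iff hi).2 hiv
  rw [hv, h.contour_mem_colorClass_iff hi] at this
  rw [← hiv, this]

lemma colorClass_root (h : IsTreeWalk W k r par depth) : colorClass W k r par r = {[]} := by
  ext x
  rw [mem_colorClass, Finset.mem_singleton]
  constructor
  · rintro ⟨i, hi, hr, rfl⟩
    have := (h.length_contour hi).1
    rw [hr, h.depth_root] at this
    exact List.length_eq_zero_iff.1 this
  · rintro rfl
    exact ⟨0, Nat.zero_le _, h.start, rfl⟩

open Classical in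
/-- The coloring of the plane tree of `W` by the vertices visited by `W`. -/
noncomputable def coloring [Fintype V] (h : IsTreeWalk W k r par depth) :
    Finpartition (contour (IsUp W r par) k).2 :=
  Finpartition.ofExistsUnique (Finset.univ.image (colorClass W k r par))
    (by
      intro B hB x hx
      obtain ⟨v, -, rfl⟩ := Finset.mem_image.1 hB
      obtain ⟨i, hi, -, hx⟩ := mem_colorClass.1 hx
      exact mem_contour_snd.2 ⟨i, hi, hx⟩)
    (by
      intro x hx
      obtain ⟨i, hi, rfl⟩ := mem_contour_snd.1 hx
      refine ⟨colorClass W k r par (W i), ⟨Finset.mem_image_of_mem _ (Finset.mem_univ _),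
        (h.contour_mem_colorClass_iff hi).2 rfl⟩, ?_⟩
      rintro B ⟨hB, hxB⟩
      obtain ⟨v, -, rfl⟩ := Finset.mem_image.1 hB
      rw [(h.contour_mem_colorClass_iff hi).1 hxB])
    (by
      intro h0
      obtain ⟨v, -, hv⟩ := Finset.mem_image.1 h0
      exact (h.colorClass_nonempty v).ne_empty hv)

lemma mem_coloring_parts [Fintype V] (h : IsTreeWalk W k r par depth) {B : Finset (List ℕ)} :
    B ∈ h.coloring.parts ↔ ∃ v, colorClass W k r par v = B := by
  simp [coloring]

lemma eq_iff_exists_part [Fintype V] (h : IsTreeWalk W k r par depth) {i j : ℕ} (hi : i ≤ k)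
    (hj : j ≤ k) : W i = W j ↔ ∃ B ∈ h.coloring.parts,
      (contour (IsUp W r par) i).1 ∈ B ∧ (contour (IsUp W r par) j).1 ∈ B := by
  constructor
  · intro hij
    exact ⟨_, h.mem_coloring_parts.2 ⟨W i, rfl⟩, (h.contour_mem_colorClass_iff hi).2 rfl,
      (h.contour_mem_colorClass_iff hj).2 hij.symm⟩
  · rintro ⟨B, hB, h1, h2⟩
    obtain ⟨v, rfl⟩ := h.mem_coloring_parts.1 hB
    rw [(h.contour_mem_colorClass_iff hi).1 h1, (h.contour_mem_colorClass_iff hj).1 h2]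

/-- The lift preserves depth, and the plane parent of an address above `v` lies above `par v`: this
is `eq_iterate_par` with `m = 1`. -/
lemma isAdmissibleColoring [Fintype V] (h : IsTreeWalk W k r par depth) :
    IsAdmissibleColoring h.coloring where
  root := h.mem_coloring_parts.2 ⟨r, h.colorClass_root⟩
  depth := by
    intro B hB x hx y hy
    obtain ⟨v, rfl⟩ := h.mem_coloring_parts.1 hB
    obtain ⟨i, hi, hiv, rfl⟩ := mem_colorClass.1 hx
    obtain ⟨j, hj, hjv, rfl⟩ := mem_colorClass.1 hy
    rw [(h.length_contour hi).1, (h.length_contour hj).1, hiv, hjv]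
  parent := by
    intro B hB x hx y hy
    obtain ⟨v, rfl⟩ := h.mem_coloring_parts.1 hB
    refine ⟨_, h.mem_coloring_parts.2 ⟨par v, rfl⟩, ?_⟩
    have key : ∀ x ∈ colorClass W k r par v, x.dropLast ∈ colorClass W k r par (par v) := by
      intro x hx
      obtain ⟨i, hi, rfl, rfl⟩ := mem_colorClass.1 hx
      obtain ⟨j, hj, hx⟩ := mem_contour_snd.1
        ((contour_spec (IsUp W r par) i).1.dropLast_mem (contour_spec (IsUp W r par) i).2)
      exact mem_colorClass.2 ⟨j, by omega, h.eq_iterate_par hi hj (m := 1) hx, hx⟩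
    exact ⟨key x hx, key y hy⟩

-- A closed walk of `2 p` steps ends at depth `0`, so `length_contour` forces `p + 1` plane
-- vertices; removing the root leaves classes of total size `p`, one for each vertex of `V` other
-- than `r`.
open Classical in
lemma exists_partition [Fintype V] {p : ℕ} (h : IsTreeWalk W (2 * p) r par depth) :
    ∃ q : Nat.Partition p, Multiset.card q.parts + 1 = Fintype.card V ∧
      (h.coloring.parts.erase {[]}).val.map Finset.card = q.parts := by
  have hmem : ({[]} : Finset (List ℕ)) ∈ h.coloring.parts := h.isAdmissibleColoring.root
  have hcard : h.coloring.parts.card = Fintype.card V := by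
    simp only [coloring, Finpartition.ofExistsUnique_parts]
    rw [Finset.card_image_of_injective _ h.colorClass_injective, Finset.card_univ]
  refine ⟨⟨(h.coloring.parts.erase {[]}).val.map Finset.card, ?_, ?_⟩, ?_, rfl⟩
  · intro i hi
    obtain ⟨B, hB, rfl⟩ := Multiset.mem_map.1 hi
    exact Finset.card_pos.2 (h.coloring.nonempty_of_mem_parts (Finset.mem_of_mem_erase hB))
  · have h1 := h.coloring.sum_card_parts
    rw [← Finset.sum_erase_add _ _ hmem, Finset.card_singleton] at h1
    have h2 := (h.length_contour le_rfl)
    rw [h.finish, h.depth_root] at h2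
    have h3 : ((h.coloring.parts.erase {[]}).val.map Finset.card).sum =
        ∑ B ∈ h.coloring.parts.erase {[]}, B.card := rfl
    omega
  · simp only [Multiset.card_map, Finset.card_val]
    rw [Finset.card_erase_of_mem hmem, hcard]
    have : 0 < h.coloring.parts.card := Finset.card_pos.2 ⟨_, hmem⟩
    omega

/-- Two tree walks with the same colored plane tree have the same coincidences. -/
lemma eq_iff_eq_of_coloring_eq {V' : Type*} {W' : ℕ → V'} {r' : V'} {par' : V' → V'}
    {depth' : V' → ℕ} [Fintype V] [Fintype V'] (h : IsTreeWalk W k r par depth)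
    (h' : IsTreeWalk W' k r' par' depth')
    (heq : (⟨_, h.coloring⟩ : Σ t : Finset (List ℕ), Finpartition t) = ⟨_, h'.coloring⟩)
    {i j : ℕ} (hi : i ≤ k) (hj : j ≤ k) : W i = W j ↔ W' i = W' j := by
  have ht : (contour (IsUp W r par) k).2 = (contour (IsUp W' r' par') k).2 :=
    congrArg Sigma.fst heq
  have hp : h.coloring.parts = h'.coloring.parts :=
    congrArg (fun x : Σ t : Finset (List ℕ), Finpartition t => x.2.parts) heq
  have hup := steps_eq_of_contour_snd_eq (fun i hi hb => h.contour_ne_nil hi hb)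
    (fun i hi hb => h'.contour_ne_nil hi hb) ht
  rw [h.eq_iff_exists_part hi hj, h'.eq_iff_exists_part hi hj, hp,
    contour_congr (fun m hm => hup m (by omega : m < k)),
    contour_congr (fun m hm => hup m (by omega : m < k))]

end IsTreeWalk

/-! ### Counting -/

lemma IsPlaneTree.take_mem {t : Finset (List ℕ)} (ht : IsPlaneTree t) {u v : List ℕ}
    (h : u ++ v ∈ t) : u ∈ t := by
  induction v using List.reverseRecOn with
  | nil => simpa using h
  | append_singleton v c ih =>
    rw [← List.append_assoc] at h
    exact ih (ht.parent_mem _ _ h)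

lemma IsPlaneTree.sibling_mem_of_le {t : Finset (List ℕ)} (ht : IsPlaneTree t) {u : List ℕ}
    {c d : ℕ} (h : u ++ [c] ∈ t) (hd : d ≤ c) : u ++ [d] ∈ t := by
  induction c, hd using Nat.le_induction with
  | base => exact h
  | succ c _ ih => exact ih (ht.sibling_mem _ _ h)

lemma IsPlaneTree.length_lt {t : Finset (List ℕ)} (ht : IsPlaneTree t) {u : List ℕ}
    (hu : u ∈ t) : u.length < t.card := by
  have : ((Finset.range (u.length + 1)).image fun i => u.take i) ⊆ t := by
    intro x hx
    obtain ⟨i, -, rfl⟩ := Finset.mem_image.1 hx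
    exact ht.take_mem (v := u.drop i) (by rwa [List.take_append_drop])
  have h2 := Finset.card_le_card this
  rw [Finset.card_image_of_injOn, Finset.card_range] at h2
  · omega
  · intro i hi j hj hij
    simp only [Finset.coe_range, Set.mem_Iio] at hi hj
    have := congrArg List.length hij
    simp only [List.length_take] at this
    omega

lemma IsPlaneTree.lt_card_of_mem {t : Finset (List ℕ)} (ht : IsPlaneTree t) {u : List ℕ}
    (hu : u ∈ t) {c : ℕ} (hc : c ∈ u) : c < t.card := by
  obtain ⟨x, y, rfl⟩ := List.append_of_mem hc
  have h1 : x ++ [c] ∈ t := ht.take_mem (v := y) (by simpa using hu)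
  have : ((Finset.range (c + 1)).image fun i => x ++ [i]) ⊆ t := by
    intro z hz
    obtain ⟨i, hi, rfl⟩ := Finset.mem_image.1 hz
    exact ht.sibling_mem_of_le h1 (Nat.lt_succ_iff.1 (Finset.mem_range.1 hi))
  have h2 := Finset.card_le_card this
  rw [Finset.card_image_of_injective, Finset.card_range] at h2
  · omega
  · intro a b hab
    simpa using hab

/-- Finiteness matters because `Nat.card` of an infinite type is `0`, which would make an upper
bound by `numColoredTrees` fail. In a plane tree with `N` vertices both the lengths and the letters
of the addresses are below `N`. -/
lemma finite_coloredTrees (N : ℕ) :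
    {x : Σ t : Finset (List ℕ), Finpartition t | IsPlaneTree x.1 ∧ x.1.card = N}.Finite := by
  have hL : {u : List ℕ | u.length < N ∧ ∀ c ∈ u, c < N}.Finite := by
    have h1 : ((fun l : List (Fin N) => l.map Fin.val) '' {l | l.length < N}).Finite :=
      (List.finite_length_lt (Fin N) N).image _
    refine h1.subset ?_
    rintro u ⟨hu, hc⟩
    refine ⟨u.pmap (fun c hc => (⟨c, hc⟩ : Fin N)) hc, by simpa using hu, ?_⟩
    simp [List.map_pmap]
  have hT : {t : Finset (List ℕ) | IsPlaneTree t ∧ t.card = N}.Finite := by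
    refine (hL.toFinset.powerset.finite_toSet).subset ?_
    rintro t ⟨ht, rfl⟩
    simp only [Finset.coe_powerset, Set.Finite.coe_toFinset, Set.mem_preimage, Set.mem_powerset_iff]
    intro u hu
    exact ⟨ht.length_lt hu, fun c hc => ht.lt_card_of_mem hu hc⟩
  refine (hT.biUnion fun t _ => Set.finite_range (Sigma.mk (β := fun t => Finpartition t) t)).subset
    fun x hx => ?_
  exact Set.mem_biUnion (x := x.1) hx ⟨x.2, rfl⟩

/-- The walk of `k` steps that goes through the classes of a setoid. -/
def setoidWalk {k : ℕ} (π : Setoid (Fin (k + 1))) (i : ℕ) : Quotient π :=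
  Quotient.mk π (Fin.ofNat (k + 1) i)

lemma setoidWalk_val {k : ℕ} (π : Setoid (Fin (k + 1))) (i : Fin (k + 1)) :
    setoidWalk π i = Quotient.mk π i := by
  simp [setoidWalk]

lemma setoidWalk_surj {k : ℕ} (π : Setoid (Fin (k + 1))) (v : Quotient π) :
    ∃ i ≤ k, setoidWalk π i = v := by
  induction v using Quotient.inductionOn with
  | _ i => exact ⟨i, by omega, setoidWalk_val π i⟩

open Classical in
/-- The treelike closed walks of `2 p` steps with `ℓ + 1` vertices, up to renaming the vertices,
are at most as many as the colored plane trees with `p` edges and `ℓ + 1` colors. -/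
theorem card_treelike_le_treeCount (p ℓ : ℕ) (S : Finset (Setoid (Fin (2 * p + 1))))
    (hS : ∀ π ∈ S, setoidWalk π (2 * p) = setoidWalk π 0 ∧ IsTreelike (setoidWalk π) (2 * p) ∧
      Fintype.card (Quotient π) = ℓ + 1) : S.card ≤ treeCount p ℓ := by
  have hW : ∀ π : S, IsTreeWalk (setoidWalk π.1) (2 * p) (setoidWalk π.1 0)
      (walkParent (setoidWalk π.1)) (walkDepth (setoidWalk π.1)) := fun π =>
    (hS π π.2).2.1.isTreeWalk (hS π π.2).1 (setoidWalk_surj _)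
  choose q hq1 hq2 using fun π : S => (hW π).exists_partition
  have hmaps : ∀ π ∈ (Finset.univ : Finset S), q π ∈ (Finset.univ : Finset (Nat.Partition p)).filter
      (fun q => Multiset.card q.parts = ℓ) := by
    intro π _
    have := hq1 π
    rw [(hS π π.2).2.2] at this
    simp only [Finset.mem_filter, Finset.mem_univ, true_and]
    omega
  rw [← Fintype.card_coe, ← Finset.card_univ, Finset.card_eq_sum_card_fiberwise hmaps, treeCount]
  refine Finset.sum_le_sum fun q0 _ => ?_
  have hfin : Finite {x : Σ t : Finset (List ℕ), Finpartition t //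
      IsPlaneTree x.1 ∧ x.1.card = p + 1 ∧ IsAdmissibleColoring x.2 ∧
        (x.2.parts.erase {[]}).val.map Finset.card = q0.parts} :=
    ((finite_coloredTrees (p + 1)).subset fun x hx => ⟨hx.1, hx.2.1⟩)
  let F : {π // π ∈ (Finset.univ : Finset S).filter (fun π => q π = q0)} →
      {x : Σ t : Finset (List ℕ), Finpartition t //
        IsPlaneTree x.1 ∧ x.1.card = p + 1 ∧ IsAdmissibleColoring x.2 ∧
          (x.2.parts.erase {[]}).val.map Finset.card = q0.parts} := fun π =>
    ⟨⟨_, (hW π.1).coloring⟩, (contour_spec _ _).1, by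
      have h2 := ((hW π.1).length_contour le_rfl)
      rw [(hW π.1).finish, (hW π.1).depth_root] at h2
      simp only
      omega, (hW π.1).isAdmissibleColoring, by
      have h1 := (Finset.mem_filter.1 π.2).2
      have h2 := hq2 π.1
      rw [h1] at h2
      convert h2⟩
  have hF : Function.Injective F := by
    intro π π' hππ
    have heq := congrArg Subtype.val hππ
    apply Subtype.ext
    apply Subtype.ext
    ext i j
    have := (hW π.1).eq_iff_eq_of_coloring_eq (hW π'.1) heq (i := i) (j := j)
      (by omega) (by omega)
    rw [setoidWalk_val, setoidWalk_val, setoidWalk_val, setoidWalk_val] at this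
    rw [Quotient.eq, Quotient.eq] at this
    exact this
  have := Nat.card_le_card_of_injective F hF
  rw [Nat.card_eq_fintype_card, Fintype.card_coe] at this
  exact this

/-! ### Taylor remainders of the cosine -/

/-- The Taylor remainder of `cos (θ x)` of order `2 m`, divided by `(-1) ^ m * θ ^ (2 m)`. -/
noncomputable def cosRemainder (m : ℕ) (θ x : ℝ) : ℝ :=
  ∑' j : ℕ, (-1) ^ j * θ ^ (2 * j) * x ^ (2 * (j + m)) / (2 * (j + m)).factorial

/-- Replacing `(2(j+m))!` by the smaller `(2j)!` leaves `x^(2m)` times the series of `cosh (θ x)`,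
which yields summability and the bound on the remainder. -/
lemma norm_cosRemainder_term_le (m : ℕ) (θ x : ℝ) (j : ℕ) :
    ‖(-1 : ℝ) ^ j * θ ^ (2 * j) * x ^ (2 * (j + m)) / (2 * (j + m)).factorial‖ ≤
      x ^ (2 * m) * ((θ * x) ^ (2 * j) / (2 * j).factorial) := by
  rw [norm_div, norm_mul, norm_mul, norm_pow, norm_neg, norm_one, one_pow, one_mul,
    Real.norm_of_nonneg (Even.pow_nonneg (even_two_mul _) _),
    Real.norm_of_nonneg (Even.pow_nonneg (even_two_mul _) _),
    Real.norm_of_nonneg (Nat.cast_nonneg _)]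
  have h : θ ^ (2 * j) * x ^ (2 * (j + m)) = x ^ (2 * m) * (θ * x) ^ (2 * j) := by
    rw [mul_add, pow_add, mul_pow]; ring
  rw [h, mul_div_assoc]
  refine mul_le_mul_of_nonneg_left ?_ (Even.pow_nonneg (even_two_mul _) _)
  refine div_le_div_of_nonneg_left (Even.pow_nonneg (even_two_mul _) _)
    (by exact_mod_cast Nat.factorial_pos _) ?_
  exact_mod_cast Nat.factorial_le (by omega)

lemma summable_cosRemainder (m : ℕ) (θ x : ℝ) :
    Summable fun j : ℕ => (-1 : ℝ) ^ j * θ ^ (2 * j) * x ^ (2 * (j + m)) /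
      (2 * (j + m)).factorial :=
  Summable.of_norm_bounded ((Real.hasSum_cosh (θ * x)).summable.mul_left _)
    (norm_cosRemainder_term_le m θ x)

lemma abs_cosRemainder_le (m : ℕ) (θ x : ℝ) :
    |cosRemainder m θ x| ≤ x ^ (2 * m) * Real.cosh (θ * x) := by
  rw [← Real.norm_eq_abs]
  exact tsum_of_norm_bounded ((Real.hasSum_cosh (θ * x)).mul_left _)
    (norm_cosRemainder_term_le m θ x)

lemma cosRemainder_eq (m : ℕ) (θ x : ℝ) :
    cosRemainder m θ x = x ^ (2 * m) / (2 * m).factorial - θ ^ 2 * cosRemainder (m + 1) θ x := by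
  rw [cosRemainder, (summable_cosRemainder m θ x).tsum_eq_zero_add, cosRemainder, ← tsum_mul_left,
    sub_eq_add_neg, ← tsum_neg]
  congr 1
  · simp
  · refine tsum_congr fun j => ?_
    rw [show j + 1 + m = j + (m + 1) by ring]
    ring

lemma cosRemainder_zero (θ x : ℝ) : cosRemainder 0 θ x = Real.cos (θ * x) := by
  rw [cosRemainder, ← (Real.hasSum_cos (θ * x)).tsum_eq]
  refine tsum_congr fun j => ?_
  rw [add_zero, mul_pow]; ring

lemma one_sub_cos_eq (θ x : ℝ) : 1 - Real.cos (θ * x) = θ ^ 2 * cosRemainder 1 θ x := by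
  have := cosRemainder_eq 0 θ x
  rw [cosRemainder_zero] at this
  simp at this
  linarith

lemma measurable_cosRemainder (m : ℕ) (θ : ℝ) (hθ : θ ≠ 0) : Measurable (cosRemainder m θ) := by
  induction m with
  | zero =>
    have : cosRemainder 0 θ = fun x => Real.cos (θ * x) := funext (cosRemainder_zero θ)
    rw [this]
    fun_prop
  | succ m ih =>
    have : cosRemainder (m + 1) θ = fun x =>
        (x ^ (2 * m) / (2 * m).factorial - cosRemainder m θ x) / θ ^ 2 := by
      funext x
      rw [cosRemainder_eq m θ x]
      field_simp
      ring
    rw [this]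
    fun_prop

/-- If `f n θ` converges for all small `θ > 0` and is uniformly close to `c n`, then `c n`
converges. -/
lemma exists_tendsto_of_approx {c : ℕ → ℝ} {f : ℕ → ℝ → ℝ} {L : ℝ → ℝ} {θ₀ D : ℝ} (hθ₀ : 0 < θ₀)
    (hf : ∀ θ, 0 < θ → θ ≤ θ₀ → Tendsto (fun n => f n θ) atTop (𝓝 (L θ)))
    (hc : ∀ n θ, 0 < θ → θ ≤ θ₀ → |c n - f n θ| ≤ D * θ ^ 2) :
    ∃ κ, Tendsto c atTop (𝓝 κ) ∧ ∀ θ, 0 < θ → θ ≤ θ₀ → |κ - L θ| ≤ D * θ ^ 2 := by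
  have hcau : CauchySeq c := by
    rw [Metric.cauchySeq_iff]
    intro ε hε
    -- A fixed `θ` with `D θ² < ε/3` suffices: two approximation errors plus the Cauchy error of `f
    -- n θ` stay below `ε`.
    have hlim : Tendsto (fun θ : ℝ => D * θ ^ 2) (𝓝[>] 0) (𝓝 0) := by
      have : Tendsto (fun θ : ℝ => D * θ ^ 2) (𝓝 0) (𝓝 (D * 0 ^ 2)) :=
        (continuous_const.mul (continuous_pow 2)).tendsto 0
      simp only [ne_eq, OfNat.ofNat_ne_zero, not_false_eq_true, zero_pow, mul_zero] at this
      exact this.mono_left nhdsWithin_le_nhds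
    obtain ⟨θ, h1, h2, h3⟩ := ((hlim.eventually_lt_const (show 0 < ε / 3 by linarith)).and
      (Ioc_mem_nhdsGT hθ₀)).exists
    obtain ⟨N, hN⟩ := Metric.cauchySeq_iff.1 (hf θ h2 h3).cauchySeq (ε / 3) (by linarith)
    refine ⟨N, fun m hm n hn => ?_⟩
    have a1 := hc m θ h2 h3
    have a2 := hc n θ h2 h3
    have a3 := hN m hm n hn
    rw [Real.dist_eq] at a3 ⊢
    rw [abs_lt] at a3 ⊢
    rw [abs_le] at a1 a2
    constructor <;> linarith
  obtain ⟨κ, hκ⟩ := cauchySeq_tendsto_of_complete hcau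
  exact ⟨κ, hκ, fun θ h1 h2 => le_of_tendsto (hκ.sub (hf θ h1 h2)).abs
    (Eventually.of_forall fun n => hc n θ h1 h2)⟩

/-! ### Triangular arrays of bounded variables -/

section Array

variable {μ : ℕ → Measure ℝ} [∀ n, IsProbabilityMeasure (μ n)] {τ : ℝ}

lemma integrable_pow_of_ae_abs_le {ρ : Measure ℝ} [IsFiniteMeasure ρ] (h : ∀ᵐ x ∂ρ, |x| ≤ τ)
    (m : ℕ) : Integrable (fun x => x ^ m) ρ :=
  Integrable.of_bound (by fun_prop) (τ ^ m) (h.mono fun x hx => by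
    rw [norm_pow, Real.norm_eq_abs]; exact pow_le_pow_left₀ (abs_nonneg _) hx m)

lemma integral_pow_le_of_ae_abs_le {ρ : Measure ℝ} [IsFiniteMeasure ρ] (h : ∀ᵐ x ∂ρ, |x| ≤ τ)
    (m : ℕ) : ∫ x, x ^ (2 * (m + 1)) ∂ρ ≤ τ ^ (2 * m) * ∫ x, x ^ 2 ∂ρ := by
  rw [← integral_const_mul]
  refine integral_mono_ae (integrable_pow_of_ae_abs_le h _)
    ((integrable_pow_of_ae_abs_le h _).const_mul _) (h.mono fun x hx => ?_)
  have h1 : x ^ (2 * m) ≤ τ ^ (2 * m) := by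
    rw [← Even.pow_abs (even_two_mul m)]
    exact pow_le_pow_left₀ (abs_nonneg _) hx _
  have h2 : x ^ (2 * (m + 1)) = x ^ (2 * m) * x ^ 2 := by ring
  simp only [h2]
  exact mul_le_mul_of_nonneg_right h1 (sq_nonneg x)

lemma integrable_cos {ρ : Measure ℝ} [IsFiniteMeasure ρ] (θ : ℝ) :
    Integrable (fun x => Real.cos (θ * x)) ρ :=
  Integrable.of_bound (by fun_prop) 1 (ae_of_all _ fun x => Real.abs_cos_le_one _)

lemma abs_mul_le_one {θ x : ℝ} (h0 : 0 < θ) (h1 : θ * τ ≤ 1) (hx : |x| ≤ τ) : |θ * x| ≤ 1 := by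
  rw [abs_mul, abs_of_pos h0]
  exact (mul_le_mul_of_nonneg_left hx h0.le).trans h1

/-- If the powers `(∫ cos (θ x) μ_n(dx)) ^ (n + 1)` converge to `exp (-g)`, then
`(n + 1) ∫ (1 - cos (θ x)) μ_n(dx)` converges to `g`. -/
lemma tendsto_mul_one_sub_integral_cos (hb : ∀ n, ∀ᵐ x ∂μ n, |x| ≤ τ) {θ g : ℝ} (h0 : 0 < θ)
    (h1 : θ * τ ≤ 1)
    (hlim : Tendsto (fun n : ℕ => (∫ x, Real.cos (θ * x) ∂μ n) ^ (n + 1)) atTop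
      (𝓝 (Real.exp (-g)))) :
    Tendsto (fun n : ℕ => ((n : ℝ) + 1) * (1 - ∫ x, Real.cos (θ * x) ∂μ n)) atTop (𝓝 g) := by
  set φ : ℕ → ℝ := fun n => ∫ x, Real.cos (θ * x) ∂μ n
  -- On the support `|θ x| ≤ 1`, so the cosine is at least `cos 1 > 0` and logarithms may be taken.
  have hφpos : ∀ n, 0 < φ n := by
    intro n
    refine lt_of_lt_of_le Real.cos_one_pos ?_
    have : ∫ _, Real.cos 1 ∂μ n ≤ φ n := by
      refine integral_mono_ae (integrable_const _) (integrable_cos θ) ((hb n).mono fun x hx => ?_)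
      simp only
      rw [← Real.cos_abs (θ * x)]
      exact Real.cos_le_cos_of_nonneg_of_le_pi (abs_nonneg _) (by linarith [Real.pi_gt_three])
        (abs_mul_le_one h0 h1 hx)
    simpa using this
  have hlog : Tendsto (fun n : ℕ => ((n : ℝ) + 1) * Real.log (φ n)) atTop (𝓝 (-g)) := by
    have := (Real.continuousAt_log (Real.exp_pos (-g)).ne').tendsto.comp hlim
    rw [Real.log_exp] at this
    refine this.congr fun n => ?_
    rw [Function.comp_apply, Real.log_pow]
    push_cast
    rfl
  have hneg : Tendsto (fun n : ℕ => -(((n : ℝ) + 1) * Real.log (φ n))) atTop (𝓝 g) := by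
    simpa using hlog.neg
  have hlogφ : Tendsto (fun n => Real.log (φ n)) atTop (𝓝 0) := by
    have := hlog.mul tendsto_one_div_add_atTop_nhds_zero_nat
    rw [mul_zero] at this
    refine this.congr fun n => ?_
    field_simp
  have hφ : Tendsto φ atTop (𝓝 1) := by
    have := (Real.continuous_exp.tendsto 0).comp hlogφ
    rw [Real.exp_zero] at this
    exact this.congr fun n => Real.exp_log (hφpos n)
  -- Squeeze with `-φ log φ ≤ 1 - φ ≤ -log φ`; the two sides have the same limit because `φ n → 1`.
  refine tendsto_of_tendsto_of_tendsto_of_le_of_le (by simpa using hφ.mul hneg) hneg ?_ ?_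
  · intro n
    have := Real.one_sub_inv_le_log_of_pos (hφpos n)
    have h2 : φ n - 1 ≤ φ n * Real.log (φ n) := by
      have := mul_le_mul_of_nonneg_left this (hφpos n).le
      rwa [mul_sub, mul_one, mul_inv_cancel₀ (hφpos n).ne'] at this
    have h3 : (0 : ℝ) ≤ (n : ℝ) + 1 := by positivity
    have := mul_le_mul_of_nonneg_left h2 h3
    simp only
    nlinarith
  · intro n
    have := Real.log_le_sub_one_of_pos (hφpos n)
    have h3 : (0 : ℝ) ≤ (n : ℝ) + 1 := by positivity
    have := mul_le_mul_of_nonneg_left this h3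
    simp only
    nlinarith

/-- The second moments are of order `1 / n`. -/
lemma exists_forall_mul_integral_sq_le (hb : ∀ n, ∀ᵐ x ∂μ n, |x| ≤ τ) {θ g : ℝ}
    (h0 : 0 < θ) (h1 : θ * τ ≤ 1)
    (hlim : Tendsto (fun n : ℕ => (∫ x, Real.cos (θ * x) ∂μ n) ^ (n + 1)) atTop
      (𝓝 (Real.exp (-g)))) :
    ∃ A : ℝ, 0 ≤ A ∧ ∀ n : ℕ, ((n : ℝ) + 1) * ∫ x, x ^ 2 ∂μ n ≤ A := by
  obtain ⟨B, hB⟩ := (tendsto_mul_one_sub_integral_cos hb h0 h1 hlim).bddAbove_range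
  have hB' : ∀ n : ℕ, ((n : ℝ) + 1) * (1 - ∫ x, Real.cos (θ * x) ∂μ n) ≤ B :=
    fun n => hB ⟨n, rfl⟩
  -- The constant comes from `cos y ≤ 1 - (2/π²) y²` for `|y| ≤ π`.
  set K : ℝ := 2 / Real.pi ^ 2 * θ ^ 2
  have hK : 0 < K := by positivity
  have key : ∀ n : ℕ, K * (((n : ℝ) + 1) * ∫ x, x ^ 2 ∂μ n) ≤ B := by
    intro n
    refine le_trans ?_ (hB' n)
    have : K * ∫ x, x ^ 2 ∂μ n ≤ 1 - ∫ x, Real.cos (θ * x) ∂μ n := by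
      have e1 : (1 : ℝ) - ∫ x, Real.cos (θ * x) ∂μ n = ∫ x, (1 - Real.cos (θ * x)) ∂μ n := by
        rw [integral_sub (integrable_const _) (integrable_cos θ)]
        simp
      rw [e1, ← integral_const_mul]
      refine integral_mono_ae ((integrable_pow_of_ae_abs_le (hb n) 2).const_mul _)
        ((integrable_const _).sub (integrable_cos θ)) ((hb n).mono fun x hx => ?_)
      have := Real.cos_le_one_sub_mul_cos_sq (x := θ * x)
        ((abs_mul_le_one h0 h1 hx).trans (by linarith [Real.pi_gt_three]))
      simp only [K]
      rw [mul_pow] at this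
      linarith
    have h3 : (0 : ℝ) ≤ (n : ℝ) + 1 := by positivity
    nlinarith [mul_le_mul_of_nonneg_left this h3]
  refine ⟨B / K, ?_, fun n => ?_⟩
  · refine div_nonneg (le_trans ?_ (key 0)) hK.le
    have : 0 ≤ ∫ x, x ^ 2 ∂μ 0 := integral_nonneg fun x => sq_nonneg x
    positivity
  · rw [le_div_iff₀ hK, mul_comm]
    exact key n

/-- Convergence of the powers of the characteristic functions near `0` implies convergence of the
even moments, multiplied by `n`. -/
lemma exists_tendsto_mul_integral_pow (hτ : 0 < τ) (hb : ∀ n, ∀ᵐ x ∂μ n, |x| ≤ τ) {g : ℝ → ℝ}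
    {θ₀ : ℝ} (h0 : 0 < θ₀) (h1 : θ₀ * τ ≤ 1)
    (hlim : ∀ θ, 0 < θ → θ ≤ θ₀ →
      Tendsto (fun n : ℕ => (∫ x, Real.cos (θ * x) ∂μ n) ^ (n + 1)) atTop
        (𝓝 (Real.exp (-g θ)))) :
    ∃ κ : ℕ → ℝ, (∀ m, 1 ≤ m →
      Tendsto (fun n : ℕ => ((n : ℝ) + 1) * ∫ x, x ^ (2 * m) ∂μ n) atTop (𝓝 (κ m))) ∧
      ∃ D : ℝ, ∀ θ, 0 < θ → θ ≤ θ₀ → |κ 1 / 2 - g θ / θ ^ 2| ≤ D * θ ^ 2 := by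
  obtain ⟨A, hA0, hA⟩ := exists_forall_mul_integral_sq_le hb h0 h1 (hlim θ₀ h0 le_rfl)
  have h1' : ∀ θ, 0 < θ → θ ≤ θ₀ → θ * τ ≤ 1 := fun θ _ h =>
    (mul_le_mul_of_nonneg_right h hτ.le).trans h1
  set f : ℕ → ℕ → ℝ → ℝ := fun m n θ => ((n : ℝ) + 1) * ∫ x, cosRemainder m θ x ∂μ n with hf
  set c : ℕ → ℕ → ℝ := fun m n =>
    ((n : ℝ) + 1) * ∫ x, x ^ (2 * m) / (2 * m).factorial ∂μ n with hc
  have hremb : ∀ m n θ, 0 < θ → θ ≤ θ₀ → ∀ᵐ x ∂μ n,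
      |cosRemainder m θ x| ≤ x ^ (2 * m) * Real.cosh 1 := by
    intro m n θ hp hq
    filter_upwards [hb n] with x hx
    refine (abs_cosRemainder_le m θ x).trans (mul_le_mul_of_nonneg_left ?_
      (Even.pow_nonneg (even_two_mul _) _))
    rw [Real.cosh_le_cosh, abs_one]
    exact abs_mul_le_one hp (h1' θ hp hq) hx
  have hint : ∀ m n θ, 0 < θ → θ ≤ θ₀ → Integrable (cosRemainder m θ) (μ n) := by
    intro m n θ hp hq
    refine Integrable.mono' ((integrable_pow_of_ae_abs_le (hb n) (2 * m)).mul_const (Real.cosh 1))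
      (measurable_cosRemainder m θ hp.ne').aestronglyMeasurable (hremb m n θ hp hq)
  have hrec : ∀ m n θ, 0 < θ → θ ≤ θ₀ → f m n θ = c m n - θ ^ 2 * f (m + 1) n θ := by
    intro m n θ hp hq
    simp only [hf, hc]
    rw [integral_congr_ae (ae_of_all _ (cosRemainder_eq m θ)), integral_sub
      ((integrable_pow_of_ae_abs_le (hb n) (2 * m)).div_const _)
      ((hint (m + 1) n θ hp hq).const_mul _), integral_const_mul]
    ring
  have hbound : ∀ m n θ, 0 < θ → θ ≤ θ₀ →
      |f (m + 1) n θ| ≤ τ ^ (2 * m) * A * Real.cosh 1 := by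
    intro m n θ hp hq
    have h3 : (0 : ℝ) ≤ (n : ℝ) + 1 := by positivity
    simp only [hf]
    rw [abs_mul, abs_of_nonneg h3]
    have e1 : |∫ x, cosRemainder (m + 1) θ x ∂μ n| ≤
        ∫ x, x ^ (2 * (m + 1)) * Real.cosh 1 ∂μ n := by
      rw [← Real.norm_eq_abs]
      exact norm_integral_le_of_norm_le
        ((integrable_pow_of_ae_abs_le (hb n) _).mul_const _) (hremb (m + 1) n θ hp hq)
    rw [integral_mul_const] at e1
    have e2 := integral_pow_le_of_ae_abs_le (hb n) m
    have e3 : 0 ≤ τ ^ (2 * m) := by positivity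
    have e4 := Real.cosh_pos 1
    calc ((n : ℝ) + 1) * |∫ x, cosRemainder (m + 1) θ x ∂μ n|
        ≤ ((n : ℝ) + 1) * ((τ ^ (2 * m) * ∫ x, x ^ 2 ∂μ n) * Real.cosh 1) :=
          mul_le_mul_of_nonneg_left (e1.trans (mul_le_mul_of_nonneg_right e2 e4.le)) h3
      _ = τ ^ (2 * m) * (((n : ℝ) + 1) * ∫ x, x ^ 2 ∂μ n) * Real.cosh 1 := by ring
      _ ≤ _ := mul_le_mul_of_nonneg_right (mul_le_mul_of_nonneg_left (hA n) e3) e4.le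
  have happ : ∀ m n θ, 0 < θ → θ ≤ θ₀ →
      |c m n - f m n θ| ≤ (τ ^ (2 * m) * A * Real.cosh 1) * θ ^ 2 := by
    intro m n θ hp hq
    rw [hrec m n θ hp hq, sub_sub_cancel, abs_mul, abs_of_nonneg (sq_nonneg θ), mul_comm]
    exact mul_le_mul_of_nonneg_right (hbound m n θ hp hq) (sq_nonneg θ)
  have hconv1 : ∀ θ, 0 < θ → θ ≤ θ₀ →
      Tendsto (fun n => f 1 n θ) atTop (𝓝 (g θ / θ ^ 2)) := by
    intro θ hp hq
    have := (tendsto_mul_one_sub_integral_cos hb hp (h1' θ hp hq) (hlim θ hp hq)).div_const (θ ^ 2)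
    refine this.congr fun n => ?_
    have e1 : (1 : ℝ) - ∫ x, Real.cos (θ * x) ∂μ n = θ ^ 2 * ∫ x, cosRemainder 1 θ x ∂μ n := by
      rw [← integral_const_mul, ← integral_congr_ae (ae_of_all _ (one_sub_cos_eq θ)),
        integral_sub (integrable_const _) (integrable_cos θ)]
      simp
    simp only [hf]
    rw [e1]
    field_simp
  -- Bootstrap: if the scaled remainder of one order converges for all small `θ`, its leading
  -- coefficient converges as it is within `O(θ²)` uniformly in `n`; subtracting and dividing by
  -- `θ²` gives convergence at the next order.
  have hconv : ∀ m, ∃ L : ℝ → ℝ, ∀ θ, 0 < θ → θ ≤ θ₀ →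
      Tendsto (fun n => f (m + 1) n θ) atTop (𝓝 (L θ)) := by
    intro m
    induction m with
    | zero => exact ⟨_, hconv1⟩
    | succ m ih =>
      obtain ⟨L, hL⟩ := ih
      obtain ⟨κ, hκ, -⟩ := exists_tendsto_of_approx h0 hL (happ (m + 1))
      refine ⟨fun θ => (κ - L θ) / θ ^ 2, fun θ hp hq => ?_⟩
      refine ((hκ.sub (hL θ hp hq)).div_const (θ ^ 2)).congr fun n => ?_
      rw [hrec (m + 1) n θ hp hq]
      field_simp
      ring
  have hcm : ∀ m n, c m n = (((n : ℝ) + 1) * ∫ x, x ^ (2 * m) ∂μ n) / (2 * m).factorial := by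
    intro m n
    simp only [hc]
    rw [integral_div, mul_div_assoc]
  have hlimc : ∀ m, ∃ κ, Tendsto (c (m + 1)) atTop (𝓝 κ) := by
    intro m
    obtain ⟨L, hL⟩ := hconv m
    obtain ⟨κ, hκ, -⟩ := exists_tendsto_of_approx h0 hL (happ (m + 1))
    exact ⟨κ, hκ⟩
  choose κ' hκ' using hlimc
  obtain ⟨κ₁, hκ₁, hD⟩ := exists_tendsto_of_approx h0 hconv1 (happ 1)
  -- The limits `κ'` belong to `x^(2(m+1))/(2(m+1))!`, hence the index shift and the factorial; the
  -- last constant is the approximation error at order one.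
  refine ⟨fun m => κ' (m - 1) * (2 * m).factorial, fun m hm => ?_, τ ^ (2 * 1) * A * Real.cosh 1,
    fun θ hp hq => ?_⟩
  · obtain ⟨m, rfl⟩ := Nat.exists_eq_add_of_le' hm
    simp only [Nat.add_sub_cancel]
    refine ((hκ' m).mul_const _).congr fun n => ?_
    rw [hcm, div_mul_cancel₀]
    exact_mod_cast (Nat.factorial_pos _).ne'
  · have := tendsto_nhds_unique hκ₁ (hκ' 0)
    have h2 : κ' (1 - 1) * ((2 * 1).factorial : ℝ) / 2 = κ₁ := by
      rw [this]
      simp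
    rw [h2]
    exact hD θ hp hq

end Array

/-! ### The Lévy exponent -/

section Levy

variable {ν : Measure ℝ}

lemma IsLevyMeasure.integrable_min (h : IsLevyMeasure ν) :
    Integrable (fun x : ℝ => min 1 (x ^ 2)) ν := by
  refine ⟨by fun_prop, ?_⟩
  rw [hasFiniteIntegral_iff_ofReal (ae_of_all _ fun x => le_min zero_le_one (sq_nonneg x))]
  exact h.finite

/-- For `|x| ≤ 1` the Taylor remainder and the change of compensator are each at most `x²`; for `|x|
≥ 1` each of the three terms is at most `1`. -/
lemma norm_levy_integrand_le {θ : ℝ} (h0 : 0 ≤ θ) (h1 : θ ≤ 1) (x : ℝ) :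
    ‖Complex.exp (Complex.I * θ * x) - 1 - Complex.I * θ * x / (1 + (x : ℂ) ^ 2)‖ ≤
      3 * min 1 (x ^ 2) := by
  have hden : (1 + (x : ℂ) ^ 2) = ((1 + x ^ 2 : ℝ) : ℂ) := by push_cast; ring
  have hpos : 0 < 1 + x ^ 2 := by positivity
  have hne : (1 + (x : ℂ) ^ 2) ≠ 0 := by
    rw [hden]; exact_mod_cast hpos.ne'
  have hnI : ‖Complex.I * θ * x‖ = θ * |x| := by
    rw [norm_mul, norm_mul, Complex.norm_I, one_mul, Complex.norm_real, Complex.norm_real,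
      Real.norm_of_nonneg h0, Real.norm_eq_abs]
  have hnd : ‖(1 + (x : ℂ) ^ 2)‖ = 1 + x ^ 2 := by
    rw [hden, Complex.norm_real, Real.norm_of_nonneg hpos.le]
  rcases le_total |x| 1 with hx | hx
  · have hx2 : x ^ 2 ≤ 1 := by rw [← sq_abs]; nlinarith [abs_nonneg x]
    rw [min_eq_right hx2]
    have hsplit : Complex.exp (Complex.I * θ * x) - 1 - Complex.I * θ * x / (1 + (x : ℂ) ^ 2) =
        (Complex.exp (Complex.I * θ * x) - 1 - Complex.I * θ * x) +
          Complex.I * θ * x * ((x : ℂ) ^ 2 / (1 + (x : ℂ) ^ 2)) := by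
      field_simp
      ring
    have hle : θ * |x| ≤ 1 := by nlinarith [abs_nonneg x]
    have e1 := Complex.norm_exp_sub_one_sub_id_le (x := Complex.I * θ * x) (by rw [hnI]; exact hle)
    rw [hnI] at e1
    have e2 : ‖Complex.I * θ * x * ((x : ℂ) ^ 2 / (1 + (x : ℂ) ^ 2))‖ ≤ x ^ 2 := by
      rw [norm_mul, hnI, norm_div, hnd, norm_pow, Complex.norm_real, Real.norm_eq_abs, sq_abs]
      have : x ^ 2 / (1 + x ^ 2) ≤ x ^ 2 := div_le_self (sq_nonneg x) (by linarith [sq_nonneg x])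
      have h3 : 0 ≤ x ^ 2 / (1 + x ^ 2) := by positivity
      nlinarith [abs_nonneg x]
    have e3 : (θ * |x|) ^ 2 ≤ x ^ 2 := by
      rw [mul_pow, sq_abs]
      exact mul_le_of_le_one_left (sq_nonneg x) (pow_le_one₀ h0 h1)
    rw [hsplit]
    refine (norm_add_le _ _).trans ?_
    linarith [sq_nonneg x]
  · have hx2 : 1 ≤ x ^ 2 := by rw [← sq_abs]; nlinarith [abs_nonneg x]
    rw [min_eq_left hx2]
    have e1 : ‖Complex.exp (Complex.I * θ * x)‖ = 1 := by
      rw [show Complex.I * θ * x = ((θ * x : ℝ) : ℂ) * Complex.I by push_cast; ring]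
      exact Complex.norm_exp_ofReal_mul_I _
    have e2 : ‖Complex.I * θ * x / (1 + (x : ℂ) ^ 2)‖ ≤ 1 := by
      rw [norm_div, hnI, hnd, div_le_one hpos, ← sq_abs]
      nlinarith [abs_nonneg x]
    refine (norm_sub_le _ _).trans ?_
    have := norm_sub_le (Complex.exp (Complex.I * θ * x)) 1
    rw [e1, norm_one] at this
    linarith

lemma IsLevyMeasure.integrable_levy_integrand (h : IsLevyMeasure ν) {θ : ℝ} (h0 : 0 ≤ θ)
    (h1 : θ ≤ 1) : Integrable (fun x : ℝ =>
      Complex.exp (Complex.I * θ * x) - 1 - Complex.I * θ * x / (1 + (x : ℂ) ^ 2)) ν := by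
  refine Integrable.mono' (h.integrable_min.const_mul 3) ?_
    (ae_of_all _ (norm_levy_integrand_le h0 h1))
  exact Measurable.aestronglyMeasurable (by fun_prop)

/-- The compensator is purely imaginary, so it disappears when the modulus of the characteristic
function is taken. -/
lemma re_levy_integrand (θ x : ℝ) :
    (Complex.exp (Complex.I * θ * x) - 1 - Complex.I * θ * x / (1 + (x : ℂ) ^ 2)).re =
      Real.cos (θ * x) - 1 := by
  have e1 : Complex.exp (Complex.I * θ * x) = Complex.exp (((θ * x : ℝ) : ℂ) * Complex.I) := by
    congr 1; push_cast; ring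
  have e2 : Complex.I * θ * x / (1 + (x : ℂ) ^ 2) =
      ((θ * x / (1 + x ^ 2) : ℝ) : ℂ) * Complex.I := by push_cast; ring
  rw [e1, e2, Complex.sub_re, Complex.sub_re, Complex.exp_ofReal_mul_I_re, Complex.re_ofReal_mul,
    Complex.I_re, Complex.one_re]
  ring

lemma IsLevyMeasure.integrable_one_sub_cos (h : IsLevyMeasure ν) {θ : ℝ} (h0 : 0 ≤ θ)
    (h1 : θ ≤ 1) : Integrable (fun x : ℝ => 1 - Real.cos (θ * x)) ν := by
  refine (h.integrable_levy_integrand h0 h1).re.neg.congr (ae_of_all _ fun x => ?_)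
  have := re_levy_integrand θ x
  simp only [RCLike.re_eq_complex_re, Pi.neg_apply]
  rw [this]
  ring

lemma IsLevyMeasure.re_levyExponent (h : IsLevyMeasure ν) (σ : ℝ) {θ : ℝ} (h0 : 0 ≤ θ)
    (h1 : θ ≤ 1) : (levyExponent σ 0 ν θ).re =
      -(θ ^ 2 * σ ^ 2 / 2 + ∫ x, (1 - Real.cos (θ * x)) ∂ν) := by
  have e1 : (∫ x : ℝ, (Complex.exp (Complex.I * θ * x) - 1 -
      Complex.I * θ * x / (1 + (x : ℂ) ^ 2)) ∂ν).re = -∫ x, (1 - Real.cos (θ * x)) ∂ν := by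
    rw [← RCLike.re_eq_complex_re, ← integral_re (h.integrable_levy_integrand h0 h1),
      ← integral_neg]
    refine integral_congr_ae (ae_of_all _ fun x => ?_)
    simp only [RCLike.re_eq_complex_re]
    rw [re_levy_integrand]
    ring
  have e2 : (-(1 / 2) * (θ : ℂ) ^ 2 * (σ : ℂ) ^ 2 + Complex.I * θ * (0 : ℝ)) =
      ((-(1 / 2) * θ ^ 2 * σ ^ 2 : ℝ) : ℂ) := by push_cast; ring
  rw [levyExponent, Complex.add_re, e1, e2, Complex.ofReal_re]
  ring

/-- If the integrals of `(1 - cos (θ x)) / θ ^ 2` are bounded near `θ = 0`, then the second moment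
is finite. -/
lemma integrable_sq_of_one_sub_cos_le {θ₀ B : ℝ} (h0 : 0 < θ₀)
    (hint : ∀ θ, 0 < θ → θ ≤ θ₀ → Integrable (fun x : ℝ => 1 - Real.cos (θ * x)) ν)
    (hB : ∀ θ, 0 < θ → θ ≤ θ₀ → (∫ x, (1 - Real.cos (θ * x)) ∂ν) / θ ^ 2 ≤ B) :
    Integrable (fun x : ℝ => x ^ 2) ν := by
  set t : ℕ → ℝ := fun n => θ₀ / ((n : ℝ) + 1)
  have htpos : ∀ n, 0 < t n := fun n => by positivity
  have htle : ∀ n, t n ≤ θ₀ := fun n =>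
    div_le_self h0.le (by linarith [(Nat.cast_nonneg n : (0 : ℝ) ≤ n)])
  have htlim : Tendsto t atTop (𝓝 0) := by
    have := (tendsto_one_div_add_atTop_nhds_zero_nat (𝕜 := ℝ)).const_mul θ₀
    rw [mul_zero] at this
    refine this.congr fun n => ?_
    rw [mul_one_div]
  have hpt : ∀ x : ℝ, Tendsto (fun n => ENNReal.ofReal ((1 - Real.cos (t n * x)) / t n ^ 2)) atTop
      (𝓝 (ENNReal.ofReal (x ^ 2 / 2))) := by
    intro x
    refine ENNReal.tendsto_ofReal ?_
    rw [tendsto_iff_norm_sub_tendsto_zero]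
    have hx0 : Tendsto (fun n => t n * x) atTop (𝓝 0) := by simpa using htlim.mul_const x
    have hsmall : ∀ᶠ n in atTop, |t n * x| ≤ 1 := by
      have := hx0.abs
      rw [abs_zero] at this
      exact (this.eventually_lt_const one_pos).mono fun n hn => hn.le
    -- The factor `5/96` is the fourth-order error constant of `Real.cos_bound`, left after division
    -- by `t n ^ 2`.
    have hz : Tendsto (fun n => t n ^ 2 * (x ^ 4 * (5 / 96))) atTop (𝓝 0) := by
      have := (htlim.pow 2).mul_const (x ^ 4 * (5 / 96))
      simpa using this
    refine squeeze_zero' (Eventually.of_forall fun n => norm_nonneg _) ?_ hz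
    filter_upwards [hsmall] with n hn
    have hb := Real.cos_bound hn
    have ht2 : 0 < t n ^ 2 := pow_pos (htpos n) 2
    have htne : t n ≠ 0 := (htpos n).ne'
    have e : (1 - Real.cos (t n * x)) / t n ^ 2 - x ^ 2 / 2 =
        -(Real.cos (t n * x) - (1 - (t n * x) ^ 2 / 2)) / t n ^ 2 := by
      field_simp
      ring
    rw [e, Real.norm_eq_abs, abs_div, abs_neg, abs_of_pos ht2, div_le_iff₀ ht2]
    refine hb.trans (le_of_eq ?_)
    rw [abs_mul, mul_pow, abs_of_pos (htpos n), show |x| ^ 4 = x ^ 4 from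
      Even.pow_abs (by decide) x]
    ring
  have hfatou : ∫⁻ x, ENNReal.ofReal (x ^ 2 / 2) ∂ν ≤ ENNReal.ofReal B := by
    calc ∫⁻ x, ENNReal.ofReal (x ^ 2 / 2) ∂ν
        = ∫⁻ x, liminf (fun n => ENNReal.ofReal ((1 - Real.cos (t n * x)) / t n ^ 2)) atTop ∂ν :=
          lintegral_congr fun x => ((hpt x).liminf_eq).symm
      _ ≤ liminf (fun n => ∫⁻ x, ENNReal.ofReal ((1 - Real.cos (t n * x)) / t n ^ 2) ∂ν) atTop :=
          lintegral_liminf_le fun n => by fun_prop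
      _ ≤ ENNReal.ofReal B := by
          refine liminf_le_of_le (by isBoundedDefault) fun b hb => ?_
          obtain ⟨n, hn⟩ := hb.exists
          refine hn.trans ?_
          rw [← ofReal_integral_eq_lintegral_ofReal ((hint _ (htpos n) (htle n)).div_const _)
            (ae_of_all _ fun x => div_nonneg (by linarith [Real.cos_le_one (t n * x)])
              (sq_nonneg _)), integral_div]
          exact ENNReal.ofReal_le_ofReal (hB _ (htpos n) (htle n))
  have h2 : Integrable (fun x : ℝ => x ^ 2 / 2) ν := by
    refine ⟨by fun_prop, ?_⟩
    rw [hasFiniteIntegral_iff_ofReal (ae_of_all _ fun x => by positivity)]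
    exact hfatou.trans_lt ENNReal.ofReal_lt_top
  refine (h2.const_mul 2).congr (ae_of_all _ fun x => ?_)
  simp only
  ring

/-- The variance bound for an infinitely divisible law with the exponent `g`. -/
lemma IsLevyMeasure.le_of_abs_sub_le (h : IsLevyMeasure ν) (σ : ℝ) {θ₀ D κ : ℝ} (h0 : 0 < θ₀)
    (h1 : θ₀ ≤ 1)
    (hD : ∀ θ, 0 < θ → θ ≤ θ₀ →
      |κ / 2 - (θ ^ 2 * σ ^ 2 / 2 + ∫ x, (1 - Real.cos (θ * x)) ∂ν) / θ ^ 2| ≤ D * θ ^ 2) :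
    Integrable (fun x : ℝ => x ^ 2) ν ∧ κ ≤ σ ^ 2 + realMoment 2 ν := by
  have hsplit : ∀ θ, 0 < θ → (θ ^ 2 * σ ^ 2 / 2 + ∫ x, (1 - Real.cos (θ * x)) ∂ν) / θ ^ 2 =
      σ ^ 2 / 2 + (∫ x, (1 - Real.cos (θ * x)) ∂ν) / θ ^ 2 := by
    intro θ hθ
    field_simp
  have hDn : 0 ≤ D := by
    have := (abs_nonneg _).trans (hD θ₀ h0 le_rfl)
    exact nonneg_of_mul_nonneg_left this (by positivity)
  have hint : ∀ θ, 0 < θ → θ ≤ θ₀ → Integrable (fun x : ℝ => 1 - Real.cos (θ * x)) ν :=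
    fun θ hp hq => h.integrable_one_sub_cos hp.le (hq.trans h1)
  have hsq : Integrable (fun x : ℝ => x ^ 2) ν := by
    -- The Gaussian part is nonnegative and may be dropped, and `D θ² ≤ D` as `θ ≤ 1`.
    refine integrable_sq_of_one_sub_cos_le (B := κ / 2 + D) h0 hint fun θ hp hq => ?_
    have e := hD θ hp hq
    rw [hsplit θ hp, abs_le] at e
    have : D * θ ^ 2 ≤ D := by
      have : θ ^ 2 ≤ 1 := pow_le_one₀ hp.le (hq.trans h1)
      nlinarith
    linarith [sq_nonneg σ]
  refine ⟨hsq, ?_⟩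
  have hmain : ∀ θ, 0 < θ → θ ≤ θ₀ → κ / 2 ≤ σ ^ 2 / 2 + realMoment 2 ν / 2 + D * θ ^ 2 := by
    intro θ hp hq
    have e := hD θ hp hq
    rw [hsplit θ hp, abs_le] at e
    have e2 : (∫ x, (1 - Real.cos (θ * x)) ∂ν) / θ ^ 2 ≤ realMoment 2 ν / 2 := by
      rw [div_le_iff₀ (by positivity), realMoment, ← integral_div, ← integral_mul_const]
      refine integral_mono (hint θ hp hq) ((hsq.div_const _).mul_const _) fun x => ?_
      have := Real.one_sub_sq_div_two_le_cos (x := θ * x)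
      simp only
      rw [mul_pow] at this
      linarith
    linarith
  have hlim : Tendsto (fun θ : ℝ => σ ^ 2 / 2 + realMoment 2 ν / 2 + D * θ ^ 2) (𝓝[>] 0)
      (𝓝 (σ ^ 2 / 2 + realMoment 2 ν / 2)) := by
    have : Continuous fun θ : ℝ => σ ^ 2 / 2 + realMoment 2 ν / 2 + D * θ ^ 2 := by fun_prop
    have h2 := this.tendsto 0
    simp only [ne_eq, OfNat.ofNat_ne_zero, not_false_eq_true, zero_pow, mul_zero, add_zero] at h2
    exact h2.mono_left nhdsWithin_le_nhds
  have := ge_of_tendsto hlim ((Ioc_mem_nhdsGT h0 : _ ∈ 𝓝[>] (0 : ℝ)) |> fun hm =>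
    Filter.eventually_of_mem hm fun θ hθ => hmain θ hθ.1 hθ.2)
  linarith

end Levy

/-! ### Randomly signed row sums -/

instance : IsProbabilityMeasure rademacher := by
  refine ⟨?_⟩
  rw [rademacher, Measure.smul_apply, Measure.add_apply, measure_univ, measure_univ, smul_eq_mul,
    one_add_one_eq_two]
  exact ENNReal.inv_mul_cancel (by norm_num) (by norm_num)

lemma integral_exp_rademacher (t : ℝ) :
    ∫ x : ℝ, Complex.exp (Complex.I * (x * t : ℝ)) ∂rademacher = (Real.cos t : ℂ) := by
  have hi : ∀ a : ℝ, Integrable (fun x : ℝ => Complex.exp (Complex.I * (x * t : ℝ)))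
      (Measure.dirac a) := fun a => integrable_dirac (by simp)
  rw [rademacher, integral_smul_measure, integral_add_measure (hi _) (hi _), integral_dirac,
    integral_dirac, Complex.ofReal_cos, Complex.cos]
  simp only [ENNReal.toReal_inv, ENNReal.toReal_ofNat, Complex.real_smul]
  push_cast
  rw [show Complex.I * (1 * (t : ℂ)) = t * Complex.I by ring,
    show Complex.I * (-1 * (t : ℂ)) = -t * Complex.I by ring]
  ring

section RowSum

variable {Ω : Type*} [MeasurableSpace Ω] {P : Measure Ω} [IsProbabilityMeasure P] {n : ℕ}

lemma measurable_signedRowSum {A : Ω → Matrix (Fin n) (Fin n) ℂ}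
    (hA : ∀ j k, Measurable fun ω => A ω j k) (j : Fin n) :
    Measurable fun x : Ω × (Fin n → ℝ) => ∑ k, x.2 k * ‖A x.1 j k‖ := by
  refine Finset.measurable_sum _ fun k _ => ?_
  exact ((measurable_pi_apply k).comp measurable_snd).mul
    (((hA j k).comp measurable_fst).norm)

/-- Integrating over the signs first turns each exponential into a cosine. The diagonal entry
contributes `cos 0 = 1`, and independence along the row separates the remaining `n` factors. -/
lemma integral_exp_signedRowSumLaw {A : Ω → Matrix (Fin (n + 1)) (Fin (n + 1)) ℂ}
    (hA : ∀ j k, Measurable fun ω => A ω j k) (hdiag : ∀ ω j, A ω j j = 0)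
    (hind : iIndepFun (fun (e : {e : Fin (n + 1) × Fin (n + 1) // e.1 < e.2}) ω =>
      A ω e.1.1 e.1.2) P) (θ : ℝ) :
    ∫ x : ℝ, Complex.exp (Complex.I * θ * x) ∂(signedRowSumLaw P A 0) =
      ((∏ k : Fin n, ∫ ω, Real.cos (θ * ‖A ω 0 k.succ‖) ∂P : ℝ) : ℂ) := by
  have hmeas := measurable_signedRowSum hA 0
  rw [signedRowSumLaw, integral_map hmeas.aemeasurable
    (Measurable.aestronglyMeasurable (by fun_prop))]
  rw [integral_prod]
  swap
  · refine Integrable.of_bound (Measurable.aestronglyMeasurable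
      (by exact Complex.measurable_exp.comp
            (measurable_const.mul (Complex.measurable_ofReal.comp hmeas)))) 1
      (ae_of_all _ fun x => ?_)
    rw [mul_comm Complex.I, mul_assoc, mul_comm Complex.I, ← mul_assoc, ← Complex.ofReal_mul,
      Complex.norm_exp_ofReal_mul_I]
  have hinner : ∀ ω, ∫ y : Fin (n + 1) → ℝ,
      Complex.exp (Complex.I * θ * (∑ k, y k * ‖A ω 0 k‖ : ℝ)) ∂(Measure.pi fun _ => rademacher) =
      ((∏ k : Fin n, Real.cos (θ * ‖A ω 0 k.succ‖) : ℝ) : ℂ) := by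
    intro ω
    have e1 : ∀ y : Fin (n + 1) → ℝ,
        Complex.exp (Complex.I * θ * (∑ k, y k * ‖A ω 0 k‖ : ℝ)) =
          ∏ k, Complex.exp (Complex.I * (y k * (θ * ‖A ω 0 k‖) : ℝ)) := by
      intro y
      rw [← Complex.exp_sum]
      congr 1
      push_cast
      rw [Finset.mul_sum]
      exact Finset.sum_congr rfl fun k _ => by ring
    simp_rw [e1]
    rw [integral_fintype_prod_eq_prod (fun k (x : ℝ) =>
      Complex.exp (Complex.I * (x * (θ * ‖A ω 0 k‖) : ℝ)))]
    simp_rw [integral_exp_rademacher]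
    rw [Fin.prod_univ_succ, hdiag]
    simp
  simp only
  rw [integral_congr_ae (ae_of_all _ hinner), integral_complex_ofReal]
  congr 1
  have hind2 : iIndepFun (fun (k : Fin n) ω => A ω 0 k.succ) P :=
    hind.precomp (g := fun k : Fin n => ⟨(0, k.succ), Fin.succ_pos k⟩) (by
      intro k k' hk
      simpa using hk)
  exact hind2.integral_fun_prod_comp (f := fun _ z => Real.cos (θ * ‖z‖))
    (fun k => (hA 0 k.succ).aemeasurable) (fun k => Measurable.aestronglyMeasurable (by fun_prop))

end RowSum

/-- Weak convergence implies convergence of the characteristic functions. -/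
lemma WeaklyConverges.tendsto_integral_exp {μ : ℕ → Measure ℝ} {ρ : Measure ℝ}
    [∀ n, IsFiniteMeasure (μ n)] [IsFiniteMeasure ρ] (h : WeaklyConverges μ ρ) (θ : ℝ) :
    Tendsto (fun n => ∫ x : ℝ, Complex.exp (Complex.I * θ * x) ∂(μ n)) atTop
      (𝓝 (∫ x : ℝ, Complex.exp (Complex.I * θ * x) ∂ρ)) := by
  let fc : ℝ →ᵇ ℝ := BoundedContinuousFunction.ofNormedAddCommGroup (fun x => Real.cos (θ * x))
    (by fun_prop) 1 fun x => Real.abs_cos_le_one _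
  let fs : ℝ →ᵇ ℝ := BoundedContinuousFunction.ofNormedAddCommGroup (fun x => Real.sin (θ * x))
    (by fun_prop) 1 fun x => Real.abs_sin_le_one _
  have key : ∀ m : Measure ℝ, IsFiniteMeasure m →
      ∫ x : ℝ, Complex.exp (Complex.I * θ * x) ∂m =
        ((∫ x, fc x ∂m : ℝ) : ℂ) + ((∫ x, fs x ∂m : ℝ) : ℂ) * Complex.I := by
    intro m hm
    rw [← integral_complex_ofReal, ← integral_complex_ofReal, ← integral_mul_const,
      ← integral_add (fc.integrable m).ofReal ((fs.integrable m).ofReal.mul_const _)]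
    refine integral_congr_ae (ae_of_all _ fun x => ?_)
    simp only
    rw [show Complex.I * θ * x = ((θ * x : ℝ) : ℂ) * Complex.I by push_cast; ring,
      Complex.exp_mul_I, ← Complex.ofReal_cos, ← Complex.ofReal_sin]
    rfl
  rw [key ρ inferInstance]
  simp_rw [fun n => key (μ n) inferInstance]
  exact ((Complex.continuous_ofReal.tendsto _).comp (h fc)).add
    (((Complex.continuous_ofReal.tendsto _).comp (h fs)).mul_const _)

section Ensemble

variable {Ω : ℕ → Type*} [∀ n, MeasurableSpace (Ω n)] {P : ∀ n, Measure (Ω n)}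
  [∀ n, IsProbabilityMeasure (P n)] {C : ∀ n, Ω n → Matrix (Fin n) (Fin n) ℂ} {σ : ℝ}
  {ν : Measure ℝ} {τ : ℝ}

/-- The limits of the even moments of the entries, multiplied by the size. -/
theorem IsLevyKhintchineEnsemble.exists_tendsto_moments (hC : IsLevyKhintchineEnsemble P C σ ν)
    (hτ : 0 < τ) (hbound : ∀ n (j k : Fin n), ∀ᵐ ω ∂(P n), ‖C n ω j k‖ ≤ τ) :
    Integrable (fun x : ℝ => x ^ 2) ν ∧ ∃ κ : ℕ → ℝ, κ 1 ≤ σ ^ 2 + realMoment 2 ν ∧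
      ∀ m, 1 ≤ m → Tendsto (fun n : ℕ => ((n : ℝ) + 1) *
        ∫ ω, ‖C (n + 2) ω 0 1‖ ^ (2 * m) ∂(P (n + 2))) atTop (𝓝 (κ m)) := by
  obtain ⟨ρ, hρ, hlim⟩ := hC.rowSum
  have := hρ.prob
  have hν := hρ.levy
  set μ : ℕ → Measure ℝ := fun n => (P (n + 2)).map fun ω => ‖C (n + 2) ω 0 1‖ with hμ
  have hm : ∀ n, Measurable fun ω => ‖C (n + 2) ω 0 1‖ := fun n =>
    (hC.measurable (n + 2) 0 1).norm
  have : ∀ n, IsProbabilityMeasure (μ n) := fun n =>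
    Measure.isProbabilityMeasure_map (hm n).aemeasurable
  have hb : ∀ n, ∀ᵐ x ∂μ n, |x| ≤ τ := by
    intro n
    rw [ae_map_iff (hm n).aemeasurable (measurableSet_le (by fun_prop) measurable_const)]
    filter_upwards [hbound (n + 2) 0 1] with ω hω
    rwa [abs_norm]
  have hprob : ∀ n, IsProbabilityMeasure (signedRowSumLaw (P (n + 1)) (C (n + 1)) 0) := fun n =>
    Measure.isProbabilityMeasure_map (measurable_signedRowSum (hC.measurable (n + 1)) 0).aemeasurable
  have hpow : ∀ θ : ℝ, ∀ n : ℕ,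
      ∫ x : ℝ, Complex.exp (Complex.I * θ * x) ∂(signedRowSumLaw (P (n + 2)) (C (n + 2)) 0) =
        (((∫ x, Real.cos (θ * x) ∂μ n) ^ (n + 1) : ℝ) : ℂ) := by
    intro θ n
    rw [integral_exp_signedRowSumLaw (hC.measurable (n + 2)) (hC.diag (n + 2))
      (hC.indep (n + 2))]
    congr 1
    rw [Finset.prod_congr rfl (g := fun _ => ∫ x, Real.cos (θ * x) ∂μ n)]
    · simp
    · intro k _
      rw [hμ, integral_map (hm n).aemeasurable (Measurable.aestronglyMeasurable (by fun_prop))]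
      have hid := hC.identDistrib (n + 2) 0 k.succ 0 1 (Fin.succ_ne_zero k).symm (by simp)
      exact (hid.comp (u := fun x => Real.cos (θ * x)) (by fun_prop)).integral_eq
  have hlimc : ∀ θ : ℝ, Tendsto (fun n : ℕ =>
      (((∫ x, Real.cos (θ * x) ∂μ n) ^ (n + 1) : ℝ) : ℂ)) atTop
      (𝓝 (Complex.exp (levyExponent σ 0 ν θ))) := by
    intro θ
    rw [← hρ.charFun_eq θ]
    exact ((hlim.tendsto_integral_exp θ).comp (tendsto_add_atTop_nat 1)).congr fun n => hpow θ n
  set θ₀ : ℝ := min 1 (1 / τ)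
  have h0 : 0 < θ₀ := lt_min one_pos (by positivity)
  have h1 : θ₀ * τ ≤ 1 := by
    calc θ₀ * τ ≤ 1 / τ * τ := mul_le_mul_of_nonneg_right (min_le_right _ _) hτ.le
      _ = 1 := by field_simp
  have h1' : θ₀ ≤ 1 := min_le_left _ _
  set g : ℝ → ℝ := fun θ => θ ^ 2 * σ ^ 2 / 2 + ∫ x, (1 - Real.cos (θ * x)) ∂ν
  have hlimr : ∀ θ, 0 < θ → θ ≤ θ₀ →
      Tendsto (fun n : ℕ => (∫ x, Real.cos (θ * x) ∂μ n) ^ (n + 1)) atTop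
        (𝓝 (Real.exp (-g θ))) := by
    intro θ hp hq
    -- Norms reduce the complex limit to a real one: the power on the left is nonnegative for small
    -- `θ`, and on the right only the real part of the exponent remains.
    have hnorm := (hlimc θ).norm
    rw [Complex.norm_exp, hν.re_levyExponent σ hp.le (hq.trans h1')] at hnorm
    refine hnorm.congr fun n => ?_
    rw [Complex.norm_real, Real.norm_of_nonneg]
    refine pow_nonneg (integral_nonneg_of_ae ((hb n).mono fun x hx => ?_)) _
    have hx1 : |θ * x| ≤ 1 :=
      abs_mul_le_one hp ((mul_le_mul_of_nonneg_right hq hτ.le).trans h1) hx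
    exact Real.cos_nonneg_of_mem_Icc
      ⟨by linarith [Real.pi_gt_three, (abs_le.1 hx1).1], by
        linarith [Real.pi_gt_three, (abs_le.1 hx1).2]⟩
  obtain ⟨κ, hκ, D, hD⟩ := exists_tendsto_mul_integral_pow hτ hb h0 h1 hlimr
  obtain ⟨hsq, hle⟩ := hν.le_of_abs_sub_le σ h0 h1' hD
  refine ⟨hsq, κ, hle, fun m hm1 => (hκ m hm1).congr fun n => ?_⟩
  rw [hμ, integral_map (hm n).aemeasurable (Measurable.aestronglyMeasurable (by fun_prop))]

end Ensemble

/-! ### The method of moments -/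

section Moments

lemma integral_pow_two_mul_nonneg (ρ : Measure ℝ) (p : ℕ) : 0 ≤ realMoment (2 * p) ρ :=
  integral_nonneg fun x => Even.pow_nonneg (even_two_mul p) x

/-- Moments of factorial growth give exponential moments. -/
lemma integrable_cosh_of_moment_le {ρ : Measure ℝ} {A R t : ℝ}
    (hint : ∀ k : ℕ, Integrable (fun x : ℝ => x ^ k) ρ)
    (hgrow : ∀ p : ℕ, realMoment (2 * p) ρ ≤ A * R ^ (2 * p) * (2 * p).factorial)
    (ht : |t * R| < 1) : Integrable (fun x => Real.cosh (t * x)) ρ := by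
  refine ⟨by fun_prop, ?_⟩
  rw [hasFiniteIntegral_iff_ofReal (ae_of_all _ fun x => (Real.cosh_pos _).le)]
  have hterm : ∀ (p : ℕ) (x : ℝ), 0 ≤ (t * x) ^ (2 * p) / (2 * p).factorial := fun p x =>
    div_nonneg (Even.pow_nonneg (even_two_mul p) _) (Nat.cast_nonneg _)
  have h1 : ∀ x : ℝ, ENNReal.ofReal (Real.cosh (t * x)) =
      ∑' p : ℕ, ENNReal.ofReal ((t * x) ^ (2 * p) / (2 * p).factorial) := by
    intro x
    rw [← (Real.hasSum_cosh (t * x)).tsum_eq]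
    exact ENNReal.ofReal_tsum_of_nonneg (fun p => hterm p x) (Real.hasSum_cosh (t * x)).summable
  simp_rw [h1]
  rw [lintegral_tsum fun p => by fun_prop]
  -- The factorial growth cancels the factorial of the cosh series and leaves a geometric series.
  have h2 : ∀ p : ℕ, ∫⁻ x, ENNReal.ofReal ((t * x) ^ (2 * p) / (2 * p).factorial) ∂ρ ≤
      ENNReal.ofReal (A * ((t * R) ^ 2) ^ p) := by
    intro p
    have hi : Integrable (fun x : ℝ => (t * x) ^ (2 * p) / (2 * p).factorial) ρ := by
      simp_rw [mul_pow]
      exact ((hint (2 * p)).const_mul _).div_const _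
    rw [← ofReal_integral_eq_lintegral_ofReal hi (ae_of_all _ (hterm p))]
    apply ENNReal.ofReal_le_ofReal
    simp_rw [mul_pow]
    rw [integral_div, integral_const_mul, div_le_iff₀ (by exact_mod_cast Nat.factorial_pos _)]
    calc t ^ (2 * p) * ∫ x, x ^ (2 * p) ∂ρ
        ≤ t ^ (2 * p) * (A * R ^ (2 * p) * (2 * p).factorial) :=
          mul_le_mul_of_nonneg_left (hgrow p) (Even.pow_nonneg (even_two_mul p) _)
      _ = _ := by simp only [← pow_mul]; ring
  refine (ENNReal.tsum_le_tsum h2).trans_lt ?_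
  have hA : 0 ≤ A := by
    have := (integral_pow_two_mul_nonneg ρ 0).trans (hgrow 0)
    simpa using this
  have hs : Summable fun p : ℕ => A * ((t * R) ^ 2) ^ p :=
    (summable_geometric_of_lt_one (sq_nonneg _) (by
      rw [← sq_abs]
      exact pow_lt_one₀ (abs_nonneg _) ht two_ne_zero)).mul_left _
  rw [← ENNReal.ofReal_tsum_of_nonneg (fun p => by positivity) hs]
  exact ENNReal.ofReal_lt_top

lemma zero_mem_interior_integrableExpSet {ρ : Measure ℝ} {A R : ℝ} (hR : 0 < R)
    (hint : ∀ k : ℕ, Integrable (fun x : ℝ => x ^ k) ρ)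
    (hgrow : ∀ p : ℕ, realMoment (2 * p) ρ ≤ A * R ^ (2 * p) * (2 * p).factorial) :
    0 ∈ interior (integrableExpSet id ρ) := by
  rw [mem_interior]
  refine ⟨Set.Ioo (-(1 / R)) (1 / R), fun t ht => ?_, isOpen_Ioo, by
    constructor <;> simp [hR]⟩
  have ht' : |t * R| < 1 := by
    rw [abs_mul, abs_of_pos hR, ← lt_div_iff₀ hR]
    exact abs_lt.2 ht
  have hc := integrable_cosh_of_moment_le hint hgrow ht'
  change Integrable (fun x => Real.exp (t * id x)) ρ
  refine Integrable.mono' (hc.const_mul 2) (by fun_prop) (ae_of_all _ fun x => ?_)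
  rw [Real.norm_of_nonneg (Real.exp_pos _).le, Real.cosh_eq]
  have := (Real.exp_pos (-(t * x))).le
  simp only [id]
  linarith

/-- Probability measures with the same moments of factorial growth are equal. -/
lemma eq_of_realMoment_eq {ρ ρ' : Measure ℝ} [IsProbabilityMeasure ρ] [IsProbabilityMeasure ρ']
    {A R : ℝ} (hR : 0 < R) (hint : ∀ k : ℕ, Integrable (fun x : ℝ => x ^ k) ρ)
    (hint' : ∀ k : ℕ, Integrable (fun x : ℝ => x ^ k) ρ')
    (heq : ∀ k : ℕ, realMoment k ρ' = realMoment k ρ)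
    (hgrow : ∀ p : ℕ, realMoment (2 * p) ρ ≤ A * R ^ (2 * p) * (2 * p).factorial) : ρ' = ρ := by
  have h0 := zero_mem_interior_integrableExpSet hR hint hgrow
  have h0' := zero_mem_interior_integrableExpSet hR hint' (A := A) (fun p => by
    rw [heq]; exact hgrow p)
  set S := interior (integrableExpSet id ρ) ∩ interior (integrableExpSet id ρ')
  have hU : IsPreconnected {z : ℂ | z.re ∈ S} :=
    ((convex_integrableExpSet.interior.inter convex_integrableExpSet.interior).linear_preimage
      Complex.reLm).isPreconnected
  have hf : AnalyticOnNhd ℂ (complexMGF id ρ) {z : ℂ | z.re ∈ S} :=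
    analyticOnNhd_complexMGF.mono fun z hz => hz.1
  have hf' : AnalyticOnNhd ℂ (complexMGF id ρ') {z : ℂ | z.re ∈ S} :=
    analyticOnNhd_complexMGF.mono fun z hz => hz.2
  have h0S : (0 : ℂ) ∈ {z : ℂ | z.re ∈ S} := ⟨by simpa using h0, by simpa using h0'⟩
  -- The derivatives at `0` are the moments, so both power series agree; the identity theorem
  -- carries this over the strip, whose imaginary axis holds the characteristic functions.
  have hder : ∀ n : ℕ, iteratedDeriv n (complexMGF id ρ') 0 = iteratedDeriv n (complexMGF id ρ) 0 := by
    intro n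
    rw [iteratedDeriv_complexMGF (by simpa using h0'), iteratedDeriv_complexMGF (by simpa using h0)]
    have key : ∀ m : Measure ℝ, ∫ ω : ℝ, ((id ω : ℝ) : ℂ) ^ n * Complex.exp (0 * (id ω : ℝ)) ∂m =
        ((realMoment n m : ℝ) : ℂ) := by
      intro m
      rw [realMoment, ← integral_complex_ofReal]
      simp
    rw [key, key, heq]
  have hev : complexMGF id ρ' =ᶠ[𝓝 0] complexMGF id ρ := by
    have e1 := (hf 0 h0S).hasFPowerSeriesAt
    have e2 := (hf' 0 h0S).hasFPowerSeriesAt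
    simp_rw [hder] at e2
    filter_upwards [e1.eventually_hasSum_sub, e2.eventually_hasSum_sub] with z h1 h2
    exact h2.unique h1
  have hEq := hf'.eqOn_of_preconnected_of_eventuallyEq hf hU h0S hev
  apply Measure.ext_of_charFun
  funext t
  rw [← complexMGF_id_mul_I, ← complexMGF_id_mul_I]
  exact hEq (by
    simp only [Set.mem_ofPred_eq, Complex.mul_re, Complex.ofReal_re, Complex.I_re, mul_zero,
      Complex.ofReal_im, Complex.I_im, mul_one, sub_self]
    exact ⟨h0, h0'⟩)

/-- Moments of a limit along a filter. -/
lemma realMoment_of_tendsto {μ : ℕ → Measure ℝ} [∀ n, IsProbabilityMeasure (μ n)]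
    (hint : ∀ n k, Integrable (fun x : ℝ => x ^ k) (μ n)) {m : ℕ → ℝ}
    (hm : ∀ k, Tendsto (fun n => realMoment k (μ n)) atTop (𝓝 (m k))) {L : Filter ℕ} [NeBot L]
    (hL : L ≤ atTop) {ρ : Measure ℝ} [IsProbabilityMeasure ρ]
    (hρ : ∀ f : ℝ →ᵇ ℝ, Tendsto (fun n => ∫ x, f x ∂(μ n)) L (𝓝 (∫ x, f x ∂ρ))) (k : ℕ) :
    Integrable (fun x : ℝ => x ^ k) ρ ∧ realMoment k ρ = m k := by
  let F : ℕ → ℕ → ℝ →ᵇ ℝ := fun M k => BoundedContinuousFunction.ofNormedAddCommGroup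
    (fun x : ℝ => max (-(M : ℝ)) (min (M : ℝ) (x ^ k))) (by fun_prop) M fun x => by
      rw [Real.norm_eq_abs, abs_le]
      have : (0 : ℝ) ≤ M := Nat.cast_nonneg M
      exact ⟨le_max_left _ _, max_le (by linarith) (min_le_left _ _)⟩
  have hF : ∀ M k x, F M k x = max (-(M : ℝ)) (min (M : ℝ) (x ^ k)) := fun M k x => rfl
  -- even powers
  have heven : ∀ p, Integrable (fun x : ℝ => x ^ (2 * p)) ρ ∧ realMoment (2 * p) ρ ≤ m (2 * p) := by
    intro p
    have hFn : ∀ M x, F M (2 * p) x = min (M : ℝ) (x ^ (2 * p)) := by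
      intro M x
      rw [hF, max_eq_right]
      have : (0 : ℝ) ≤ M := Nat.cast_nonneg M
      exact le_min (by linarith) (by linarith [Even.pow_nonneg (even_two_mul p) x])
    have hFint : ∀ M, ∫ x, F M (2 * p) x ∂ρ ≤ m (2 * p) := by
      intro M
      refine le_of_tendsto_of_tendsto' (hρ (F M (2 * p))) ((hm (2 * p)).mono_left hL) fun n => ?_
      refine integral_mono ((F M (2 * p)).integrable _) (hint n _) fun x => ?_
      rw [hFn]
      exact min_le_right _ _
    have hpt : ∀ x : ℝ, Tendsto (fun M : ℕ => ENNReal.ofReal (F M (2 * p) x)) atTop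
        (𝓝 (ENNReal.ofReal (x ^ (2 * p)))) := by
      intro x
      apply tendsto_const_nhds.congr'
      obtain ⟨N, hN⟩ := exists_nat_ge (x ^ (2 * p))
      filter_upwards [eventually_ge_atTop N] with M hM
      rw [hFn, min_eq_right (hN.trans (by exact_mod_cast hM))]
    have hfatou : ∫⁻ x, ENNReal.ofReal (x ^ (2 * p)) ∂ρ ≤ ENNReal.ofReal (m (2 * p)) := by
      calc ∫⁻ x, ENNReal.ofReal (x ^ (2 * p)) ∂ρ
          = ∫⁻ x, liminf (fun M : ℕ => ENNReal.ofReal (F M (2 * p) x)) atTop ∂ρ :=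
            lintegral_congr fun x => ((hpt x).liminf_eq).symm
        _ ≤ liminf (fun M : ℕ => ∫⁻ x, ENNReal.ofReal (F M (2 * p) x) ∂ρ) atTop :=
            lintegral_liminf_le fun M => by
              exact ((F M (2 * p)).continuous.measurable).ennreal_ofReal
        _ ≤ ENNReal.ofReal (m (2 * p)) := by
            refine liminf_le_of_le (by isBoundedDefault) fun b hb => ?_
            obtain ⟨M, hM⟩ := hb.exists
            refine hM.trans ?_
            rw [← ofReal_integral_eq_lintegral_ofReal ((F M (2 * p)).integrable _)
              (ae_of_all _ fun x => by
                rw [hFn]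
                exact le_min (Nat.cast_nonneg M) (Even.pow_nonneg (even_two_mul p) x))]
            exact ENNReal.ofReal_le_ofReal (hFint M)
    have hnn : ∀ x : ℝ, 0 ≤ x ^ (2 * p) := fun x => Even.pow_nonneg (even_two_mul p) x
    have hi : Integrable (fun x : ℝ => x ^ (2 * p)) ρ := by
      refine ⟨by fun_prop, ?_⟩
      rw [hasFiniteIntegral_iff_ofReal (ae_of_all _ hnn)]
      exact hfatou.trans_lt ENNReal.ofReal_lt_top
    refine ⟨hi, ?_⟩
    rw [← ofReal_integral_eq_lintegral_ofReal hi (ae_of_all _ hnn)] at hfatou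
    refine (ENNReal.ofReal_le_ofReal_iff ?_).1 hfatou
    exact ge_of_tendsto' (hm (2 * p)) fun n => integral_pow_two_mul_nonneg _ p
  have hint' : Integrable (fun x : ℝ => x ^ k) ρ := by
    refine Integrable.mono' ((heven k).1.add (integrable_const 1)) (by fun_prop)
      (ae_of_all _ fun x => ?_)
    simp only [Pi.add_apply]
    rw [Real.norm_eq_abs, pow_mul', ← sq_abs]
    nlinarith [sq_nonneg (|x ^ k| - 1)]
  refine ⟨hint', ?_⟩
  -- The truncation acts only where `|x^k| ≥ M`; there the error is at most `|x^k| ≤ |x^k|²/M`.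
  have hdiff : ∀ M : ℕ, 0 < M → ∀ x : ℝ, |x ^ k - F M k x| ≤ x ^ (2 * k) / M := by
    intro M hM x
    have hM' : (0 : ℝ) < M := by exact_mod_cast hM
    rw [hF, le_div_iff₀ hM', pow_mul', ← sq_abs]
    rcases le_total |x ^ k| (M : ℝ) with h | h
    · obtain ⟨h1, h2⟩ := abs_le.1 h
      rw [min_eq_right h2, max_eq_right h1, sub_self, abs_zero, zero_mul]
      positivity
    · have : |x ^ k - max (-(M : ℝ)) (min (M : ℝ) (x ^ k))| ≤ |x ^ k| := by
        rcases le_total 0 (x ^ k) with h3 | h3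
        · rw [abs_of_nonneg h3] at h ⊢
          rw [min_eq_left h, max_eq_right (by linarith), abs_of_nonneg (by linarith)]
          linarith
        · rw [abs_of_nonpos h3] at h ⊢
          rw [min_eq_right (by linarith), max_eq_left (by linarith), abs_of_nonpos (by linarith)]
          linarith
      nlinarith [abs_nonneg (x ^ k)]
  have happ : ∀ (θ : Measure ℝ) [IsProbabilityMeasure θ], Integrable (fun x : ℝ => x ^ k) θ →
      Integrable (fun x : ℝ => x ^ (2 * k)) θ → ∀ M : ℕ, 0 < M →
      |realMoment k θ - ∫ x, F M k x ∂θ| ≤ realMoment (2 * k) θ / M := by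
    intro θ _ h1 h2 M hM
    rw [realMoment, ← integral_sub h1 ((F M k).integrable _), ← Real.norm_eq_abs, realMoment,
      ← integral_div]
    exact norm_integral_le_of_norm_le (h2.div_const _) (ae_of_all _ fun x => hdiff M hM x)
  have hfinal : ∀ M : ℕ, 0 < M → |realMoment k ρ - m k| ≤ 2 * m (2 * k) / M := by
    intro M hM
    have hM' : (0 : ℝ) < M := by exact_mod_cast hM
    have e1 : |m k - ∫ x, F M k x ∂ρ| ≤ m (2 * k) / M :=
      le_of_tendsto_of_tendsto' (((hm k).mono_left hL).sub (hρ (F M k))).abs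
        (((hm (2 * k)).mono_left hL).div_const _) fun n => happ _ (hint n _) (hint n _) M hM
    have e2 := happ ρ hint' (heven k).1 M hM
    have e3 : realMoment (2 * k) ρ / M ≤ m (2 * k) / M :=
      div_le_div_of_nonneg_right (heven k).2 hM'.le
    have e4 : 2 * m (2 * k) / M = m (2 * k) / M + m (2 * k) / M := by ring
    rw [e4]
    rw [abs_le] at e1 e2 ⊢
    constructor <;> linarith
  have hlim : Tendsto (fun M : ℕ => 2 * m (2 * k) / (M : ℝ)) atTop (𝓝 0) :=
    tendsto_const_div_atTop_nhds_zero_nat _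
  have := ge_of_tendsto hlim ((eventually_gt_atTop 0).mono hfinal)
  have h0 := le_antisymm this (abs_nonneg _)
  exact sub_eq_zero.1 (abs_eq_zero.1 h0)

/-- The method of moments: convergence of the moments to a sequence of factorial growth implies
weak convergence to a measure determined by these moments. -/
theorem exists_weaklyConverges_of_tendsto_realMoment {μ : ℕ → Measure ℝ}
    [hμ : ∀ n, IsProbabilityMeasure (μ n)]
    (hint : ∀ n k, Integrable (fun x : ℝ => x ^ k) (μ n)) {m : ℕ → ℝ}
    (hm : ∀ k, Tendsto (fun n => realMoment k (μ n)) atTop (𝓝 (m k))) {A R : ℝ} (hR : 0 < R)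
    (hgrow : ∀ p : ℕ, m (2 * p) ≤ A * R ^ (2 * p) * (2 * p).factorial) :
    ∃ ρ : Measure ℝ, IsProbabilityMeasure ρ ∧ WeaklyConverges μ ρ ∧
      (∀ k, realMoment k ρ = m k) ∧ IsDeterminedByMoments ρ := by
  obtain ⟨B, hB⟩ := (hm 2).bddAbove_range
  have hB' : ∀ n, realMoment 2 (μ n) ≤ B := fun n => hB ⟨n, rfl⟩
  have hB0 : 0 ≤ B := (integral_pow_two_mul_nonneg (μ 0) 1).trans (hB' 0)
  let μ' : ℕ → ProbabilityMeasure ℝ := fun n => ⟨μ n, hμ n⟩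
  -- Chebyshev's inequality with the bound `B` on the second moments gives tightness, and thus a
  -- compact set of laws containing the sequence.
  let u : ℕ → NNReal := fun j => ⟨B / ((j : ℝ) + 1), by positivity⟩
  have hu : Tendsto u atTop (𝓝 0) := by
    rw [← NNReal.tendsto_coe]
    have := (tendsto_one_div_add_atTop_nhds_zero_nat (𝕜 := ℝ)).const_mul B
    rw [mul_zero] at this
    exact this.congr fun j => by rw [mul_one_div]; rfl
  have hcpt := isCompact_setOfPred_probabilityMeasure_mass_eq_compl_isCompact_le (E := ℝ)
    (K := fun j : ℕ => Set.Icc (-((j : ℝ) + 1)) ((j : ℝ) + 1)) hu (fun j => isCompact_Icc)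
    (Or.inl inferInstance)
  have hmem : ∀ n, μ' n ∈ {θ : ProbabilityMeasure ℝ |
      ∀ j : ℕ, θ (Set.Icc (-((j : ℝ) + 1)) ((j : ℝ) + 1))ᶜ ≤ u j} := by
    intro n j
    rw [← NNReal.coe_le_coe]
    change (μ n).real _ ≤ B / ((j : ℝ) + 1)
    have hj : (0 : ℝ) < (j : ℝ) + 1 := by positivity
    rw [le_div_iff₀ hj, mul_comm]
    have hsub : (Set.Icc (-((j : ℝ) + 1)) ((j : ℝ) + 1))ᶜ ⊆ {x : ℝ | (j : ℝ) + 1 ≤ x ^ 2} := by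
      intro x hx
      have hx' : (j : ℝ) + 1 < |x| := by
        by_contra hcon
        exact hx (abs_le.1 (not_lt.1 hcon))
      change (j : ℝ) + 1 ≤ x ^ 2
      rw [← sq_abs]
      nlinarith [(Nat.cast_nonneg j : (0 : ℝ) ≤ j)]
    calc ((j : ℝ) + 1) * (μ n).real _ ≤ ((j : ℝ) + 1) * (μ n).real {x : ℝ | (j : ℝ) + 1 ≤ x ^ 2} :=
          mul_le_mul_of_nonneg_left (measureReal_mono hsub) hj.le
      _ ≤ realMoment 2 (μ n) :=
          mul_meas_ge_le_integral_of_nonneg (ae_of_all _ fun x => sq_nonneg x) (hint n 2) _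
      _ ≤ B := hB' n
  have hcluster : ∀ θ : ProbabilityMeasure ℝ, MapClusterPt θ atTop μ' →
      ∀ k, Integrable (fun x : ℝ => x ^ k) (θ : Measure ℝ) ∧ realMoment k (θ : Measure ℝ) = m k := by
    intro θ hθ
    obtain ⟨U, hU, hUθ⟩ := mapClusterPt_iff_ultrafilter.1 hθ
    exact realMoment_of_tendsto hint hm hU
      (ProbabilityMeasure.tendsto_iff_forall_integral_tendsto.1 hUθ)
  obtain ⟨ρ, -, hρ⟩ := hcpt.exists_mapClusterPt (f := atTop) (u := μ')
    (tendsto_principal.2 (Eventually.of_forall hmem))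
  have hρm := hcluster ρ hρ
  have hgρ : ∀ p : ℕ, realMoment (2 * p) (ρ : Measure ℝ) ≤ A * R ^ (2 * p) * (2 * p).factorial := by
    intro p
    rw [(hρm _).2]
    exact hgrow p
  have hlim : Tendsto μ' atTop (𝓝 ρ) := by
    refine hcpt.tendsto_nhds_of_unique_mapClusterPt (Eventually.of_forall hmem) fun θ _ hθ => ?_
    have hθm := hcluster θ hθ
    have : (θ : Measure ℝ) = (ρ : Measure ℝ) :=
      eq_of_realMoment_eq hR (fun k => (hρm k).1) (fun k => (hθm k).1)
        (fun k => by rw [(hρm k).2, (hθm k).2]) hgρ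
    exact Subtype.ext this
  refine ⟨ρ, inferInstance, ProbabilityMeasure.tendsto_iff_forall_integral_tendsto.1 hlim,
    fun k => (hρm k).2, fun k => (hρm k).1, fun θ hθ hi he => ?_⟩
  exact eq_of_realMoment_eq hR (fun k => (hρm k).1) hi he hgρ

end Moments

/-! ### Traces of powers as sums over closed walks -/

/-- A partition is recovered from its choice of representatives. This encodes partitions as
self-maps, whence finiteness and the bound `N^N`. -/
lemma Setoid.out_injective {α : Type*} :
    Function.Injective fun (π : Setoid α) (a : α) => (Quotient.mk π a).out := by
  intro π π' h
  ext a b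
  have key : ∀ ρ : Setoid α, ρ a b ↔ (Quotient.mk ρ a).out = (Quotient.mk ρ b).out := by
    intro ρ
    rw [Quotient.out_inj, Quotient.eq]
  rw [key, key]
  have := congrFun h
  simp only at this
  rw [this a, this b]

instance {α : Type*} [Finite α] : Finite (Setoid α) := Finite.of_injective _ Setoid.out_injective

noncomputable instance {α : Type*} [Finite α] : Fintype (Setoid α) := Fintype.ofFinite _

lemma card_setoid_fin_le (N : ℕ) : Fintype.card (Setoid (Fin N)) ≤ N ^ N := by
  have := Fintype.card_le_of_injective _ (Setoid.out_injective (α := Fin N))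
  simpa using this

section Trace

variable {n : ℕ}

open Classical in
/-- Entries of powers of a matrix as sums over walks. -/
lemma pow_apply_eq_sum_walks (A : Matrix (Fin n) (Fin n) ℂ) (k : ℕ) (a b : Fin n) :
    (A ^ k) a b = ∑ w : Fin (k + 1) → Fin n, if w 0 = a ∧ w (Fin.last k) = b then
      ∏ i : Fin k, A (w i.castSucc) (w i.succ) else 0 := by
  induction k generalizing a with
  | zero =>
    rw [← (Equiv.funUnique (Fin 1) (Fin n)).symm.sum_comp]
    simp only [pow_zero, Matrix.one_apply]
    simp only [Equiv.funUnique_symm_apply, Finset.univ_eq_empty, Finset.prod_empty]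
    by_cases hab : a = b
    · subst hab
      simp [Finset.sum_ite_eq']
    · rw [if_neg hab]
      refine (Finset.sum_eq_zero fun x _ => if_neg ?_).symm
      rintro ⟨rfl, rfl⟩
      exact hab rfl
  | succ k ih =>
    rw [pow_succ', Matrix.mul_apply]
    have hlast : ∀ (x : Fin n) (w : Fin (k + 1) → Fin n),
        (Fin.cons x w : Fin (k + 1 + 1) → Fin n) (Fin.last (k + 1)) = w (Fin.last k) := by
      intro x w
      rw [← Fin.succ_last, Fin.cons_succ]
    have hw : ∀ (x : Fin n) (w : Fin (k + 1) → Fin n),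
        (∏ i : Fin (k + 1), A ((Fin.cons x w : Fin (k + 1 + 1) → Fin n) i.castSucc)
          ((Fin.cons x w : Fin (k + 1 + 1) → Fin n) i.succ)) =
          A x (w 0) * ∏ i : Fin k, A (w i.castSucc) (w i.succ) := by
      intro x w
      rw [Fin.prod_univ_succ]
      simp only [Fin.castSucc_zero, Fin.cons_zero, Fin.cons_succ, ← Fin.succ_castSucc]
    have hcons : ∀ F : (Fin (k + 1 + 1) → Fin n) → ℂ,
        ∑ w, F w = ∑ x : Fin n, ∑ w : Fin (k + 1) → Fin n, F (Fin.cons x w) := by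
      intro F
      rw [← (Fin.consEquiv fun _ : Fin (k + 1 + 1) => Fin n).sum_comp, Fintype.sum_prod_type]
      rfl
    rw [hcons]
    simp only [hlast, hw, Fin.cons_zero]
    have houter := Finset.sum_eq_single (s := Finset.univ) (f := fun x : Fin n =>
      ∑ w : Fin (k + 1) → Fin n, if x = a ∧ w (Fin.last k) = b then
        A x (w 0) * ∏ i : Fin k, A (w i.castSucc) (w i.succ) else 0) a
      (fun x _ hx => Finset.sum_eq_zero fun w _ => if_neg fun h => hx h.1) (by simp)
    refine Eq.trans ?_ houter.symm
    · simp only [true_and]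
      simp_rw [ih, Finset.mul_sum]
      rw [Finset.sum_comm]
      refine Finset.sum_congr rfl fun w _ => ?_
      rw [Finset.sum_eq_single (w 0)]
      · simp only [true_and]
        split_ifs <;> simp
      · intro c _ hc
        rw [if_neg (fun h => hc h.1.symm), mul_zero]
      · simp

/-- Functions on a type correspond to pairs of a setoid and an embedding of its quotient. -/
noncomputable def setoidEmbeddingEquiv (α β : Type*) :
    (Σ π : Setoid α, Quotient π ↪ β) ≃ (α → β) :=
  Equiv.ofBijective (fun x a => x.2 (Quotient.mk x.1 a)) (by
    constructor
    · rintro ⟨π, e⟩ ⟨π', e'⟩ h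
      have key : ∀ (ρ : Setoid α) (f : Quotient ρ ↪ β) (a b : α),
          ρ a b ↔ f (Quotient.mk ρ a) = f (Quotient.mk ρ b) := by
        intro ρ f a b
        rw [f.injective.eq_iff, Quotient.eq]
      have h' := congrFun h
      simp only at h'
      have hπ : π = π' := by
        ext a b
        rw [key π e, key π' e', h', h']
      subst hπ
      congr 1
      ext x
      induction x using Quotient.inductionOn with
      | _ a => exact h' a
    · intro f
      exact ⟨⟨Setoid.ker f, ⟨Setoid.kerLift f, Setoid.kerLift_injective f⟩⟩, rfl⟩)

open Classical in
/-- The trace of a power as a sum over closed walks, grouped by their coincidences. -/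
lemma trace_pow_eq_sum_setoid (A : Matrix (Fin n) (Fin n) ℂ) (k : ℕ) :
    (A ^ k).trace = ∑ π : Setoid (Fin (k + 1)) with setoidWalk π k = setoidWalk π 0,
      ∑ e : Quotient π ↪ Fin n,
        ∏ i ∈ Finset.range k, A (e (setoidWalk π i)) (e (setoidWalk π (i + 1))) := by
  have h1 : (A ^ k).trace = ∑ w : Fin (k + 1) → Fin n, if w (Fin.last k) = w 0 then
      ∏ i : Fin k, A (w i.castSucc) (w i.succ) else 0 := by
    simp_rw [Matrix.trace, Matrix.diag, pow_apply_eq_sum_walks]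
    rw [Finset.sum_comm]
    refine Finset.sum_congr rfl fun w _ => ?_
    rw [Finset.sum_eq_single (w 0)]
    · simp
    · intro c _ hc
      rw [if_neg (fun h => hc h.1.symm)]
    · simp
  rw [h1, ← (setoidEmbeddingEquiv (Fin (k + 1)) (Fin n)).sum_comp, Fintype.sum_sigma,
    Finset.sum_filter]
  refine Finset.sum_congr rfl fun π _ => ?_
  have hlast : setoidWalk π k = Quotient.mk π (Fin.last k) := by
    rw [← setoidWalk_val]; rfl
  have hzero : setoidWalk π 0 = Quotient.mk π 0 := by
    rw [← setoidWalk_val]; rfl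
  have hcond : ∀ e : Quotient π ↪ Fin n,
      setoidEmbeddingEquiv _ _ ⟨π, e⟩ (Fin.last k) = setoidEmbeddingEquiv _ _ ⟨π, e⟩ 0 ↔
        setoidWalk π k = setoidWalk π 0 := by
    intro e
    rw [hlast, hzero]
    exact e.injective.eq_iff
  simp only [hcond]
  split_ifs with hc
  · refine Finset.sum_congr rfl fun e _ => ?_
    rw [Finset.prod_range]
    refine Finset.prod_congr rfl fun i _ => ?_
    have e1 : setoidWalk π i = Quotient.mk π i.castSucc := by
      rw [← setoidWalk_val]; rfl
    have e2 : setoidWalk π (i + 1) = Quotient.mk π i.succ := by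
      rw [← setoidWalk_val]; rfl
    rw [e1, e2]
    rfl
  · simp

lemma Matrix.IsHermitian.trace_pow_eq {A : Matrix (Fin n) (Fin n) ℂ} [DecidableEq (Fin n)]
    (h : A.IsHermitian) (k : ℕ) :
    (A ^ k).trace = ((∑ j, h.eigenvalues j ^ k : ℝ) : ℂ) := by
  conv_lhs => rw [h.spectral_theorem]
  rw [← map_pow, Unitary.conjStarAlgAut_apply, Matrix.trace_mul_cycle, Unitary.coe_star_mul_self,
    one_mul, Matrix.diagonal_pow, Matrix.trace_diagonal]
  push_cast
  rfl

end Trace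

/-! ### Empirical spectral distributions -/

section ESD

variable {n : ℕ}

lemma esd_isProbabilityMeasure [NeZero n] {A : Matrix (Fin n) (Fin n) ℂ} (h : A.IsHermitian) :
    IsProbabilityMeasure (esd A) := by
  refine ⟨?_⟩
  rw [esd, dif_pos h, Measure.smul_apply, Measure.finsetSum_apply _ _ _]
  simp only [measure_univ, Finset.sum_const, Finset.card_univ, Fintype.card_fin, nsmul_eq_mul,
    mul_one, smul_eq_mul]
  exact ENNReal.inv_mul_cancel (by exact_mod_cast NeZero.ne n) (ENNReal.natCast_ne_top n)

open Classical in
lemma integral_esd {A : Matrix (Fin n) (Fin n) ℂ} (h : A.IsHermitian) (f : ℝ → ℝ) :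
    ∫ x, f x ∂(esd A) = (n : ℝ)⁻¹ * ∑ j, f (h.eigenvalues j) := by
  rw [esd, dif_pos h, integral_smul_measure, integral_finsetSum_measure fun j _ =>
    integrable_dirac (by simp)]
  simp only [integral_dirac, ENNReal.toReal_inv, ENNReal.toReal_natCast, smul_eq_mul]

lemma integrable_esd {A : Matrix (Fin n) (Fin n) ℂ} [NeZero n] (f : ℝ → ℝ) :
    Integrable f (esd A) := by
  classical
  rw [esd]
  split_ifs with h
  · refine Integrable.smul_measure (integrable_finsetSum_measure.2 fun j _ =>
      integrable_dirac (by simp)) ?_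
    exact ENNReal.inv_ne_top.2 (by exact_mod_cast NeZero.ne n)
  · exact integrable_zero_measure

lemma realMoment_esd {A : Matrix (Fin n) (Fin n) ℂ} (h : A.IsHermitian) (k : ℕ) :
    realMoment k (esd A) = (n : ℝ)⁻¹ * ((A ^ k).trace).re := by
  classical
  rw [realMoment, integral_esd h, h.trace_pow_eq, Complex.ofReal_re]

variable {Ω : Type*} [MeasurableSpace Ω] {A : Ω → Matrix (Fin n) (Fin n) ℂ}

lemma measurable_pow_apply (hA : ∀ j k, Measurable fun ω => A ω j k) (k : ℕ) (a b : Fin n) :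
    Measurable fun ω => (A ω ^ k) a b := by
  induction k generalizing a with
  | zero => simp only [pow_zero]; exact measurable_const
  | succ k ih =>
    simp_rw [pow_succ', Matrix.mul_apply]
    exact Finset.measurable_sum _ fun c _ => (hA a c).mul (ih c)

lemma measurable_trace_pow (hA : ∀ j k, Measurable fun ω => A ω j k) (k : ℕ) :
    Measurable fun ω => (A ω ^ k).trace := by
  simp_rw [Matrix.trace, Matrix.diag]
  exact Finset.measurable_sum _ fun a _ => measurable_pow_apply hA k a a

-- Symmetric functions avoid measurability of single eigenvalues: for a polynomial the sum is a
-- combination of traces of powers, and a continuous `f` is a pointwise limit of polynomials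
-- approximating it on `[-m, m]`.
open Classical in
lemma measurable_sum_eigenvalues_of_continuous (hA : ∀ j k, Measurable fun ω => A ω j k)
    (hh : ∀ ω, (A ω).IsHermitian) {f : ℝ → ℝ} (hf : Continuous f) :
    Measurable fun ω => ∑ j, f ((hh ω).eigenvalues j) := by
  have hpoly : ∀ p : Polynomial ℝ, Measurable fun ω => ∑ j, p.eval ((hh ω).eigenvalues j) := by
    intro p
    have : (fun ω => ∑ j, p.eval ((hh ω).eigenvalues j)) = fun ω =>
        ∑ i ∈ Finset.range (p.natDegree + 1), p.coeff i * ((A ω ^ i).trace).re := by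
      funext ω
      simp_rw [Polynomial.eval_eq_sum_range, (hh ω).trace_pow_eq, Complex.ofReal_re,
        Finset.mul_sum]
      rw [Finset.sum_comm]
    rw [this]
    exact Finset.measurable_sum _ fun i _ =>
      (Complex.measurable_re.comp (measurable_trace_pow hA i)).const_mul _
  have happ : ∀ m : ℕ, ∃ p : Polynomial ℝ, ∀ x ∈ Set.Icc (-(m : ℝ)) m,
      |p.eval x - f x| < 1 / ((m : ℝ) + 1) := fun m =>
    exists_polynomial_near_of_continuousOn _ _ f hf.continuousOn _ (by positivity)
  choose p hp using happ
  refine measurable_of_tendsto_metrizable (fun m => hpoly (p m)) ?_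
  rw [tendsto_pi_nhds]
  intro ω
  refine tendsto_finsetSum _ fun j _ => ?_
  rw [tendsto_iff_norm_sub_tendsto_zero]
  refine squeeze_zero' (Eventually.of_forall fun _ => norm_nonneg _) ?_
    (tendsto_one_div_add_atTop_nhds_zero_nat (𝕜 := ℝ))
  obtain ⟨N, hN⟩ := exists_nat_ge |(hh ω).eigenvalues j|
  filter_upwards [eventually_ge_atTop N] with m hm
  exact (hp m _ (abs_le.1 (hN.trans (by exact_mod_cast hm)))).le

/-- Half-lines form a generating π-system, and their indicators are limits of continuous ramps of
slope `-m`. -/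
lemma measurable_esd [NeZero n] (hA : ∀ j k, Measurable fun ω => A ω j k)
    (hh : ∀ ω, (A ω).IsHermitian) : Measurable fun ω => esd (A ω) := by
  classical
  have : ∀ ω, IsProbabilityMeasure (esd (A ω)) := fun ω => esd_isProbabilityMeasure (hh ω)
  refine Measurable.measure_of_isPiSystem_of_isProbabilityMeasure (borel_eq_generateFrom_Iic ℝ ▸
    BorelSpace.measurable_eq) isPiSystem_Iic ?_
  rintro _ ⟨a, rfl⟩
  have h1 : ∀ ω, esd (A ω) (Set.Iic a) =
      ENNReal.ofReal ((n : ℝ)⁻¹ * ∑ j, (Set.Iic a).indicator (fun _ => (1 : ℝ))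
        ((hh ω).eigenvalues j)) := by
    intro ω
    rw [← integral_esd (hh ω), integral_indicator_const _ measurableSet_Iic]
    simp
  simp_rw [h1]
  refine Measurable.ennreal_ofReal (Measurable.const_mul ?_ _)
  refine measurable_of_tendsto_metrizable (f := fun (m : ℕ) ω => ∑ j,
    (max 0 (min 1 (1 - (m : ℝ) * ((hh ω).eigenvalues j - a)))))
    (fun m => measurable_sum_eigenvalues_of_continuous hA hh
      (f := fun x => max 0 (min 1 (1 - (m : ℝ) * (x - a)))) (by fun_prop)) ?_
  rw [tendsto_pi_nhds]
  intro ω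
  refine tendsto_finsetSum _ fun j _ => ?_
  set x := (hh ω).eigenvalues j
  by_cases hx : x ≤ a
  · rw [Set.indicator_of_mem (show x ∈ Set.Iic a from hx)]
    refine tendsto_const_nhds.congr fun m => ?_
    have : (m : ℝ) * (x - a) ≤ 0 :=
      mul_nonpos_of_nonneg_of_nonpos (Nat.cast_nonneg m) (by linarith)
    rw [min_eq_left (by linarith), max_eq_right zero_le_one]
  · rw [Set.indicator_of_notMem (show x ∉ Set.Iic a from hx)]
    have hpos : 0 < x - a := by linarith [not_le.1 hx]
    obtain ⟨N, hN⟩ := exists_nat_ge (1 / (x - a))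
    refine tendsto_const_nhds.congr' ?_
    filter_upwards [eventually_ge_atTop N] with m hm
    have h2 : 1 / (x - a) ≤ m := hN.trans (by exact_mod_cast hm)
    rw [div_le_iff₀ hpos] at h2
    rw [max_eq_left]
    exact (min_le_right _ _).trans (by linarith)

variable {P : Measure Ω} [IsProbabilityMeasure P]

lemma expectedESD_isProbabilityMeasure [NeZero n] (hA : ∀ j k, Measurable fun ω => A ω j k)
    (hh : ∀ ω, (A ω).IsHermitian) : IsProbabilityMeasure (expectedESD P A) := by
  have : ∀ ω, IsProbabilityMeasure (esd (A ω)) := fun ω => esd_isProbabilityMeasure (hh ω)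
  exact isProbabilityMeasure_bind (measurable_esd hA hh).aemeasurable (ae_of_all _ this)

open Classical in
lemma norm_trace_pow_le {τ : ℝ} {B : Matrix (Fin n) (Fin n) ℂ} (hB : ∀ j k, ‖B j k‖ ≤ τ) (k : ℕ) :
    ‖(B ^ k).trace‖ ≤ ∑ π : Setoid (Fin (k + 1)) with setoidWalk π k = setoidWalk π 0,
      ∑ _e : Quotient π ↪ Fin n, τ ^ k := by
  rw [trace_pow_eq_sum_setoid]
  refine (norm_sum_le _ _).trans ?_
  refine (Finset.sum_le_sum fun π _ => norm_sum_le _ _).trans ?_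
  refine Finset.sum_le_sum fun π _ => Finset.sum_le_sum fun e _ => ?_
  rw [norm_prod]
  refine (Finset.prod_le_prod (fun _ _ => norm_nonneg _) fun i _ => hB _ _).trans ?_
  simp

/-- Moments of the expected empirical spectral distribution of a random matrix with bounded
entries. -/
lemma realMoment_expectedESD [NeZero n] (hA : ∀ j k, Measurable fun ω => A ω j k)
    (hh : ∀ ω, (A ω).IsHermitian) {τ : ℝ} (hb : ∀ j k, ∀ᵐ ω ∂P, ‖A ω j k‖ ≤ τ) (k : ℕ) :
    Integrable (fun x : ℝ => x ^ k) (expectedESD P A) ∧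
      realMoment k (expectedESD P A) = (n : ℝ)⁻¹ * ∫ ω, ((A ω ^ k).trace).re ∂P := by
  have hae : ∀ᵐ ω ∂P, ∀ j k, ‖A ω j k‖ ≤ τ := by
    rw [ae_all_iff]; intro j; rw [ae_all_iff]; exact hb j
  let κ : Kernel Ω ℝ := ⟨fun ω => esd (A ω), measurable_esd hA hh⟩
  have hbind : expectedESD P A = P.bind κ := rfl
  have htr : ∀ k, Integrable (fun ω => ((A ω ^ k).trace).re) P := fun k =>
    Integrable.of_bound (Complex.measurable_re.comp (measurable_trace_pow hA k)).aestronglyMeasurable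
      _ (hae.mono fun ω hω => (Complex.abs_re_le_norm _).trans (norm_trace_pow_le hω k))
  -- For even powers the absolute moment is itself a trace, hence bounded; other powers follow from
  -- `|x^k| ≤ x^(2k) + 1`.
  have heven : ∀ p, Integrable (fun x : ℝ => x ^ (2 * p)) (expectedESD P A) := by
    intro p
    rw [hbind, Measure.integrable_comp_iff (Measurable.aestronglyMeasurable (by fun_prop))]
    refine ⟨ae_of_all _ fun ω => integrable_esd _, ?_⟩
    refine ((htr (2 * p)).const_mul (n : ℝ)⁻¹).congr (ae_of_all _ fun ω => ?_)
    simp only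
    rw [← realMoment_esd (hh ω), realMoment]
    refine integral_congr_ae (ae_of_all _ fun x => ?_)
    simp only
    rw [Real.norm_of_nonneg (Even.pow_nonneg (even_two_mul p) x)]
  have : IsProbabilityMeasure (expectedESD P A) := expectedESD_isProbabilityMeasure hA hh
  have hint : Integrable (fun x : ℝ => x ^ k) (expectedESD P A) := by
    refine Integrable.mono' ((heven k).add (integrable_const 1)) (by fun_prop)
      (ae_of_all _ fun x => ?_)
    simp only [Pi.add_apply]
    rw [Real.norm_eq_abs, pow_mul', ← sq_abs]
    nlinarith [sq_nonneg (|x ^ k| - 1)]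
  refine ⟨hint, ?_⟩
  have hk : expectedESD P A = (κ ∘ₖ Kernel.const Unit P) () := by
    rw [hbind, Kernel.comp_apply, Kernel.const_apply]
  rw [realMoment, hk, Kernel.integral_comp (hk ▸ hint), Kernel.const_apply, ← integral_const_mul]
  refine integral_congr_ae (ae_of_all _ fun ω => ?_)
  exact realMoment_esd (hh ω) k

end ESD

/-! ### Expectations of products along closed walks -/

lemma tendsto_descFactorial_div_pow (q : ℕ) :
    Tendsto (fun n : ℕ => ((n + 2).descFactorial q : ℝ) / ((n : ℝ) + 2) ^ q) atTop (𝓝 1) := by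
  induction q with
  | zero => simp
  | succ q ih =>
    have h1 : Tendsto (fun n : ℕ => 1 - (q : ℝ) / ((n : ℝ) + 2)) atTop (𝓝 1) := by
      have : Tendsto (fun n : ℕ => (n : ℝ) + 2) atTop atTop :=
        tendsto_atTop_add_const_right _ _ tendsto_natCast_atTop_atTop
      simpa using (this.const_div_atTop (q : ℝ)).const_sub 1
    have h2 := h1.mul ih
    rw [one_mul] at h2
    refine h2.congr' ?_
    filter_upwards [eventually_ge_atTop q] with n hn
    rw [Nat.descFactorial_succ, Nat.cast_mul, Nat.cast_sub (by omega)]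
    have : (n : ℝ) + 2 ≠ 0 := by positivity
    push_cast
    field_simp
    ring

/-- The pair `a, b` in increasing order (with a junk value if `a = b`). -/
def sortedPair {n : ℕ} (a b : Fin (n + 2)) : {e : Fin (n + 2) × Fin (n + 2) // e.1 < e.2} :=
  if h : a < b then ⟨(a, b), h⟩ else if h : b < a then ⟨(b, a), h⟩ else ⟨(0, 1), Fin.zero_lt_one⟩

lemma sortedPair_of_lt {n : ℕ} {a b : Fin (n + 2)} (h : a < b) : sortedPair a b = ⟨(a, b), h⟩ :=
  dif_pos h

lemma sortedPair_of_gt {n : ℕ} {a b : Fin (n + 2)} (h : b < a) : sortedPair a b = ⟨(b, a), h⟩ := by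
  rw [sortedPair, dif_neg h.not_gt, dif_pos h]

lemma sym2_sortedPair {n : ℕ} {a b : Fin (n + 2)} (h : a ≠ b) :
    s((sortedPair a b).1.1, (sortedPair a b).1.2) = s(a, b) := by
  rcases lt_or_gt_of_ne h with h | h
  · rw [sortedPair_of_lt h]
  · rw [sortedPair_of_gt h, Sym2.eq_swap]

lemma sym2_injective_of_lt {n : ℕ} : Function.Injective
    fun c : {e : Fin n × Fin n // e.1 < e.2} => s(c.1.1, c.1.2) := by
  rintro ⟨⟨a, b⟩, h⟩ ⟨⟨a', b'⟩, h'⟩ heq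
  simp only at h h'
  rcases Sym2.eq_iff.1 heq with ⟨h1, h2⟩ | ⟨h1, h2⟩
  · simp only at h1 h2
    subst h1 h2
    rfl
  · simp only at h1 h2
    subst h1 h2
    exact absurd h h'.not_gt

section Product

variable {n : ℕ} {Ω : Type*} [MeasurableSpace Ω] {P : Measure Ω}
  {A : Ω → Matrix (Fin (n + 2)) (Fin (n + 2)) ℂ}

lemma apply_eq_sortedPair {B : Matrix (Fin (n + 2)) (Fin (n + 2)) ℂ} (hB : B.IsHermitian)
    {a b : Fin (n + 2)} (h : a ≠ b) :
    B a b = if a < b then B (sortedPair a b).1.1 (sortedPair a b).1.2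
      else star (B (sortedPair a b).1.1 (sortedPair a b).1.2) := by
  rcases lt_or_gt_of_ne h with h | h
  · rw [if_pos h, sortedPair_of_lt h]
  · rw [if_neg h.not_gt, sortedPair_of_gt h]
    exact (hB.apply a b).symm

lemma norm_apply_eq_sortedPair {B : Matrix (Fin (n + 2)) (Fin (n + 2)) ℂ} (hB : B.IsHermitian)
    {a b : Fin (n + 2)} (h : a ≠ b) :
    ‖B a b‖ = ‖B (sortedPair a b).1.1 (sortedPair a b).1.2‖ := by
  rw [apply_eq_sortedPair hB h]
  split_ifs
  · rfl
  · rw [norm_star]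

/-- The expectation of the product of the entries along a closed walk without loops factorizes
over the edges. -/
lemma norm_integral_prod_le [IsProbabilityMeasure P] (hA : ∀ j k, Measurable fun ω => A ω j k)
    (hh : ∀ ω, (A ω).IsHermitian)
    (hind : iIndepFun (fun (e : {e : Fin (n + 2) × Fin (n + 2) // e.1 < e.2}) ω =>
      A ω e.1.1 e.1.2) P) {δ : ℝ} {k : ℕ}
    (hδ1 : ∀ j l, j ≠ l → ‖∫ ω, A ω j l ∂P‖ ≤ δ)
    (hδ2 : ∀ j l, j ≠ l → ∀ s, 2 ≤ s → s ≤ k → ∫ ω, ‖A ω j l‖ ^ s ∂P ≤ δ)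
    {V : Type*} [DecidableEq V] (e : V ↪ Fin (n + 2)) (W : ℕ → V)
    (hW : ∀ i < k, W i ≠ W (i + 1)) :
    ‖∫ ω, ∏ i ∈ Finset.range k, A ω (e (W i)) (e (W (i + 1))) ∂P‖ ≤
      δ ^ ((Finset.range k).image fun i => s(W i, W (i + 1))).card := by
  classical
  set w : ℕ → Fin (n + 2) := fun i => e (W i)
  have hw : ∀ i < k, w i ≠ w (i + 1) := fun i hi h => hW i hi (e.injective h)
  set sp : ℕ → {e : Fin (n + 2) × Fin (n + 2) // e.1 < e.2} := fun i => sortedPair (w i) (w (i + 1))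
  set S : {e : Fin (n + 2) × Fin (n + 2) // e.1 < e.2} → Finset ℕ := fun c =>
    (Finset.range k).filter fun i => sp i = c
  -- All steps along one edge are collected into a function of the single entry above the diagonal,
  -- conjugated when the edge is crossed in decreasing order.
  set g : {e : Fin (n + 2) × Fin (n + 2) // e.1 < e.2} → ℂ → ℂ := fun c z =>
    ∏ i ∈ S c, if w i < w (i + 1) then z else star z
  have hgm : ∀ c, Measurable (g c) := by
    intro c
    refine Finset.measurable_prod _ fun i _ => ?_
    split_ifs
    · exact measurable_id
    · exact continuous_star.measurable
  have hgn : ∀ c z, ‖g c z‖ = ‖z‖ ^ (S c).card := by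
    intro c z
    simp only [g]
    rw [norm_prod, Finset.prod_congr rfl (g := fun _ => ‖z‖), Finset.prod_const]
    intro i _
    split_ifs
    · rfl
    · rw [norm_star]
  have hprod : ∀ ω, ∏ i ∈ Finset.range k, A ω (w i) (w (i + 1)) =
      ∏ c, g c (A ω c.1.1 c.1.2) := by
    intro ω
    rw [← Finset.prod_fiberwise_of_maps_to (t := Finset.univ) (g := sp)
      (fun i _ => Finset.mem_univ _)]
    refine Finset.prod_congr rfl fun c _ => Finset.prod_congr rfl fun i hi => ?_
    rw [Finset.mem_filter, Finset.mem_range] at hi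
    rw [apply_eq_sortedPair (hh ω) (hw i hi.1), ← hi.2]
  have hfac : ∫ ω, ∏ i ∈ Finset.range k, A ω (w i) (w (i + 1)) ∂P =
      ∏ c, ∫ ω, g c (A ω c.1.1 c.1.2) ∂P := by
    simp_rw [hprod]
    exact hind.integral_fun_prod_comp (fun c => (hA _ _).aemeasurable)
      (fun c => (hgm c).aestronglyMeasurable)
  change ‖∫ ω, ∏ i ∈ Finset.range k, A ω (w i) (w (i + 1)) ∂P‖ ≤ _
  rw [hfac, norm_prod]
  have hout : ∀ c, c ∉ (Finset.range k).image sp → ‖∫ ω, g c (A ω c.1.1 c.1.2) ∂P‖ = 1 := by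
    intro c hc
    have : S c = ∅ := by
      rw [Finset.filter_eq_empty_iff]
      intro i hi h
      exact hc (Finset.mem_image.2 ⟨i, hi, h⟩)
    simp [g, this]
  rw [← Finset.prod_subset (Finset.subset_univ ((Finset.range k).image sp))
    (fun c _ hc => hout c hc)]
  have hcard : ((Finset.range k).image fun i => s(W i, W (i + 1))).card =
      ((Finset.range k).image sp).card := by
    rw [← Finset.card_image_of_injective ((Finset.range k).image sp) sym2_injective_of_lt,
      ← Finset.card_image_of_injective ((Finset.range k).image fun i => s(W i, W (i + 1)))
        (Sym2.map.injective e.injective), Finset.image_image, Finset.image_image]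
    congr 1
    refine Finset.image_congr fun i hi => ?_
    simp only [Function.comp_apply, Sym2.map_mk]
    exact (sym2_sortedPair (hw i (Finset.mem_range.1 hi))).symm
  rw [hcard, ← Finset.prod_const]
  refine Finset.prod_le_prod (fun c _ => norm_nonneg _) fun c hc => ?_
  obtain ⟨i, hi, hic⟩ := Finset.mem_image.1 hc
  have hpos : 0 < (S c).card := Finset.card_pos.2 ⟨i, Finset.mem_filter.2 ⟨hi, hic⟩⟩
  have hle : (S c).card ≤ k := (Finset.card_filter_le _ _).trans (Finset.card_range k).le
  -- An edge used once contributes a mean, where cancellation is needed; from two uses on, the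
  -- absolute moment is already small.
  rcases Nat.lt_or_ge (S c).card 2 with h2 | h2
  · have h1 : (S c).card = 1 := by omega
    obtain ⟨i', hi'⟩ := Finset.card_eq_one.1 h1
    have hmem : i' ∈ S c := by rw [hi']; exact Finset.mem_singleton_self _
    have hk := Finset.mem_range.1 (Finset.mem_filter.1 hmem).1
    have hc' := (Finset.mem_filter.1 hmem).2
    have hg : ∀ ω, g c (A ω c.1.1 c.1.2) = A ω (w i') (w (i' + 1)) := by
      intro ω
      simp only [g]
      rw [hi', Finset.prod_singleton, apply_eq_sortedPair (hh ω) (hw i' hk), ← hc']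
    simp_rw [hg]
    exact hδ1 _ _ (hw i' hk)
  · refine (norm_integral_le_integral_norm _).trans ?_
    simp_rw [hgn]
    exact hδ2 _ _ c.2.ne _ h2 hle

/-- The expectation of the product of the entries along a tree walk. -/
lemma integral_prod_treeWalk (hA : ∀ j k, Measurable fun ω => A ω j k)
    (hh : ∀ ω, (A ω).IsHermitian)
    (hind : iIndepFun (fun (e : {e : Fin (n + 2) × Fin (n + 2) // e.1 < e.2}) ω =>
      A ω e.1.1 e.1.2) P)
    (hid : ∀ (j k j' k' : Fin (n + 2)), j ≠ k → j' ≠ k' →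
      IdentDistrib (fun ω => ‖A ω j k‖) (fun ω => ‖A ω j' k'‖) P P)
    {V : Type*} [Fintype V] [DecidableEq V] (e : V ↪ Fin (n + 2)) {W : ℕ → V} {k : ℕ} {r : V}
    {par : V → V} {depth : V → ℕ} (hW : IsTreeWalk W k r par depth) :
    ∫ ω, ∏ i ∈ Finset.range k, A ω (e (W i)) (e (W (i + 1))) ∂P =
      ((∏ v ∈ Finset.univ.erase r,
        ∫ ω, ‖A ω 0 1‖ ^ (2 * IsTreeWalk.upCount W k par v) ∂P : ℝ) : ℂ) := by
  have hne : ∀ v, v ≠ r → v ≠ par v := by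
    intro v hv h
    have := hW.depth_par v hv
    rw [← h] at this
    omega
  have hne' : ∀ v, v ≠ r → e v ≠ e (par v) := fun v hv h => hne v hv (e.injective h)
  set sp : {v // v ∈ Finset.univ.erase r} → {e : Fin (n + 2) × Fin (n + 2) // e.1 < e.2} :=
    fun v => sortedPair (e v) (e (par v))
  have hmem : ∀ v : {v // v ∈ Finset.univ.erase r}, v.1 ≠ r := fun v => (Finset.mem_erase.1 v.2).1
  have hsp : Function.Injective sp := by
    intro v v' hv
    have h1 := congrArg (fun c : {e : Fin (n + 2) × Fin (n + 2) // e.1 < e.2} => s(c.1.1, c.1.2)) hv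
    simp only [sp] at h1
    rw [sym2_sortedPair (hne' _ (hmem v)), sym2_sortedPair (hne' _ (hmem v')), Sym2.eq_iff] at h1
    rcases h1 with ⟨h1, -⟩ | ⟨h1, h2⟩
    · exact Subtype.ext (e.injective h1)
    · have d1 := hW.depth_par _ (hmem v)
      have d2 := hW.depth_par _ (hmem v')
      rw [e.injective h2] at d1
      rw [← e.injective h1] at d2
      omega
  -- Each entry meets its conjugate equally often, so the product depends on moduli only; identical
  -- distribution of the moduli is therefore enough.
  have hpt : ∀ ω, ∏ i ∈ Finset.range k, A ω (e (W i)) (e (W (i + 1))) =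
      ((∏ v : {v // v ∈ Finset.univ.erase r},
        ‖A ω (sp v).1.1 (sp v).1.2‖ ^ (2 * IsTreeWalk.upCount W k par v) : ℝ) : ℂ) := by
    intro ω
    rw [hW.prod_steps (fun a b => A ω (e a) (e b)), ← Finset.prod_coe_sort]
    push_cast
    refine Finset.prod_congr rfl fun v _ => ?_
    rw [pow_mul, ← norm_apply_eq_sortedPair (hh ω) (hne' _ (hmem v)), ← (hh ω).apply (e (par v)),
      RCLike.star_def, Complex.conj_mul']
  simp_rw [hpt]
  rw [integral_complex_ofReal]
  congr 1
  refine ((hind.precomp hsp).integral_fun_prod_comp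
    (f := fun (v : {v // v ∈ Finset.univ.erase r}) (z : ℂ) =>
      ‖z‖ ^ (2 * IsTreeWalk.upCount W k par v.1))
    (fun v => (hA _ _).aemeasurable)
    (fun v => Measurable.aestronglyMeasurable (by fun_prop))).trans ?_
  rw [← Finset.prod_coe_sort (Finset.univ.erase r)]
  refine Finset.prod_congr rfl fun v _ => ?_
  have := (hid (sp v).1.1 (sp v).1.2 0 1 (sp v).2.ne (by simp)).comp
    (u := fun x => x ^ (2 * IsTreeWalk.upCount W k par v)) (by fun_prop)
  exact this.integral_eq

end Product

/-! ### The limits of the moments -/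

open Classical in
/-- The product of the weights of the edges of a treelike closed walk, where an edge used `2 m`
times has the weight `κ m`. -/
noncomputable def treeWeight (κ : ℕ → ℝ) {k : ℕ} (π : Setoid (Fin (k + 1))) : ℝ :=
  ∏ v ∈ Finset.univ.erase (setoidWalk π 0),
    κ (IsTreeWalk.upCount (setoidWalk π) k (walkParent (setoidWalk π)) v)

open Classical in
/-- The setoids of the coincidences of treelike closed walks of `k` steps. -/
noncomputable def treelikeSetoids (k : ℕ) : Finset (Setoid (Fin (k + 1))) :=
  Finset.univ.filter fun π => setoidWalk π k = setoidWalk π 0 ∧ IsTreelike (setoidWalk π) k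

/-- The limit of the `k`-th moments. -/
noncomputable def limitMoment (κ : ℕ → ℝ) (k : ℕ) : ℝ :=
  ∑ π ∈ treelikeSetoids k, treeWeight κ π

open Classical in
lemma isTreeWalk_of_mem_treelikeSetoids {k : ℕ} {π : Setoid (Fin (k + 1))}
    (hπ : π ∈ treelikeSetoids k) : IsTreeWalk (setoidWalk π) k (setoidWalk π 0)
      (walkParent (setoidWalk π)) (walkDepth (setoidWalk π)) := by
  rw [treelikeSetoids, Finset.mem_filter] at hπ
  exact hπ.2.2.isTreeWalk hπ.2.1 (setoidWalk_surj π)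

section Ensemble

variable {Ω : ℕ → Type*} [∀ n, MeasurableSpace (Ω n)] {P : ∀ n, Measure (Ω n)}
  {C : ∀ n, Ω n → Matrix (Fin n) (Fin n) ℂ} {σ : ℝ} {ν : Measure ℝ} {τ : ℝ} {κ : ℕ → ℝ}

lemma IsLevyKhintchineEnsemble.integral_norm_pow_eq (hC : IsLevyKhintchineEnsemble P C σ ν)
    {n : ℕ} {j l : Fin (n + 2)} (h : j ≠ l) (s : ℕ) :
    ∫ ω, ‖C (n + 2) ω j l‖ ^ s ∂(P (n + 2)) = ∫ ω, ‖C (n + 2) ω 0 1‖ ^ s ∂(P (n + 2)) :=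
  ((hC.identDistrib (n + 2) j l 0 1 h (by simp)).comp (u := fun x => x ^ s) (by fun_prop)).integral_eq

/-- The moments of the entries, multiplied by the size, converge. -/
lemma tendsto_size_mul_moment
    (hκ : ∀ m, 1 ≤ m → Tendsto (fun n : ℕ => ((n : ℝ) + 1) *
        ∫ ω, ‖C (n + 2) ω 0 1‖ ^ (2 * m) ∂(P (n + 2))) atTop (𝓝 (κ m))) {m : ℕ} (hm : 1 ≤ m) :
    Tendsto (fun n : ℕ => ((n : ℝ) + 2) *
        ∫ ω, ‖C (n + 2) ω 0 1‖ ^ (2 * m) ∂(P (n + 2))) atTop (𝓝 (κ m)) := by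
  have h1 : Tendsto (fun n : ℕ => 1 + 1 / ((n : ℝ) + 1)) atTop (𝓝 1) := by
    simpa using (tendsto_one_div_add_atTop_nhds_zero_nat (𝕜 := ℝ)).const_add 1
  have h2 := h1.mul (hκ m hm)
  rw [one_mul] at h2
  refine h2.congr fun n => ?_
  have : (n : ℝ) + 1 ≠ 0 := by positivity
  field_simp
  ring

open Classical in
/-- The contribution of a treelike closed walk. -/
lemma IsLevyKhintchineEnsemble.tendsto_sum_embedding_of_mem_treelikeSetoids
    (hC : IsLevyKhintchineEnsemble P C σ ν)
    (hκ : ∀ m, 1 ≤ m → Tendsto (fun n : ℕ => ((n : ℝ) + 1) *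
        ∫ ω, ‖C (n + 2) ω 0 1‖ ^ (2 * m) ∂(P (n + 2))) atTop (𝓝 (κ m))) {k : ℕ}
    {π : Setoid (Fin (k + 1))} (hπ : π ∈ treelikeSetoids k) :
    Tendsto (fun n : ℕ => ((n : ℂ) + 2)⁻¹ * ∑ e : Quotient π ↪ Fin (n + 2),
      ∫ ω, ∏ i ∈ Finset.range k, C (n + 2) ω (e (setoidWalk π i)) (e (setoidWalk π (i + 1)))
        ∂(P (n + 2))) atTop (𝓝 ((treeWeight κ π : ℝ) : ℂ)) := by
  have hW := isTreeWalk_of_mem_treelikeSetoids hπ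
  have h1 : Tendsto (fun n : ℕ => ∏ v ∈ Finset.univ.erase (setoidWalk π 0),
      (((n : ℝ) + 2) * ∫ ω, ‖C (n + 2) ω 0 1‖ ^ (2 * IsTreeWalk.upCount (setoidWalk π) k
        (walkParent (setoidWalk π)) v) ∂(P (n + 2)))) atTop (𝓝 (treeWeight κ π)) :=
    tendsto_finsetProd _ fun v hv => tendsto_size_mul_moment hκ
      (hW.upCount_pos (Finset.mem_erase.1 hv).1)
  -- The `|V| - 1` factors `n + 2` in the scaled moments, with the prefactor's inverse, match the
  -- `(n + 2)^|V|` that normalizes the number of embeddings.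
  have h2 := (tendsto_descFactorial_div_pow (Fintype.card (Quotient π))).mul h1
  rw [one_mul] at h2
  refine ((Complex.continuous_ofReal.tendsto _).comp h2).congr fun n => ?_
  simp_rw [fun e : Quotient π ↪ Fin (n + 2) => integral_prod_treeWalk (hC.measurable (n + 2))
    (hC.hermitian (n + 2)) (hC.indep (n + 2)) (hC.identDistrib (n + 2)) e hW]
  rw [Finset.sum_const, Finset.card_univ, Fintype.card_embedding_eq, Fintype.card_fin,
    nsmul_eq_mul, Function.comp_apply, Finset.prod_mul_distrib, Finset.prod_const,
    Finset.card_erase_of_mem (Finset.mem_univ _), Finset.card_univ]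
  have hpos : 0 < Fintype.card (Quotient π) := Fintype.card_pos_iff.2 ⟨setoidWalk π 0⟩
  obtain ⟨q, hq⟩ := Nat.exists_eq_succ_of_ne_zero hpos.ne'
  rw [hq, Nat.succ_sub_one]
  have hn : (n : ℂ) + 2 ≠ 0 := by
    have : ((n + 2 : ℕ) : ℂ) ≠ 0 := Nat.cast_ne_zero.2 (by omega)
    push_cast at this
    exact this
  push_cast
  rw [Nat.succ_eq_add_one, pow_succ]
  field_simp

variable [∀ n, IsProbabilityMeasure (P n)]

lemma IsLevyKhintchineEnsemble.integrable_norm_pow (hC : IsLevyKhintchineEnsemble P C σ ν)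
    (hbound : ∀ n (j k : Fin n), ∀ᵐ ω ∂(P n), ‖C n ω j k‖ ≤ τ) (n : ℕ) (j l : Fin n) (s : ℕ) :
    Integrable (fun ω => ‖C n ω j l‖ ^ s) (P n) :=
  Integrable.of_bound ((hC.measurable n j l).norm.pow_const s).aestronglyMeasurable (τ ^ s)
    ((hbound n j l).mono fun ω hω => by
      rw [norm_pow, norm_norm]; exact pow_le_pow_left₀ (norm_nonneg _) hω s)

/-- Means and higher moments of the entries are of order `1 / n`. -/
lemma IsLevyKhintchineEnsemble.exists_entry_bounds (hC : IsLevyKhintchineEnsemble P C σ ν)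
    (hbound : ∀ n (j k : Fin n), ∀ᵐ ω ∂(P n), ‖C n ω j k‖ ≤ τ)
    (hκ : ∀ m, 1 ≤ m → Tendsto (fun n : ℕ => ((n : ℝ) + 1) *
        ∫ ω, ‖C (n + 2) ω 0 1‖ ^ (2 * m) ∂(P (n + 2))) atTop (𝓝 (κ m))) (k : ℕ) :
    ∃ D : ℝ, 0 ≤ D ∧ ∀ n (j l : Fin (n + 2)), j ≠ l →
      ‖∫ ω, C (n + 2) ω j l ∂(P (n + 2))‖ ≤ D / ((n : ℝ) + 2) ∧
      ∀ s, 2 ≤ s → s ≤ k → ∫ ω, ‖C (n + 2) ω j l‖ ^ s ∂(P (n + 2)) ≤ D / ((n : ℝ) + 2) := by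
  obtain ⟨K, hK⟩ := hC.drift
  obtain ⟨B, hB⟩ := (tendsto_size_mul_moment hκ le_rfl).bddAbove_range
  have hB' : ∀ n (j l : Fin (n + 2)), j ≠ l →
      ∫ ω, ‖C (n + 2) ω j l‖ ^ 2 ∂(P (n + 2)) ≤ B / ((n : ℝ) + 2) := by
    intro n j l hjl
    have hn : (0 : ℝ) < (n : ℝ) + 2 := by positivity
    rw [hC.integral_norm_pow_eq hjl, le_div_iff₀ hn, mul_comm]
    exact hB ⟨n, rfl⟩
  have hB0 : 0 ≤ B := by
    have h1 : 0 ≤ B / (((0 : ℕ) : ℝ) + 2) :=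
      (integral_nonneg fun ω => sq_nonneg _).trans (hB' 0 0 1 (by simp))
    have h2 := mul_nonneg h1 (by positivity : (0 : ℝ) ≤ ((0 : ℕ) : ℝ) + 2)
    rwa [div_mul_cancel₀] at h2
    positivity
  have hK0 : 0 ≤ K := by
    have h1 := (norm_nonneg _).trans (hK 2 0 1 (by simp))
    have h2 := mul_nonneg h1 (by positivity : (0 : ℝ) ≤ ((2 : ℕ) : ℝ))
    rwa [div_mul_cancel₀] at h2
    positivity
  set τ₁ := max τ 1
  have hτ1 : 1 ≤ τ₁ := le_max_right _ _
  have hpow1 : 1 ≤ τ₁ ^ k := one_le_pow₀ hτ1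
  refine ⟨K + τ₁ ^ k * B, by positivity, fun n j l hjl => ?_⟩
  have hn : (0 : ℝ) < (n : ℝ) + 2 := by positivity
  have hm := hC.measurable (n + 2) j l
  have hint : Integrable (fun ω => C (n + 2) ω j l) (P (n + 2)) :=
    Integrable.of_bound hm.aestronglyMeasurable τ (hbound (n + 2) j l)
  constructor
  · have hS : MeasurableSet {ω | ‖C (n + 2) ω j l‖ ≤ 1} := measurableSet_le hm.norm measurable_const
    rw [← integral_add_compl hS hint, add_div]
    -- The drift condition controls the part with modulus at most `1`; beyond that, the modulus is
    -- at most its square.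
    refine (norm_add_le _ _).trans (add_le_add ?_ ?_)
    · have := hK (n + 2) j l hjl
      push_cast at this
      exact this
    · calc ‖∫ ω in {ω | ‖C (n + 2) ω j l‖ ≤ 1}ᶜ, C (n + 2) ω j l ∂(P (n + 2))‖
          ≤ ∫ ω in {ω | ‖C (n + 2) ω j l‖ ≤ 1}ᶜ, ‖C (n + 2) ω j l‖ ^ 2 ∂(P (n + 2)) := by
            refine norm_integral_le_of_norm_le
              (hC.integrable_norm_pow hbound (n + 2) j l 2).integrableOn ?_
            rw [ae_restrict_iff' hS.compl]
            refine ae_of_all _ fun ω hω => ?_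
            have : 1 < ‖C (n + 2) ω j l‖ := not_le.1 hω
            nlinarith
        _ ≤ ∫ ω, ‖C (n + 2) ω j l‖ ^ 2 ∂(P (n + 2)) :=
            setIntegral_le_integral (hC.integrable_norm_pow hbound (n + 2) j l 2)
              (ae_of_all _ fun ω => sq_nonneg _)
        _ ≤ B / ((n : ℝ) + 2) := hB' n j l hjl
        _ ≤ τ₁ ^ k * B / ((n : ℝ) + 2) :=
            div_le_div_of_nonneg_right (le_mul_of_one_le_left hB0 hpow1) hn.le
  · intro s hs hsk
    calc ∫ ω, ‖C (n + 2) ω j l‖ ^ s ∂(P (n + 2))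
        ≤ ∫ ω, τ₁ ^ k * ‖C (n + 2) ω j l‖ ^ 2 ∂(P (n + 2)) := by
          refine integral_mono_ae (hC.integrable_norm_pow hbound (n + 2) j l s)
            ((hC.integrable_norm_pow hbound (n + 2) j l 2).const_mul _)
            ((hbound (n + 2) j l).mono fun ω hω => ?_)
          obtain ⟨s', rfl⟩ := Nat.exists_eq_add_of_le hs
          simp only
          rw [pow_add, mul_comm]
          refine mul_le_mul_of_nonneg_right ?_ (sq_nonneg _)
          calc ‖C (n + 2) ω j l‖ ^ s' ≤ τ₁ ^ s' :=
                pow_le_pow_left₀ (norm_nonneg _) (hω.trans (le_max_left _ _)) _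
            _ ≤ τ₁ ^ k := pow_le_pow_right₀ hτ1 (by omega)
      _ ≤ τ₁ ^ k * (B / ((n : ℝ) + 2)) := by
          rw [integral_const_mul]
          exact mul_le_mul_of_nonneg_left (hB' n j l hjl) (by positivity)
      _ ≤ (K + τ₁ ^ k * B) / ((n : ℝ) + 2) := by
          rw [← mul_div_assoc]
          exact div_le_div_of_nonneg_right (by linarith) hn.le

open Classical in
/-- The contribution of the closed walks that are not treelike vanishes in the limit. -/
lemma IsLevyKhintchineEnsemble.tendsto_sum_embedding_of_not_isTreelike
    (hC : IsLevyKhintchineEnsemble P C σ ν)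
    (hbound : ∀ n (j k : Fin n), ∀ᵐ ω ∂(P n), ‖C n ω j k‖ ≤ τ)
    (hκ : ∀ m, 1 ≤ m → Tendsto (fun n : ℕ => ((n : ℝ) + 1) *
        ∫ ω, ‖C (n + 2) ω 0 1‖ ^ (2 * m) ∂(P (n + 2))) atTop (𝓝 (κ m))) {k : ℕ}
    {π : Setoid (Fin (k + 1))} (hπ : ¬ IsTreelike (setoidWalk π) k) :
    Tendsto (fun n : ℕ => ((n : ℂ) + 2)⁻¹ * ∑ e : Quotient π ↪ Fin (n + 2),
      ∫ ω, ∏ i ∈ Finset.range k, C (n + 2) ω (e (setoidWalk π i)) (e (setoidWalk π (i + 1)))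
        ∂(P (n + 2))) atTop (𝓝 0) := by
  -- A repeated vertex in consecutive steps hits the zero diagonal. Otherwise at least `|V|` edges
  -- occur, so the `O(1/n)` edge factors absorb all embeddings and the prefactor tends to `0`.
  by_cases hloop : ∃ i < k, setoidWalk π i = setoidWalk π (i + 1)
  · obtain ⟨i, hi, hii⟩ := hloop
    refine tendsto_const_nhds.congr fun n => ?_
    rw [Finset.sum_eq_zero, mul_zero]
    intro e _
    rw [integral_eq_zero_of_ae]
    refine ae_of_all _ fun ω => Finset.prod_eq_zero (Finset.mem_range.2 hi) ?_
    rw [hii]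
    exact hC.diag _ _ _
  · push Not at hloop
    obtain ⟨D, hD0, hD⟩ := hC.exists_entry_bounds hbound hκ k
    set r := ((Finset.range k).image fun i => s(setoidWalk π i, setoidWalk π (i + 1))).card
    have hr : Fintype.card (Quotient π) ≤ r :=
      (card_le_card_edges_of_not_isTreelike (setoidWalk_surj π) hπ).trans_eq (by
        simp only [r]; congr; exact Subsingleton.elim _ _)
    rw [tendsto_zero_iff_norm_tendsto_zero]
    have hlim : Tendsto (fun n : ℕ => D ^ r / ((n : ℝ) + 2)) atTop (𝓝 0) :=
      (tendsto_atTop_add_const_right _ _ tendsto_natCast_atTop_atTop).const_div_atTop _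
    refine squeeze_zero (fun n => norm_nonneg _) (fun n => ?_) hlim
    have hn : (0 : ℝ) < (n : ℝ) + 2 := by positivity
    have hnorm : ‖((n : ℂ) + 2)⁻¹‖ = ((n : ℝ) + 2)⁻¹ := by
      rw [norm_inv, show ((n : ℂ) + 2) = (((n : ℝ) + 2 : ℝ) : ℂ) by push_cast; rfl,
        Complex.norm_real, Real.norm_of_nonneg hn.le]
    rw [norm_mul, hnorm, div_eq_inv_mul]
    refine mul_le_mul_of_nonneg_left ?_ (inv_nonneg.2 hn.le)
    have hterm : ∀ e : Quotient π ↪ Fin (n + 2),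
        ‖∫ ω, ∏ i ∈ Finset.range k, C (n + 2) ω (e (setoidWalk π i)) (e (setoidWalk π (i + 1)))
          ∂(P (n + 2))‖ ≤ (D / ((n : ℝ) + 2)) ^ r := fun e =>
      norm_integral_prod_le (hC.measurable (n + 2)) (hC.hermitian (n + 2)) (hC.indep (n + 2))
        (fun j l h => (hD n j l h).1) (fun j l h => (hD n j l h).2) e _ hloop
    refine (norm_sum_le _ _).trans ((Finset.sum_le_sum fun e _ => hterm e).trans ?_)
    rw [Finset.sum_const, Finset.card_univ, Fintype.card_embedding_eq, Fintype.card_fin,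
      nsmul_eq_mul, div_pow]
    have h1 : ((n + 2).descFactorial (Fintype.card (Quotient π)) : ℝ) ≤ ((n : ℝ) + 2) ^ r := by
      calc ((n + 2).descFactorial (Fintype.card (Quotient π)) : ℝ)
          ≤ (((n + 2) ^ Fintype.card (Quotient π) : ℕ) : ℝ) := by
            exact_mod_cast Nat.descFactorial_le_pow _ _
        _ = ((n : ℝ) + 2) ^ Fintype.card (Quotient π) := by push_cast; rfl
        _ ≤ ((n : ℝ) + 2) ^ r := pow_le_pow_right₀ (by linarith [(Nat.cast_nonneg n : (0:ℝ) ≤ n)]) hr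
    calc ((n + 2).descFactorial (Fintype.card (Quotient π)) : ℝ) * (D ^ r / ((n : ℝ) + 2) ^ r)
        ≤ ((n : ℝ) + 2) ^ r * (D ^ r / ((n : ℝ) + 2) ^ r) :=
          mul_le_mul_of_nonneg_right h1 (by positivity)
      _ = D ^ r := by field_simp

open Classical in
/-- Convergence of the moments of the expected empirical spectral distributions. -/
theorem IsLevyKhintchineEnsemble.tendsto_realMoment (hC : IsLevyKhintchineEnsemble P C σ ν)
    (hbound : ∀ n (j k : Fin n), ∀ᵐ ω ∂(P n), ‖C n ω j k‖ ≤ τ)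
    (hκ : ∀ m, 1 ≤ m → Tendsto (fun n : ℕ => ((n : ℝ) + 1) *
        ∫ ω, ‖C (n + 2) ω 0 1‖ ^ (2 * m) ∂(P (n + 2))) atTop (𝓝 (κ m))) (k : ℕ) :
    Tendsto (fun n : ℕ => realMoment k (expectedESD (P (n + 2)) (C (n + 2)))) atTop
      (𝓝 (limitMoment κ k)) := by
  have hint : ∀ n (π : Setoid (Fin (k + 1))) (e : Quotient π ↪ Fin (n + 2)),
      Integrable (fun ω => ∏ i ∈ Finset.range k,
        C (n + 2) ω (e (setoidWalk π i)) (e (setoidWalk π (i + 1)))) (P (n + 2)) := by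
    intro n π e
    refine Integrable.of_bound (Finset.measurable_prod _ fun i _ =>
      hC.measurable (n + 2) _ _).aestronglyMeasurable (∏ i ∈ Finset.range k, τ) ?_
    have hae : ∀ᵐ ω ∂(P (n + 2)), ∀ j k, ‖C (n + 2) ω j k‖ ≤ τ := by
      rw [ae_all_iff]; intro j; rw [ae_all_iff]; exact hbound (n + 2) j
    filter_upwards [hae] with ω hω
    rw [norm_prod]
    exact Finset.prod_le_prod (fun _ _ => norm_nonneg _) fun i _ => hω _ _
  have hmom : ∀ n, realMoment k (expectedESD (P (n + 2)) (C (n + 2))) =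
      (∑ π : Setoid (Fin (k + 1)) with setoidWalk π k = setoidWalk π 0,
        (((n : ℂ) + 2)⁻¹ * ∑ e : Quotient π ↪ Fin (n + 2),
          ∫ ω, ∏ i ∈ Finset.range k, C (n + 2) ω (e (setoidWalk π i)) (e (setoidWalk π (i + 1)))
            ∂(P (n + 2)))).re := by
    intro n
    rw [(realMoment_expectedESD (hC.measurable (n + 2)) (hC.hermitian (n + 2))
      (hbound (n + 2)) k).2, ← Finset.mul_sum]
    have hn : ((n : ℂ) + 2)⁻¹ = ((((n + 2 : ℕ) : ℝ)⁻¹ : ℝ) : ℂ) := by push_cast; rfl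
    rw [hn, Complex.re_ofReal_mul]
    congr 1
    have e1 : ∫ ω, ((C (n + 2) ω ^ k).trace).re ∂(P (n + 2)) =
        (∫ ω, (C (n + 2) ω ^ k).trace ∂(P (n + 2))).re := by
      rw [← RCLike.re_eq_complex_re, ← integral_re]
      simp_rw [trace_pow_eq_sum_setoid]
      exact integrable_finsetSum _ fun π _ => integrable_finsetSum _ fun e _ => hint n π e
    rw [e1]
    simp_rw [trace_pow_eq_sum_setoid]
    rw [integral_finsetSum _ fun π _ => integrable_finsetSum _ fun e _ => hint n π e]
    congr 1
    exact Finset.sum_congr rfl fun π _ => integral_finsetSum _ fun e _ => hint n π e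
  simp_rw [hmom]
  have hlim : Tendsto (fun n : ℕ => ∑ π : Setoid (Fin (k + 1)) with setoidWalk π k = setoidWalk π 0,
      (((n : ℂ) + 2)⁻¹ * ∑ e : Quotient π ↪ Fin (n + 2),
        ∫ ω, ∏ i ∈ Finset.range k, C (n + 2) ω (e (setoidWalk π i)) (e (setoidWalk π (i + 1)))
          ∂(P (n + 2)))) atTop
      (𝓝 (∑ π : Setoid (Fin (k + 1)) with setoidWalk π k = setoidWalk π 0,
        if IsTreelike (setoidWalk π) k then ((treeWeight κ π : ℝ) : ℂ) else 0)) := by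
    refine tendsto_finsetSum _ fun π hπ => ?_
    split_ifs with ht
    · exact hC.tendsto_sum_embedding_of_mem_treelikeSetoids hκ
        (Finset.mem_filter.2 ⟨Finset.mem_univ _, (Finset.mem_filter.1 hπ).2, ht⟩)
    · exact hC.tendsto_sum_embedding_of_not_isTreelike hbound hκ ht
  have hre := (Complex.continuous_re.tendsto _).comp hlim
  rw [← Finset.sum_filter, Finset.filter_filter, ← Complex.ofReal_sum, Complex.ofReal_re] at hre
  exact hre

end Ensemble

/-! ### Bounds for the limits of the moments -/

/-- Each of the `ℓ` edges gives one factor `x`, and the exponents of `t` add up to the number of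
steps. -/
lemma treeWeight_le {κ : ℕ → ℝ} {t x : ℝ} (hκ0 : ∀ m, 1 ≤ m → 0 ≤ κ m)
    (hκ : ∀ m, 1 ≤ m → κ m ≤ t ^ (2 * m) * x) {p ℓ : ℕ} {π : Setoid (Fin (2 * p + 1))}
    (hπ : π ∈ treelikeSetoids (2 * p)) (hℓ : Nat.card (Quotient π) = ℓ + 1) :
    treeWeight κ π ≤ t ^ (2 * p) * x ^ ℓ := by
  classical
  have hW := isTreeWalk_of_mem_treelikeSetoids hπ
  have hup : ∀ v ∈ Finset.univ.erase (setoidWalk π 0), 1 ≤ IsTreeWalk.upCount (setoidWalk π) (2 * p)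
      (walkParent (setoidWalk π)) v := fun v hv => hW.upCount_pos (Finset.mem_erase.1 hv).1
  rw [treeWeight]
  refine (Finset.prod_le_prod (fun v hv => hκ0 _ (hup v (by convert hv)))
    fun v hv => hκ _ (hup v (by convert hv))).trans (le_of_eq ?_)
  rw [Finset.prod_mul_distrib, Finset.prod_pow_eq_pow_sum, ← Finset.mul_sum, Finset.prod_const,
    Finset.card_erase_of_mem (Finset.mem_univ _), Finset.card_univ, ← Nat.card_eq_fintype_card, hℓ,
    hW.two_mul_sum_upCount, Nat.add_sub_cancel]

lemma card_quotient_le_of_mem_treelikeSetoids {p : ℕ} {π : Setoid (Fin (2 * p + 1))}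
    (hπ : π ∈ treelikeSetoids (2 * p)) : Nat.card (Quotient π) ≤ p + 1 := by
  classical
  have hW := isTreeWalk_of_mem_treelikeSetoids hπ
  have h1 := hW.two_mul_sum_upCount
  have h2 : (Finset.univ.erase (setoidWalk π 0)).card ≤
      ∑ v ∈ Finset.univ.erase (setoidWalk π 0), IsTreeWalk.upCount (setoidWalk π) (2 * p)
        (walkParent (setoidWalk π)) v := by
    rw [Finset.card_eq_sum_ones]
    exact Finset.sum_le_sum fun v hv => hW.upCount_pos (Finset.mem_erase.1 hv).1
  rw [Finset.card_erase_of_mem (Finset.mem_univ _), Finset.card_univ] at h2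
  rw [Nat.card_eq_fintype_card]
  omega

/-- The bound for the even moments by colored trees. -/
lemma limitMoment_le {κ : ℕ → ℝ} {t x : ℝ} (ht : 0 ≤ t) (hx : 0 ≤ x)
    (hκ0 : ∀ m, 1 ≤ m → 0 ≤ κ m) (hκ : ∀ m, 1 ≤ m → κ m ≤ t ^ (2 * m) * x) (p : ℕ) :
    limitMoment κ (2 * p) ≤
      t ^ (2 * p) * ∑ ℓ ∈ Finset.range (p + 1), (treeCount p ℓ : ℝ) * x ^ ℓ := by
  classical
  have hpos : ∀ π : Setoid (Fin (2 * p + 1)), 0 < Nat.card (Quotient π) := fun π => by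
    have : Nonempty (Quotient π) := ⟨setoidWalk π 0⟩
    exact Nat.card_pos
  rw [limitMoment, ← Finset.sum_fiberwise_of_maps_to (t := Finset.range (p + 1))
    (g := fun π => Nat.card (Quotient π) - 1) (fun π hπ => by
      have := card_quotient_le_of_mem_treelikeSetoids hπ
      have := hpos π
      rw [Finset.mem_range]
      omega), Finset.mul_sum]
  refine Finset.sum_le_sum fun ℓ _ => ?_
  have hcard : ∀ π ∈ (treelikeSetoids (2 * p)).filter (fun π => Nat.card (Quotient π) - 1 = ℓ),
      Nat.card (Quotient π) = ℓ + 1 := by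
    intro π hπ
    have h1 := (Finset.mem_filter.1 hπ).2
    have h2 := hpos π
    omega
  have hle := Finset.sum_le_card_nsmul _ _ _ fun π hπ =>
    treeWeight_le hκ0 hκ (Finset.mem_filter.1 hπ).1 (hcard π hπ)
  refine hle.trans ?_
  rw [nsmul_eq_mul]
  have hS : (((treelikeSetoids (2 * p)).filter
      fun π => Nat.card (Quotient π) - 1 = ℓ).card : ℝ) ≤ treeCount p ℓ := by
    have := card_treelike_le_treeCount p ℓ ((treelikeSetoids (2 * p)).filter
      fun π => Nat.card (Quotient π) - 1 = ℓ) (fun π hπ => by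
        have h1 := (Finset.mem_filter.1 (Finset.mem_filter.1 hπ).1).2
        have h2 := hcard π hπ
        rw [Nat.card_eq_fintype_card] at h2
        exact ⟨h1.1, h1.2, by convert h2⟩)
    exact_mod_cast this
  calc _ ≤ (treeCount p ℓ : ℝ) * (t ^ (2 * p) * x ^ ℓ) :=
        mul_le_mul_of_nonneg_right hS (by positivity)
    _ = _ := by ring

/-- The even moments have at most factorial growth. -/
lemma limitMoment_le_factorial {κ : ℕ → ℝ} {t x : ℝ} (ht : 1 ≤ t) (hx : 0 ≤ x)
    (hκ0 : ∀ m, 1 ≤ m → 0 ≤ κ m) (hκ : ∀ m, 1 ≤ m → κ m ≤ t ^ (2 * m) * x) (p : ℕ) :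
    limitMoment κ (2 * p) ≤
      Real.exp 1 * (2 * Real.exp 1 * (t * max x 1)) ^ (2 * p) * (2 * p).factorial := by
  set y := max x 1
  have hy : 1 ≤ y := le_max_right _ _
  have hweight : ∀ π ∈ treelikeSetoids (2 * p), treeWeight κ π ≤ (t * y) ^ (2 * p) := by
    intro π hπ
    have : Nonempty (Quotient π) := ⟨setoidWalk π 0⟩
    obtain ⟨ℓ, hℓ⟩ := Nat.exists_eq_succ_of_ne_zero (Nat.card_pos (α := Quotient π)).ne'
    have hle := card_quotient_le_of_mem_treelikeSetoids hπ
    refine (treeWeight_le hκ0 hκ hπ hℓ).trans ?_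
    rw [mul_pow]
    refine mul_le_mul_of_nonneg_left ?_ (by positivity)
    exact (pow_le_pow_left₀ hx (le_max_left _ _) _).trans (pow_le_pow_right₀ hy (by omega))
  have hcard : ((treelikeSetoids (2 * p)).card : ℝ) ≤
      Real.exp 1 * (2 * Real.exp 1) ^ (2 * p) * (2 * p).factorial := by
    have h1 : (treelikeSetoids (2 * p)).card ≤ (2 * p + 1) ^ (2 * p + 1) :=
      (Finset.card_le_univ _).trans (card_setoid_fin_le _)
    -- This is `N^N ≤ e^N N!` with `N = 2p + 1`; the extra factor in `(2p+1)!` is absorbed by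
    -- `2^(2p)`, hence the `2` in the growth rate.
    have h2 := Real.pow_div_factorial_le_exp (((2 * p + 1 : ℕ) : ℝ)) (Nat.cast_nonneg _) (2 * p + 1)
    rw [div_le_iff₀ (by exact_mod_cast Nat.factorial_pos _)] at h2
    have h3 : ((2 * p + 1 : ℕ) : ℝ) ≤ 2 ^ (2 * p) := by
      exact_mod_cast Nat.lt_two_pow_self (n := 2 * p)
    calc ((treelikeSetoids (2 * p)).card : ℝ) ≤ ((2 * p + 1 : ℕ) : ℝ) ^ (2 * p + 1) := by
          exact_mod_cast h1
      _ ≤ Real.exp ((2 * p + 1 : ℕ) : ℝ) * ((2 * p + 1).factorial : ℝ) := h2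
      _ = Real.exp 1 * Real.exp 1 ^ (2 * p) * (((2 * p + 1 : ℕ) : ℝ) * (2 * p).factorial) := by
          rw [Nat.factorial_succ, ← Real.exp_one_pow, pow_succ]
          push_cast
          ring
      _ ≤ Real.exp 1 * Real.exp 1 ^ (2 * p) * (2 ^ (2 * p) * (2 * p).factorial) :=
          mul_le_mul_of_nonneg_left (mul_le_mul_of_nonneg_right h3 (Nat.cast_nonneg _))
            (by positivity)
      _ = _ := by rw [mul_pow]; ring
  refine (Finset.sum_le_card_nsmul _ _ _ hweight).trans ?_
  rw [nsmul_eq_mul]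
  calc ((treelikeSetoids (2 * p)).card : ℝ) * (t * y) ^ (2 * p)
      ≤ (Real.exp 1 * (2 * Real.exp 1) ^ (2 * p) * (2 * p).factorial) * (t * y) ^ (2 * p) :=
        mul_le_mul_of_nonneg_right hcard (by positivity)
    _ = _ := by rw [mul_pow (2 * Real.exp 1)]; ring

/-! ### The expected limiting spectral distribution -/

theorem mainTheorem8 {Ω : ℕ → Type*} [∀ n, MeasurableSpace (Ω n)]
    (P : ∀ n, Measure (Ω n)) [∀ n, IsProbabilityMeasure (P n)]
    (C : ∀ n, Ω n → Matrix (Fin n) (Fin n) ℂ) (σ : ℝ) (ν : Measure ℝ)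
    (hC : IsLevyKhintchineEnsemble P C σ ν)
    (τ : ℝ) (hτ : 0 < τ)
    (hbound : ∀ n (j k : Fin n), ∀ᵐ ω ∂(P n), ‖C n ω j k‖ ≤ τ) :
    Integrable (fun x : ℝ => x ^ 2) ν ∧
      ∃ μ : Measure ℝ, IsExpectedLSD P C μ ∧
        (∀ p : ℕ, realMoment (2 * p) μ ≤
          max τ 1 ^ (2 * p) * ∑ ℓ ∈ Finset.range (p + 1),
            (treeCount p ℓ : ℝ) *
              (realMoment 2 ν + ν.real (Set.Icc (-1) 1)ᶜ + σ ^ 2) ^ ℓ) ∧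
        IsDeterminedByMoments μ := by
  obtain ⟨hsq, κ, hκ1, hκ⟩ := hC.exists_tendsto_moments hτ hbound
  refine ⟨hsq, ?_⟩
  set x : ℝ := realMoment 2 ν + ν.real (Set.Icc (-1) 1)ᶜ + σ ^ 2
  -- The tail mass of `ν` enters only as nonnegative slack.
  have hκ1x : κ 1 ≤ x := by
    have : 0 ≤ ν.real (Set.Icc (-1) 1)ᶜ := measureReal_nonneg
    simp only [x]
    linarith
  have hx : 0 ≤ x := by
    have h1 : 0 ≤ realMoment 2 ν := integral_pow_two_mul_nonneg ν 1
    have h2 : 0 ≤ ν.real (Set.Icc (-1) 1)ᶜ := measureReal_nonneg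
    positivity
  have ht : 1 ≤ max τ 1 := le_max_right _ _
  have hκ0 : ∀ m, 1 ≤ m → 0 ≤ κ m := fun m hm => ge_of_tendsto' (hκ m hm) fun n =>
    mul_nonneg (by positivity) (integral_nonneg fun ω => by positivity)
  have hκle : ∀ m, 1 ≤ m → κ m ≤ max τ 1 ^ (2 * m) * x := by
    intro m hm
    -- All but two powers of the modulus are bounded by `max τ 1`; the exponent `2m - 2` is then
    -- enlarged to `2m`, as the base is at least `1`.
    have h1 : κ m ≤ max τ 1 ^ (2 * m) * κ 1 := by
      refine le_of_tendsto_of_tendsto' (hκ m hm) ((hκ 1 le_rfl).const_mul _) fun n => ?_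
      rw [← mul_assoc, mul_comm (max τ 1 ^ (2 * m)), mul_assoc]
      refine mul_le_mul_of_nonneg_left ?_ (by positivity)
      rw [← integral_const_mul]
      refine integral_mono_ae (hC.integrable_norm_pow hbound _ _ _ _)
        ((hC.integrable_norm_pow hbound _ _ _ _).const_mul _)
        ((hbound (n + 2) 0 1).mono fun ω hω => ?_)
      obtain ⟨m, rfl⟩ := Nat.exists_eq_add_of_le' hm
      simp only
      rw [show 2 * (m + 1) = 2 * m + 2 by ring, pow_add]
      refine mul_le_mul_of_nonneg_right ?_ (sq_nonneg _)
      exact (pow_le_pow_left₀ (norm_nonneg _) (hω.trans (le_max_left _ _)) _).trans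
        (pow_le_pow_right₀ ht (by omega))
    exact h1.trans (mul_le_mul_of_nonneg_left hκ1x (by positivity))
  have hprob : ∀ n, IsProbabilityMeasure (expectedESD (P (n + 2)) (C (n + 2))) := fun n =>
    expectedESD_isProbabilityMeasure (hC.measurable (n + 2)) (hC.hermitian (n + 2))
  obtain ⟨μ, hμp, hμw, hμm, hμd⟩ := exists_weaklyConverges_of_tendsto_realMoment
    (μ := fun n => expectedESD (P (n + 2)) (C (n + 2)))
    (fun n k => (realMoment_expectedESD (hC.measurable (n + 2)) (hC.hermitian (n + 2))
      (hbound (n + 2)) k).1)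
    (hC.tendsto_realMoment hbound hκ)
    (R := 2 * Real.exp 1 * (max τ 1 * max x 1))
    (by
      have : 0 < max τ 1 := by linarith
      have : 0 < max x 1 := lt_of_lt_of_le one_pos (le_max_right _ _)
      positivity)
    (limitMoment_le_factorial ht hx hκ0 hκle)
  -- The moment argument runs over sizes `n + 2`, where the entry `(0, 1)` exists; a shift by two
  -- does not affect the limit.
  refine ⟨μ, ⟨hμp, fun f => (tendsto_add_atTop_iff_nat 2).1 (hμw f)⟩, fun p => ?_, hμd⟩
  rw [hμm]
  exact limitMoment_le (by linarith) hx hκ0 hκle p
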